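/- Let $s>\frac32$ and let $f_0\in H^s(\mathbf R)$ be the profile of a homogeneous equilibrium, that is, $f_0\ge 0$ and $\int_{\mathbf R}f_0\,dv=1$ ($f_0$ is identified with its $C^1$ representative). Let $S=\{v\in\mathbf R: f_0'(v)=0\}$ be the set of critical points of $f_0$, and let $0<T_0\le+\infty$ be defined by $$\Big(\frac{2\pi}{T_0}\Big)^2=\max\Big\{0,\ \max_{c\in S}\int_{\mathbf R}\frac{f_0'(v)}{v-c}\,dv\Big\}.$$ Then for every period $0<T<T_0$ there exists $\varepsilon_0>0$ such that the following holds. Let $(f(x,v,t),E(x,t))$, $t\in\mathbf R$, be any weak solution, $T$-periodic in $x$, of the nonlinear Vlasov--Poisson system $$\partial_t f+v\,\partial_x f-E\,\partial_v f=0,\qquad \partial_x E=-\int_{\mathbf R}f\,dv+1,$$ with $f\ge 0$, $f(t)\in L^1((0,T)\times\mathbf R)$ for all $t$, $\int_0^T\!\int_{\mathbf R}f(x,v,0)\,dv\,dx=T$ and $\int_0^T E(x,t)\,dx=0$ for all $t$. (Weak solution: $E(\cdot,t)$ is absolutely continuous and satisfies the Poisson equation almost everywhere, and for every smooth $\varphi(x,v)$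 that is $T$-periodic in $x$ and compactly supported in $v$ and all $t_1,t_2\in\mathbf R$, $$\int_0^T\!\!\int_{\mathbf R}\big(f(t_2)-f(t_1)\big)\varphi\,dv\,dx=\int_{t_1}^{t_2}\!\int_0^T\!\!\int_{\mathbf R}f\,(v\,\partial_x\varphi-E\,\partial_v\varphi)\,dv\,dx\,dt.)$$ If $$\|f(t)-f_0\|_{L^2_xH^s_v}=\Big(\int_0^T\|f(x,\cdot,t)-f_0\|_{H^s(\mathbf R)}^2\,dx\Big)^{1/2}<\varepsilon_0\quad\text{for all }t\in\mathbf R,$$ then $E(x,t)=0$ for all $x,t\in\mathbf R$. -/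

import Mathlib

open MeasureTheory Set
open scoped ENNReal FourierTransform

noncomputable section

namespace VlasovPoisson

/-- The norm of `H^s(ℝ)`, with values in `[0, ∞]`:
`‖u‖² = ∫ (1 + (2πξ)²)^s |û(ξ)|² dξ`, where `û(ξ) = ∫ e^{-2πiξv} u(v) dv` is the Fourier-Plancherel
transform of `u ∈ L²(ℝ)`; it is `∞` if `u ∉ L²(ℝ)` (used for `s ≥ 0` only). -/
def sobolevENorm (s : ℝ) (u : ℝ → ℝ) : ℝ≥0∞ :=
  open scoped Classical in
  if h : MemLp (fun v => (u v : ℂ)) 2 (volume : Measure ℝ) then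
    (∫⁻ ξ : ℝ, ENNReal.ofReal ((1 + (2 * Real.pi * ξ) ^ 2) ^ s) *
      ‖(𝓕 (h.toLp (fun v => (u v : ℂ))) : Lp ℂ 2 (volume : Measure ℝ)) ξ‖ₑ ^ 2) ^ (1 / 2 : ℝ)
  else ⊤

/-- Membership in `H^s(ℝ)`. -/
def MemH (s : ℝ) (u : ℝ → ℝ) : Prop := sobolevENorm s u < ⊤

/-- The norm of `L²_x H^s_v` over one period `0 < x ≤ T`:
`‖g‖² = ∫_0^T ‖g(x, ·)‖²_{H^s} dx`. -/
def mixedENorm (T s : ℝ) (g : ℝ → ℝ → ℝ) : ℝ≥0∞ :=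
  (∫⁻ x in Ioc 0 T, sobolevENorm s (g x) ^ 2) ^ (1 / 2 : ℝ)

/-- `max {0, max_i ∫ f₀'(v) / (v - v_i) dv}`, where `v_i` runs through the critical points of `f₀`
(`ENNReal.ofReal` replaces negative values by `0`). -/
def criticalWaveNumberSq (f₀ : ℝ → ℝ) : ℝ≥0∞ :=
  ⨆ c ∈ {c : ℝ | HasDerivAt f₀ 0 c}, ENNReal.ofReal (∫ v : ℝ, deriv f₀ v / (v - c))

/-- The critical period `T₀ ∈ [0, ∞]`, defined by `(2π / T₀)² = criticalWaveNumberSq f₀`;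
it is `∞` if the right-hand side vanishes. -/
def criticalPeriod (f₀ : ℝ → ℝ) : ℝ≥0∞ :=
  ENNReal.ofReal (2 * Real.pi) / criticalWaveNumberSq f₀ ^ (1 / 2 : ℝ)

/-- Test functions on phase space: smooth, `T`-periodic in `x`, compactly supported in `v`. -/
structure IsTestFunction (T : ℝ) (φ : ℝ → ℝ → ℝ) : Prop where
  smooth : ContDiff ℝ ((⊤ : ℕ∞) : WithTop ℕ∞) (fun p : ℝ × ℝ => φ p.1 p.2)
  periodic : ∀ x v, φ (x + T) v = φ x v
  support : ∃ R : ℝ, ∀ x v, R < |v| → φ x v = 0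

/-- `(f, E)` is a (weak) solution, global in time and `T`-periodic in `x`, of the Vlasov-Poisson
system `∂ₜf + v ∂ₓf - E ∂ᵥf = 0`, `∂ₓE = 1 - ∫ f dv`; here `f t x v ≥ 0` is the distribution
function and `E t x` is the electric field. -/
structure IsSolution (T : ℝ) (f : ℝ → ℝ → ℝ → ℝ) (E : ℝ → ℝ → ℝ) : Prop where
  measurable : Measurable (fun p : ℝ × ℝ × ℝ => f p.1 p.2.1 p.2.2)
  nonneg : ∀ t x v, 0 ≤ f t x v
  periodic_f : ∀ t x v, f t (x + T) v = f t x v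
  periodic_E : ∀ t x, E t (x + T) = E t x
  integrable : ∀ t, IntegrableOn (fun p : ℝ × ℝ => f t p.1 p.2) (Ioc 0 T ×ˢ univ)
  /-- neutrality of the initial state -/
  neutral : ∫ p in Ioc 0 T ×ˢ univ, f 0 p.1 p.2 = T
  /-- the electric field has mean zero -/
  mean_E : ∀ t, ∫ x in (0 : ℝ)..T, E t x = 0
  /-- the Poisson equation: `E t` is absolutely continuous with `∂ₓE = 1 - ∫ f dv` -/
  poisson : ∀ t x y, E t y - E t x = ∫ z in x..y, (1 - ∫ v : ℝ, f t z v)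
  /-- the Vlasov equation, tested against functions of `(x, v)` and integrated in time -/
  vlasov : ∀ φ : ℝ → ℝ → ℝ, IsTestFunction T φ → ∀ t₁ t₂ : ℝ,
    (∫ p in Ioc 0 T ×ˢ univ, f t₂ p.1 p.2 * φ p.1 p.2)
      - (∫ p in Ioc 0 T ×ˢ univ, f t₁ p.1 p.2 * φ p.1 p.2)
      = ∫ t in t₁..t₂, ∫ p in Ioc 0 T ×ˢ univ,
          f t p.1 p.2 * (p.2 * deriv (fun x => φ x p.2) p.1 - E t p.1 * deriv (φ p.1) p.2)

end VlasovPoisson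

end

/-! The perturbation stays small for all times, past and future. This forces the field to be square
integrable in time, and a dispersive estimate on the whole time axis, where no initial data survive,
then bounds the field by half of itself.

Let `ξ = n/T` with `n ≥ 1`, and let `ρ` be the corresponding Fourier coefficient of the charge
density. Duhamel's formula along free transport (`IsSolution.moment_duhamel`), the splitting of the
force into `E f₀ + E (f - f₀)` and the Poisson equation give a Volterra equation `ρ + K * ρ = S`
(`IsSolution.volterra`). Its kernel is `K(τ) = τ f̂₀(ξτ)` for `τ > 0`, and `S` consists of the
freely transported perturbation at time `t₀` and of a term containing `E (f - f₀)`.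

On `L²` of the whole time axis, `u ↦ u + K * u` is a Fourier multiplier with symbol `1 + θ k̂(ω/ξ)`,
where `k̂` is the transform of `memoryKernel` and `θ = ξ⁻² ≤ T²`. A real zero `-c` of `1 + θ k̂`
forces `f₀'(c) = 0` and `∫ f₀'(v)/(v - c) dv = 4π²/θ ≥ (2π/T)²`
(`IsProfile.critical_of_dispersion_eq_zero`), which `T < T₀` excludes. With the Riemann-Lebesgue
lemma and compactness, the symbol is bounded below uniformly in `n`
(`IsProfile.exists_dispersion_lower_bound`). Complex frequencies play no role: `ρ` is truncated to a
time window, and Plancherel's theorem bounds it there by `S`, its past, and its values shortly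
before the end of the window (`lintegral_sq_le_of_volterra`).

The nonlinear part of `S` carries a factor `ξ(t - r)`, one derivative in `v`. Cauchy-Schwarz in time
against a weight that is integrable for `s > 3/2` bounds it in `L²` by the norm of `E (f - f₀)` in
`L²` in time and `x`, `H^s` in `v` (`lintegral_sq_duhamel_le`), hence by `ε₀` times the `L²` norm in
time of `sup |E|`. Conversely `sup |E|²` is controlled by the sum of the `|ρ|²`
(`IsSolution.sq_fieldSup_le`).

The bootstrap `lintegral_eq_zero_of_modes` first yields `∫ sup |E|² dt < ∞`. Sending the window to
the whole axis and the initial time to `-∞` then removes the data and all boundary terms, so that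
`sup |E| = 0` for almost every time. Duhamel's formula extends this to every time
(`IsSolution.field_eq_zero_of_ae`). -/

noncomputable section

namespace VlasovPoisson

/-! ### The Fourier-Plancherel transform on `L¹ ∩ L²`. -/

/-- On `L¹ ∩ L²` the Fourier-Plancherel transform is the Fourier integral. -/
theorem fourier_toLp_ae_eq {u : ℝ → ℂ} (hu : Integrable u) (h : MemLp u 2) :
    ((𝓕 (h.toLp u) : Lp ℂ 2 (volume : Measure ℝ)) : ℝ → ℂ) =ᵐ[volume] 𝓕 u := by
  have hcont : Continuous (𝓕 u) :=
    VectorFourier.fourierIntegral_continuous Real.continuous_fourierChar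
      (by exact continuous_inner) hu
  refine ae_eq_of_integral_contDiff_smul_eq
    ((Lp.memLp _).locallyIntegrable (by norm_num)) hcont.locallyIntegrable ?_
  intro g hg hgs
  have hgs' : HasCompactSupport (fun x => (g x : ℂ)) := hgs.comp_left (g := fun r : ℝ => (r : ℂ)) rfl
  have hg' : ContDiff ℝ ((⊤ : ℕ∞) : WithTop ℕ∞) (fun x => (g x : ℂ)) :=
    Complex.ofRealCLM.contDiff.comp hg
  let G : SchwartzMap ℝ ℂ := hgs'.toSchwartzMap hg'
  have hG : ∀ x, G x = g x := fun x => rfl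
  -- As a tempered distribution, the Plancherel transform of `u` acts on `G` by pairing `u` with `𝓕
  -- G`; the flip formula for integrable functions (`e3`) moves the transform back onto `u`.
  have key := congrArg (fun D => D G) (Lp.fourier_toTemperedDistribution_eq (h.toLp u))
  simp only [TemperedDistribution.fourier_apply, Lp.toTemperedDistribution_apply] at key
  have e1 : ∫ x, g x • (𝓕 (h.toLp u) : Lp ℂ 2 (volume : Measure ℝ)) x
      = ∫ x, G x • (𝓕 (h.toLp u) : Lp ℂ 2 (volume : Measure ℝ)) x := by
    simp [hG]
  rw [e1, ← key]
  have e2 : ∫ x, (𝓕 G) x • (h.toLp u) x = ∫ x, (𝓕 G) x • u x := by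
    apply integral_congr_ae
    filter_upwards [h.coeFn_toLp] with x hx
    rw [hx]
  rw [e2]
  have e3 : ∫ x, 𝓕 (⇑G) x • u x = ∫ x, G x • 𝓕 u x := by
    have := VectorFourier.integral_fourierIntegral_smul_eq_flip (L := innerₗ ℝ) (f := G) (g := u)
      (μ := volume) (ν := volume) Real.continuous_fourierChar (by exact continuous_inner)
      (G.integrable (μ := volume)) hu
    simp only [flip_innerₗ] at this
    exact this
  rw [SchwartzMap.fourier_coe, e3]
  simp [hG]

/-- Plancherel's theorem on `L¹ ∩ L²`. -/
theorem lintegral_enorm_fourier_sq {u : ℝ → ℂ} (hu : Integrable u) (h : MemLp u 2) :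
    ∫⁻ ξ, ‖𝓕 u ξ‖ₑ ^ 2 = ∫⁻ x, ‖u x‖ₑ ^ 2 := by
  have h1 : eLpNorm (𝓕 u) 2 volume = eLpNorm u 2 volume := by
    rw [← eLpNorm_congr_ae (fourier_toLp_ae_eq hu h), ← eLpNorm_congr_ae h.coeFn_toLp,
      ← Lp.enorm_def, ← Lp.enorm_def]
    simp [enorm_eq_nnnorm, nnnorm, Lp.norm_fourier_eq]
  have h2 : ∀ w : ℝ → ℂ, eLpNorm w 2 volume ^ 2 = ∫⁻ x, ‖w x‖ₑ ^ 2 := by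
    intro w
    have := eLpNorm_nnreal_pow_eq_lintegral (f := w) (μ := (volume : Measure ℝ)) (p := 2) two_ne_zero
    simpa using this
  rw [← h2, ← h2, h1]

theorem memLp_two_iff_lintegral {α : Type*} [MeasurableSpace α] {μ : Measure α} {u : α → ℂ}
    (hu : AEStronglyMeasurable u μ) : MemLp u 2 μ ↔ ∫⁻ x, ‖u x‖ₑ ^ 2 ∂μ < ⊤ := by
  have h2 : eLpNorm u 2 μ ^ 2 = ∫⁻ x, ‖u x‖ₑ ^ 2 ∂μ := by
    have := eLpNorm_nnreal_pow_eq_lintegral (f := u) (μ := μ) (p := 2) two_ne_zero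
    simpa using this
  rw [← h2]
  simp [MemLp, hu]

theorem memLp_fourierInv {w : ℝ → ℂ} (hw : Integrable w) (h : MemLp w 2) : MemLp (𝓕⁻ w) 2 := by
  have hcont : Continuous (𝓕 w) :=
    VectorFourier.fourierIntegral_continuous Real.continuous_fourierChar
      (by exact continuous_inner) hw
  have h1 : MemLp (𝓕 w) 2 := by
    rw [memLp_two_iff_lintegral hcont.aestronglyMeasurable, lintegral_enorm_fourier_sq hw h,
      ← memLp_two_iff_lintegral h.1]
    exact h
  have : 𝓕⁻ w = fun x => 𝓕 w (-x) := by
    ext x; exact Real.fourierInv_eq_fourier_neg w x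
  rw [this]
  exact h1.comp_measurePreserving (Measure.measurePreserving_neg volume)

theorem continuous_fourier {u : ℝ → ℂ} (hu : Integrable u) : Continuous (𝓕 u) :=
  VectorFourier.fourierIntegral_continuous Real.continuous_fourierChar
    (by exact continuous_inner) hu

/-! ### Sobolev weights. -/

/-- The weight `(1 + (2πξ)²)^s` of the Sobolev space `H^s(ℝ)`. -/
def sobolevWeight (s ξ : ℝ) : ℝ := (1 + (2 * Real.pi * ξ) ^ 2) ^ s

theorem sobolevWeight_pos (s ξ : ℝ) : 0 < sobolevWeight s ξ := by
  unfold sobolevWeight; positivity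

theorem continuous_sobolevWeight (s : ℝ) : Continuous (sobolevWeight s) := by
  unfold sobolevWeight
  refine Continuous.rpow_const (by fun_prop) (fun ξ => Or.inl ?_)
  positivity

theorem sobolevWeight_mono {p q : ℝ} (h : p ≤ q) (ξ : ℝ) :
    sobolevWeight p ξ ≤ sobolevWeight q ξ :=
  Real.rpow_le_rpow_of_exponent_le (by nlinarith [sq_nonneg (2 * Real.pi * ξ)]) h

theorem sobolevWeight_mul (p q ξ : ℝ) :
    sobolevWeight p ξ * sobolevWeight q ξ = sobolevWeight (p + q) ξ :=
  (Real.rpow_add (by positivity) p q).symm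

theorem sq_le_sobolevWeight_one (ξ : ℝ) : (2 * Real.pi * ξ) ^ 2 ≤ sobolevWeight 1 ξ := by
  simp [sobolevWeight]

theorem abs_rpow_le_sobolevWeight {p : ℝ} (hp : 0 ≤ p) (ξ : ℝ) :
    |2 * Real.pi * ξ| ^ p ≤ sobolevWeight (p / 2) ξ := by
  have : |2 * Real.pi * ξ| ^ p = ((2 * Real.pi * ξ) ^ 2) ^ (p / 2) := by
    rw [← sq_abs, ← Real.rpow_natCast, ← Real.rpow_mul (abs_nonneg _)]
    congr 1; push_cast; ring
  rw [this]
  exact Real.rpow_le_rpow (by positivity) (by linarith) (by linarith)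

theorem integrable_sobolevWeight {r : ℝ} (hr : 1 / 2 < r) : Integrable (sobolevWeight (-r)) := by
  have h : Integrable (fun x : ℝ => ((1 : ℝ) + ‖x‖ ^ 2) ^ (-(2 * r) / 2)) :=
    integrable_rpow_neg_one_add_norm_sq (by simp; linarith)
  have h2 := h.comp_mul_left' (R := 2 * Real.pi) (by positivity)
  refine h2.congr (Filter.Eventually.of_forall fun ξ => ?_)
  simp only [sobolevWeight, Real.norm_eq_abs, sq_abs]
  congr 1; ring

/-- For integrable functions the Sobolev norm dominates the weighted norm of the Fourier
integral. -/
theorem lintegral_sobolevWeight_le {u : ℝ → ℝ} (hu : Integrable u) (s : ℝ) :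
    ∫⁻ ξ, ENNReal.ofReal (sobolevWeight s ξ) * ‖𝓕 (fun v => (u v : ℂ)) ξ‖ₑ ^ 2
      ≤ sobolevENorm s u ^ 2 := by
  unfold sobolevENorm
  split_ifs with h
  · rw [← ENNReal.rpow_natCast, ← ENNReal.rpow_mul]
    norm_num
    refine (lintegral_congr_ae ?_).le
    have hc : Integrable (fun v => (u v : ℂ)) := hu.ofReal
    filter_upwards [fourier_toLp_ae_eq hc h] with ξ hξ
    rw [hξ, sobolevWeight]
  · simp

/-- Cauchy-Schwarz against a Sobolev weight. -/
theorem lintegral_sobolevWeight_mul_lt_top {s p : ℝ} (hp : 1 / 2 < s - p) {u : ℝ → ℂ}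
    (hu : AEMeasurable u)
    (h : ∫⁻ ξ, ENNReal.ofReal (sobolevWeight s ξ) * ‖u ξ‖ₑ ^ 2 < ⊤) :
    ∫⁻ ξ, ENNReal.ofReal (sobolevWeight (p / 2) ξ) * ‖u ξ‖ₑ < ⊤ := by
  have hm : ∀ q, Measurable fun ξ => ENNReal.ofReal (sobolevWeight q ξ) := fun q =>
    (continuous_sobolevWeight q).measurable.ennreal_ofReal
  have h1 := ENNReal.lintegral_mul_le_Lp_mul_Lq (volume : Measure ℝ)
    (Real.HolderConjugate.two_two) (f := fun ξ => ENNReal.ofReal (sobolevWeight ((p - s) / 2) ξ))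
    (g := fun ξ => ENNReal.ofReal (sobolevWeight (s / 2) ξ) * ‖u ξ‖ₑ) (hm _).aemeasurable
    ((hm _).aemeasurable.mul hu.enorm)
  -- The exponent splits as `p/2 = (p - s)/2 + s/2`; the first weight is square integrable because
  -- `s - p > 1/2`.
  have e1 : ∀ ξ, ENNReal.ofReal (sobolevWeight (p / 2) ξ) * ‖u ξ‖ₑ =
      ((fun ξ => ENNReal.ofReal (sobolevWeight ((p - s) / 2) ξ)) *
        (fun ξ => ENNReal.ofReal (sobolevWeight (s / 2) ξ) * ‖u ξ‖ₑ)) ξ := by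
    intro ξ
    rw [Pi.mul_apply, ← mul_assoc, ← ENNReal.ofReal_mul (sobolevWeight_pos _ _).le,
      sobolevWeight_mul]
    congr 3; ring
  simp_rw [e1]
  refine lt_of_le_of_lt h1 (ENNReal.mul_lt_top ?_ ?_)
  · refine ENNReal.rpow_lt_top_of_nonneg (by norm_num) ?_
    have := (integrable_sobolevWeight hp).lintegral_lt_top
    refine (lt_of_le_of_lt (lintegral_mono fun ξ => ?_) this).ne
    rw [ENNReal.rpow_two, ← ENNReal.ofReal_pow (sobolevWeight_pos _ _).le, sq, sobolevWeight_mul]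
    apply le_of_eq; congr 2; ring
  · refine ENNReal.rpow_lt_top_of_nonneg (by norm_num) ?_
    refine (lt_of_le_of_lt (lintegral_mono fun ξ => ?_) h).ne
    rw [ENNReal.rpow_two, mul_pow, ← ENNReal.ofReal_pow (sobolevWeight_pos _ _).le, sq (sobolevWeight _ _),
      sobolevWeight_mul]
    apply le_of_eq; congr 3; ring

/-! ### Regularity of the profile: Hölder continuous derivative and the quotient at critical points.
-/

/-- The regularity of the profile that is used: continuity, integrability and a finite weighted
norm of the Fourier integral. -/
structure IsProfile (s : ℝ) (f₀ : ℝ → ℝ) : Prop where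
  continuous : Continuous f₀
  integrable : Integrable f₀
  weighted : ∫⁻ ξ, ENNReal.ofReal (sobolevWeight s ξ) * ‖𝓕 (fun v => (f₀ v : ℂ)) ξ‖ₑ ^ 2 < ⊤

/-- The Fourier transform of the derivative of the profile. -/
def derivMult (f₀ : ℝ → ℝ) (η : ℝ) : ℂ :=
  (2 * Real.pi * Complex.I * η) * 𝓕 (fun v => (f₀ v : ℂ)) η

namespace IsProfile

variable {s : ℝ} {f₀ : ℝ → ℝ}

theorem ofReal_integrable (h : IsProfile s f₀) : Integrable (fun v => (f₀ v : ℂ)) :=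
  h.integrable.ofReal

theorem continuous_fourier (h : IsProfile s f₀) : Continuous (𝓕 (fun v => (f₀ v : ℂ))) :=
  VlasovPoisson.continuous_fourier h.ofReal_integrable

theorem continuous_derivMult (h : IsProfile s f₀) : Continuous (derivMult f₀) := by
  have := h.continuous_fourier
  unfold derivMult
  fun_prop

/-- Cauchy-Schwarz against the Sobolev weight. The exponents used are `p = 0` (Fourier inversion),
`p = 1` (derivative) and `p = 1 + α` (Hölder continuity of the derivative). -/
theorem integrable_rpow_mul_fourier (h : IsProfile s f₀) {p : ℝ} (hp : 0 ≤ p)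
    (hs : 1 / 2 < s - p) :
    Integrable (fun η => |2 * Real.pi * η| ^ p * ‖𝓕 (fun v => (f₀ v : ℂ)) η‖) := by
  have hc := h.continuous_fourier
  have h1 := lintegral_sobolevWeight_mul_lt_top hs hc.aemeasurable h.weighted
  refine ⟨?_, lt_of_le_of_lt (lintegral_mono fun η => ?_) h1⟩
  · refine Continuous.aestronglyMeasurable ?_
    exact ((by fun_prop : Continuous fun η : ℝ => |2 * Real.pi * η|).rpow_const
      fun _ => Or.inr hp).mul hc.norm
  · rw [enorm_mul, Real.enorm_of_nonneg (by positivity), enorm_norm]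
    gcongr
    exact abs_rpow_le_sobolevWeight hp η

theorem integrable_fourier (h : IsProfile s f₀) (hs : 1 / 2 < s) :
    Integrable (𝓕 (fun v => (f₀ v : ℂ))) := by
  have := h.integrable_rpow_mul_fourier le_rfl (by simpa using hs)
  simp only [Real.rpow_zero, one_mul] at this
  exact (integrable_norm_iff h.continuous_fourier.aestronglyMeasurable).1 this

theorem norm_derivMult (η : ℝ) :
    ‖derivMult f₀ η‖ = |2 * Real.pi * η| * ‖𝓕 (fun v => (f₀ v : ℂ)) η‖ := by
  simp [derivMult, abs_mul]

theorem integrable_derivMult (h : IsProfile s f₀) (hs : 3 / 2 < s) :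
    Integrable (derivMult f₀) := by
  have := h.integrable_rpow_mul_fourier zero_le_one (by linarith)
  rw [← integrable_norm_iff h.continuous_derivMult.aestronglyMeasurable]
  simpa [norm_derivMult] using this

theorem memLp_derivMult (h : IsProfile s f₀) (hs : 1 ≤ s) : MemLp (derivMult f₀) 2 := by
  rw [memLp_two_iff_lintegral h.continuous_derivMult.aestronglyMeasurable]
  refine lt_of_le_of_lt (lintegral_mono fun η => ?_) h.weighted
  rw [← ofReal_norm, norm_derivMult, ENNReal.ofReal_mul (abs_nonneg _), mul_pow,
    ofReal_norm, ← ENNReal.ofReal_pow (abs_nonneg _), sq_abs]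
  gcongr
  exact (sq_le_sobolevWeight_one η).trans (sobolevWeight_mono hs η)

/-- Fourier inversion holds at every point because `f₀` is continuous, and the inversion integral
may be differentiated under the integral sign since `derivMult f₀` is integrable. -/
theorem hasDerivAt_ofReal (h : IsProfile s f₀) (hs : 3 / 2 < s) (v : ℝ) :
    HasDerivAt (fun v => (f₀ v : ℂ)) (𝓕⁻ (derivMult f₀) v) v := by
  have hF := h.integrable_fourier (by linarith)
  have hM := h.integrable_derivMult hs
  have hinv : (fun v => (f₀ v : ℂ)) = fun v => 𝓕 (𝓕 (fun v => (f₀ v : ℂ))) (-v) := by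
    have := Continuous.fourierInv_fourier_eq (f := fun v => (f₀ v : ℂ))
      (by have := h.continuous; fun_prop) h.ofReal_integrable hF
    nth_rw 1 [← this]
    ext v
    exact Real.fourierInv_eq_fourier_neg _ _
  have hF' : Integrable (fun x : ℝ => x • 𝓕 (fun v => (f₀ v : ℂ)) x) := by
    have := hM.const_mul (2 * Real.pi * Complex.I)⁻¹
    refine this.congr (Filter.Eventually.of_forall fun x => ?_)
    simp only [derivMult, Complex.real_smul]
    field_simp
  have h1 := (Real.hasDerivAt_fourier hF hF' (-v)).scomp v (hasDerivAt_neg v)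
  rw [hinv]
  convert! h1 using 1
  rw [Real.fourierInv_eq_fourier_neg]
  have e : derivMult f₀ = (-1 : ℂ) • fun x : ℝ =>
      (-2 * Real.pi * Complex.I * x) • 𝓕 (fun v => (f₀ v : ℂ)) x := by
    ext x; simp [derivMult]
  rw [e]
  simp only [Real.fourier_real_eq, neg_smul, one_smul, Pi.neg_apply, smul_neg, integral_neg]

theorem hasDerivAt (h : IsProfile s f₀) (hs : 3 / 2 < s) (v : ℝ) :
    HasDerivAt f₀ (deriv f₀ v) v := by
  have h1 := (Complex.reCLM.hasFDerivAt.comp_hasDerivAt v (h.hasDerivAt_ofReal hs v))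
  have h2 : HasDerivAt f₀ (𝓕⁻ (derivMult f₀) v).re v := by simpa using! h1
  rwa [h2.deriv]

theorem ofReal_deriv (h : IsProfile s f₀) (hs : 3 / 2 < s) (v : ℝ) :
    ((deriv f₀ v : ℝ) : ℂ) = 𝓕⁻ (derivMult f₀) v :=
  (h.hasDerivAt hs v).ofReal_comp.unique (h.hasDerivAt_ofReal hs v)

theorem memLp_deriv (h : IsProfile s f₀) (hs : 3 / 2 < s) : MemLp (deriv f₀) 2 := by
  have h1 := memLp_fourierInv (h.integrable_derivMult hs) (h.memLp_derivMult (by linarith))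
  have h2 : MemLp (fun v => ((deriv f₀ v : ℝ) : ℂ)) 2 := by
    convert h1 using 2 with v
    exact h.ofReal_deriv hs v
  simpa using! h2.re

theorem continuous_deriv (h : IsProfile s f₀) (hs : 3 / 2 < s) : Continuous (deriv f₀) := by
  have h1 : deriv f₀ = fun v => (𝓕 (derivMult f₀) (-v)).re := by
    ext v
    rw [← Real.fourierInv_eq_fourier_neg, ← h.ofReal_deriv hs v, Complex.ofReal_re]
  rw [h1]
  exact Complex.continuous_re.comp
    ((VlasovPoisson.continuous_fourier (h.integrable_derivMult hs)).comp continuous_neg)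

/-- The derivative of the profile is Hölder continuous. -/
theorem exists_holder (h : IsProfile s f₀) (hs : 3 / 2 < s) :
    ∃ α C : ℝ, 0 < α ∧ α ≤ 1 ∧ ∀ v w, |deriv f₀ v - deriv f₀ w| ≤ C * |v - w| ^ α := by
  -- Any `α < s - 3/2` leaves enough decay of the transform; half of the gap keeps the inequality
  -- strict.
  obtain ⟨α, hα0, hα1, hαs⟩ : ∃ α : ℝ, 0 < α ∧ α ≤ 1 ∧ 1 / 2 < s - (1 + α) :=
    ⟨min 1 ((s - 3 / 2) / 2), by apply lt_min <;> linarith, min_le_left _ _, by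
      have := min_le_right 1 ((s - 3 / 2) / 2); linarith⟩
  have hint := h.integrable_rpow_mul_fourier (by linarith) hαs
  refine ⟨α, 2 * ∫ η, |2 * Real.pi * η| ^ (1 + α) * ‖𝓕 (fun v => (f₀ v : ℂ)) η‖, hα0, hα1,
    fun v w => ?_⟩
  have hM := h.integrable_derivMult hs
  have e : ((deriv f₀ v - deriv f₀ w : ℝ) : ℂ) =
      ∫ η, (Real.fourierChar (η * v) - Real.fourierChar (η * w) : ℂ) * derivMult f₀ η := by
    push_cast
    rw [h.ofReal_deriv hs, h.ofReal_deriv hs, Real.fourierInv_eq, Real.fourierInv_eq,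
      ← integral_sub]
    · congr 1; ext η
      simp only [Circle.smul_def, smul_eq_mul, RCLike.inner_apply, conj_trivial, sub_mul, mul_comm v, mul_comm w]
    · have := (Real.fourierIntegral_convergent_iff (-v)).2 hM
      simpa using! this
    · have := (Real.fourierIntegral_convergent_iff (-w)).2 hM
      simpa using! this
  have hb : ∀ η, ‖(Real.fourierChar (η * v) - Real.fourierChar (η * w) : ℂ) * derivMult f₀ η‖ ≤
      |v - w| ^ α * 2 * (|2 * Real.pi * η| ^ (1 + α) * ‖𝓕 (fun v => (f₀ v : ℂ)) η‖) := by
    intro η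
    -- Interpolation between `|e^{iy} - 1| ≤ |y|` and `|e^{iy} - 1| ≤ 2`.
    have h1 : ‖(Real.fourierChar (η * v) - Real.fourierChar (η * w) : ℂ)‖ ≤
        2 * (|2 * Real.pi * η| * |v - w|) ^ α := by
      have ha : (Real.fourierChar (η * v) - Real.fourierChar (η * w) : ℂ) =
          Real.fourierChar (η * w) * (Complex.exp (Complex.I * (2 * Real.pi * η * (v - w) : ℝ)) - 1) := by
        rw [Real.fourierChar_apply, Real.fourierChar_apply, mul_sub, mul_one, ← Complex.exp_add]
        congr 2; push_cast; ring
      have hl : ‖(Real.fourierChar (η * v) - Real.fourierChar (η * w) : ℂ)‖ ≤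
          |2 * Real.pi * η| * |v - w| := by
        rw [ha, norm_mul, Circle.norm_coe, one_mul]
        refine (Real.norm_exp_I_mul_ofReal_sub_one_le).trans ?_
        rw [Real.norm_eq_abs, abs_mul]
      have h2 : ‖(Real.fourierChar (η * v) - Real.fourierChar (η * w) : ℂ)‖ ≤ 2 := by
        refine (norm_sub_le _ _).trans ?_
        rw [Circle.norm_coe, Circle.norm_coe]; norm_num
      rcases le_total (|2 * Real.pi * η| * |v - w|) 1 with h3 | h3
      · have := Real.rpow_le_rpow_of_exponent_ge_of_imp (by positivity) h3 hα1
          (fun h => by intro h'; linarith)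
        rw [Real.rpow_one] at this
        have := Real.rpow_nonneg (by positivity : (0:ℝ) ≤ |2 * Real.pi * η| * |v - w|) α
        linarith
      · have := Real.one_le_rpow h3 hα0.le
        linarith
    rw [norm_mul, norm_derivMult]
    calc _ ≤ (2 * (|2 * Real.pi * η| * |v - w|) ^ α) *
          (|2 * Real.pi * η| * ‖𝓕 (fun v => (f₀ v : ℂ)) η‖) := by gcongr
      _ = _ := by
        rw [Real.mul_rpow (abs_nonneg _) (abs_nonneg _),
          Real.rpow_add_of_nonneg (abs_nonneg _) zero_le_one hα0.le, Real.rpow_one]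
        ring
  calc |deriv f₀ v - deriv f₀ w| = ‖((deriv f₀ v - deriv f₀ w : ℝ) : ℂ)‖ :=
        (Complex.norm_real _).symm
    _ ≤ ∫ η, |v - w| ^ α * 2 * (|2 * Real.pi * η| ^ (1 + α) * ‖𝓕 (fun v => (f₀ v : ℂ)) η‖) := by
      rw [e]
      exact norm_integral_le_of_norm_le (hint.const_mul _) (Filter.Eventually.of_forall hb)
    _ = _ := by rw [integral_const_mul]; ring

/-- At a critical point of the profile the quotient `f₀'(v) / (v - c)` is integrable. -/
theorem integrable_deriv_div (h : IsProfile s f₀) (hs : 3 / 2 < s) {c : ℝ}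
    (hc : deriv f₀ c = 0) : Integrable (fun v => deriv f₀ v / (v - c)) := by
  obtain ⟨α, C, hα0, hα1, hC⟩ := h.exists_holder hs
  have hmeas : AEStronglyMeasurable (fun v => deriv f₀ v / (v - c)) volume :=
    ((h.continuous_deriv hs).measurable.div (by fun_prop)).aestronglyMeasurable
  -- Near `c`, the Hölder bound together with `f₀'(c) = 0` gives the integrable majorant `C |v -
  -- c|^(α - 1)`.
  have hnear : IntegrableOn (fun v => deriv f₀ v / (v - c)) (Icc (c - 1) (c + 1)) := by
    have h0 : IntegrableOn (fun v : ℝ => |v| ^ (α - 1)) (Icc (-1) 1) := by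
      have h1 := (intervalIntegral.intervalIntegrable_rpow' (a := 0) (b := 1)
        (r := α - 1) (by linarith))
      have h1' : IntegrableOn (fun v : ℝ => |v| ^ (α - 1)) (Ioc 0 1) := by
        rw [intervalIntegrable_iff_integrableOn_Ioc_of_le zero_le_one] at h1
        refine h1.congr_fun (fun v hv => ?_) measurableSet_Ioc
        simp [abs_of_pos hv.1]
      have h2 : IntegrableOn (fun v : ℝ => |v| ^ (α - 1)) (Ico (-1) 0) := by
        have := (Measure.measurePreserving_neg (volume : Measure ℝ)).integrableOn_comp_preimage
          (Homeomorph.neg ℝ).measurableEmbedding (f := fun v : ℝ => |v| ^ (α - 1)) (s := Ioc 0 1)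
        have h3 := this.2 h1'
        simpa [Function.comp_def] using! h3
      have h3 : IntegrableOn (fun v : ℝ => |v| ^ (α - 1)) (Icc 0 1) := by
        rwa [integrableOn_Icc_iff_integrableOn_Ioc]
      refine (h2.union h3).mono_set fun x hx => ?_
      rcases lt_or_ge x 0 with h | h
      · exact Or.inl ⟨hx.1, h⟩
      · exact Or.inr ⟨h, hx.2⟩
    have h1 : IntegrableOn (fun v : ℝ => |v - c| ^ (α - 1)) (Icc (c - 1) (c + 1)) := by
      have := (measurePreserving_sub_right (volume : Measure ℝ) c).integrableOn_comp_preimage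
        (Homeomorph.subRight c).measurableEmbedding (f := fun v : ℝ => |v| ^ (α - 1))
        (s := Icc (-1) 1)
      have h3 := this.2 h0
      have e : (fun x => x - c) ⁻¹' Icc (-1) 1 = Icc (c - 1) (c + 1) := by
        ext x; simp only [mem_preimage, mem_Icc]; constructor <;> rintro ⟨h1, h2⟩ <;>
          constructor <;> linarith
      rw [e] at h3
      simpa [Function.comp_def] using! h3
    refine (h1.const_mul C).mono' hmeas.restrict (Filter.Eventually.of_forall fun v => ?_)
    have h2 := hC v c
    rw [hc, sub_zero] at h2
    rcases eq_or_ne v c with rfl | hv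
    · simp only [sub_self, div_zero, norm_zero]
      have : 0 ≤ C := by
        have := (abs_nonneg _).trans (hC 1 0)
        simpa using this
      positivity
    · have h3 : 0 < |v - c| := abs_pos.2 (sub_ne_zero.2 hv)
      rw [Real.norm_eq_abs, abs_div, div_le_iff₀ h3, mul_assoc, ← Real.rpow_add_one h3.ne']
      simpa using h2
  -- Away from `c` the quotient is a product of two square integrable functions.
  have hfar : IntegrableOn (fun v => deriv f₀ v / (v - c)) (Icc (c - 1) (c + 1))ᶜ := by
    have h1 : MemLp (fun v => (v - c)⁻¹) 2 (volume.restrict (Icc (c - 1) (c + 1))ᶜ) := by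
      rw [memLp_two_iff_integrable_sq (by
        exact (Measurable.inv (by fun_prop)).aestronglyMeasurable)]
      have h2 : Integrable (fun v : ℝ => 2 * (1 + (v - c) ^ 2)⁻¹) :=
        (integrable_inv_one_add_sq.comp_sub_right c).const_mul 2
      refine h2.restrict.mono' (Measurable.aestronglyMeasurable (by fun_prop)) ?_
      rw [ae_restrict_iff' measurableSet_Icc.compl]
      refine Filter.Eventually.of_forall fun v hv => ?_
      have h3 : 1 ≤ (v - c) ^ 2 := by
        by_contra! h4
        have h5 := abs_lt.1 ((sq_lt_one_iff_abs_lt_one _).1 h4)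
        exact hv ⟨by linarith, by linarith⟩
      rw [Real.norm_of_nonneg (by positivity), inv_pow, ← div_eq_mul_inv, inv_eq_one_div,
        div_le_div_iff₀ (by positivity) (by positivity)]
      linarith
    exact ((h.memLp_deriv hs).restrict _).integrable_mul h1
  have := hnear.union hfar
  rwa [union_compl_self, integrableOn_univ] at this

end IsProfile

/-! ### Damped half-line Fourier integrals. -/

theorem integrableOn_mul_exp_neg {δ : ℝ} (hδ : 0 < δ) :
    IntegrableOn (fun η : ℝ => η * Real.exp (-δ * η)) (Ioi 0) := by
  have := integrableOn_rpow_mul_exp_neg_mul_rpow (p := 1) (s := 1) (b := δ) (by norm_num)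
    one_pos hδ
  simpa using this

theorem norm_mul_cexp_neg (r : ℂ) {η : ℝ} (hη : 0 ≤ η) :
    ‖(η : ℂ) * Complex.exp (-r * η)‖ = η * Real.exp (-r.re * η) := by
  rw [norm_mul, Complex.norm_real, Real.norm_of_nonneg hη, Complex.norm_exp]
  simp

theorem integrableOn_mul_cexp_neg {r : ℂ} (hr : 0 < r.re) :
    IntegrableOn (fun η : ℝ => (η : ℂ) * Complex.exp (-r * η)) (Ioi 0) := by
  refine Integrable.mono' (integrableOn_mul_exp_neg hr)
    (Continuous.aestronglyMeasurable (by fun_prop)) ?_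
  rw [ae_restrict_iff' measurableSet_Ioi]
  exact Filter.Eventually.of_forall fun η hη => (norm_mul_cexp_neg r (mem_Ioi.1 hη).le).le

/-- An explicit primitive that vanishes at infinity. It is needed for `r = δ + 2πi(v - c)`, where
the damping `δ > 0` is the real part. -/
theorem integral_mul_cexp_neg {r : ℂ} (hr : 0 < r.re) :
    ∫ η in Ioi (0 : ℝ), (η : ℂ) * Complex.exp (-r * η) = 1 / r ^ 2 := by
  have hr0 : r ≠ 0 := by rintro rfl; simp at hr
  have hd : ∀ x ∈ Ici (0 : ℝ), HasDerivAt
      (fun η : ℝ => -((η : ℂ) / r + 1 / r ^ 2) * Complex.exp (-r * η))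
      ((x : ℂ) * Complex.exp (-r * x)) x := by
    intro x _
    have h1 : HasDerivAt (fun η : ℝ => (η : ℂ)) 1 x := Complex.ofRealCLM.hasDerivAt
    have h2 : HasDerivAt (fun η : ℝ => -r * (η : ℂ)) (-r) x := by
      simpa using h1.const_mul (-r)
    have h3 := h2.cexp
    have h4 := (((h1.div_const r).add_const (1 / r ^ 2)).fun_neg).mul h3
    convert! h4 using 1
    field_simp
    ring
  have hlim : Filter.Tendsto (fun η : ℝ => -((η : ℂ) / r + 1 / r ^ 2) * Complex.exp (-r * η))
      Filter.atTop (nhds 0) := by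
    have ha : Filter.Tendsto (fun η : ℝ => (η : ℂ) * Complex.exp (-r * η)) Filter.atTop (nhds 0) := by
      rw [tendsto_zero_iff_norm_tendsto_zero]
      have := (Real.tendsto_pow_mul_exp_neg_atTop_nhds_zero 1).comp
        (Filter.tendsto_id.const_mul_atTop hr)
      have h2 := this.const_mul (r.re⁻¹)
      rw [mul_zero] at h2
      refine h2.congr' ?_
      filter_upwards [Filter.eventually_ge_atTop 0] with η hη
      rw [norm_mul_cexp_neg r hη]
      simp only [Function.comp_apply, id, pow_one]
      field_simp
    have hb : Filter.Tendsto (fun η : ℝ => Complex.exp (-r * η)) Filter.atTop (nhds 0) := by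
      rw [tendsto_zero_iff_norm_tendsto_zero]
      have := Real.tendsto_exp_neg_atTop_nhds_zero.comp (Filter.tendsto_id.const_mul_atTop hr)
      refine this.congr fun η => ?_
      simp [Complex.norm_exp]
    have := ((ha.const_mul (-r⁻¹)).add (hb.const_mul (-(1 / r ^ 2))))
    simp only [mul_zero, add_zero] at this
    refine this.congr fun η => ?_
    ring
  have := integral_Ioi_of_hasDerivAt_of_tendsto' hd (integrableOn_mul_cexp_neg hr) hlim
  rw [this]
  simp

namespace IsProfile

variable {s : ℝ} {f₀ : ℝ → ℝ}

/-- The derivative is in `L²`, and so is the resolvent factor: `δ > 0` keeps it bounded near `c`,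
and it decays like `1/|v|`. -/
theorem integrable_deriv_mul_inv (h : IsProfile s f₀) (hs : 3 / 2 < s) (c : ℝ) {δ : ℝ}
    (hδ : 0 < δ) :
    Integrable (fun v => ((deriv f₀ v : ℝ) : ℂ) * ((δ : ℂ) + 2 * Real.pi * Complex.I * (v - c))⁻¹) := by
  have hre : ∀ v : ℝ, ((δ : ℂ) + 2 * Real.pi * Complex.I * (v - c)) ≠ 0 := by
    intro v h0
    have := congrArg Complex.re h0
    simp at this
    linarith
  have hc : Continuous fun v : ℝ => ((δ : ℂ) + 2 * Real.pi * Complex.I * (v - c))⁻¹ :=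
    Continuous.inv₀ (by fun_prop) hre
  have h2 : MemLp (fun v : ℝ => ((δ : ℂ) + 2 * Real.pi * Complex.I * (v - c))⁻¹) 2 := by
    have h2 : Integrable (fun v : ℝ => (min (δ ^ 2) ((2 * Real.pi) ^ 2))⁻¹ * (1 + (v - c) ^ 2)⁻¹) :=
      (integrable_inv_one_add_sq.comp_sub_right c).const_mul _
    rw [memLp_two_iff_integrable_sq_norm hc.aestronglyMeasurable]
    refine h2.mono' (hc.norm.pow 2).aestronglyMeasurable
      (Filter.Eventually.of_forall fun v => ?_)
    have e : ‖(δ : ℂ) + 2 * Real.pi * Complex.I * (v - c)‖ ^ 2 =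
        δ ^ 2 + (2 * Real.pi) ^ 2 * (v - c) ^ 2 := by
      rw [← Complex.normSq_eq_norm_sq, Complex.normSq_apply]
      simp
      ring
    rw [Real.norm_of_nonneg (by positivity), norm_inv, inv_pow, e, ← mul_inv]
    have hm : 0 < min (δ ^ 2) ((2 * Real.pi) ^ 2) := by
      apply lt_min <;> positivity
    apply inv_anti₀ (by positivity)
    have := min_le_left (δ ^ 2) ((2 * Real.pi) ^ 2)
    have := min_le_right (δ ^ 2) ((2 * Real.pi) ^ 2)
    nlinarith [sq_nonneg (v - c)]
  have h3 : MemLp (fun v => ((deriv f₀ v : ℝ) : ℂ)) 2 := (h.memLp_deriv hs).ofReal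
  exact h3.integrable_mul h2

/-- The half-line Fourier integral of the derivative of the profile, damped by `e^{-δη}`. -/
theorem integral_exp_mul_derivMult (h : IsProfile s f₀) (hs : 3 / 2 < s) (c : ℝ) {δ : ℝ}
    (hδ : 0 < δ) :
    ∫ η in Ioi (0 : ℝ), Complex.exp (-δ * η) * (derivMult f₀ η * Real.fourierChar (η * c)) =
      ∫ v, ((deriv f₀ v : ℝ) : ℂ) * ((δ : ℂ) + 2 * Real.pi * Complex.I * (v - c))⁻¹ := by
  set r : ℝ → ℂ := fun v => (δ : ℂ) + 2 * Real.pi * Complex.I * (v - c) with hr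
  have hre : ∀ v, (r v).re = δ := by intro v; simp [hr]
  have hr0 : ∀ v, r v ≠ 0 := by intro v h0; have := hre v; rw [h0] at this; simp at this; linarith
  have hrd : ∀ v, HasDerivAt (fun v => (r v)⁻¹)
      (-(2 * Real.pi * Complex.I) / (r v) ^ 2) v := by
    intro v
    have h1 : HasDerivAt (fun η : ℝ => (η : ℂ)) 1 v := Complex.ofRealCLM.hasDerivAt
    have h2 : HasDerivAt r (2 * Real.pi * Complex.I) v := by
      have := (((h1.sub_const (c : ℂ)).const_mul (2 * Real.pi * Complex.I)).const_add (δ : ℂ))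
      rwa [mul_one] at this
    exact h2.fun_inv (hr0 v)
  -- Fubini is applied with `f₀`, which is integrable, instead of `f₀'`, which is only known to be
  -- in `L²`; the integration by parts `ibp` restores the derivative afterwards.
  have e1 : ∀ η ∈ Ioi (0 : ℝ),
      Complex.exp (-δ * η) * (derivMult f₀ η * Real.fourierChar (η * c)) =
      ∫ v, (2 * Real.pi * Complex.I) * (((η : ℂ) * Complex.exp (-(r v) * η)) * f₀ v) := by
    intro η _
    rw [derivMult, Real.fourier_real_eq_integral_exp_smul, Real.fourierChar_apply,
      ← integral_const_mul, ← integral_mul_const, ← integral_const_mul]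
    congr 1; ext v
    have : Complex.exp (-(r v) * η) = Complex.exp (-δ * η) *
        Complex.exp (((-2 * Real.pi * v * η : ℝ) : ℂ) * Complex.I) *
        Complex.exp (((2 * Real.pi * (η * c) : ℝ) : ℂ) * Complex.I) := by
      rw [← Complex.exp_add, ← Complex.exp_add]
      congr 1
      simp only [hr]; push_cast; ring
    rw [this, smul_eq_mul]
    ring
  rw [setIntegral_congr_fun measurableSet_Ioi e1, integral_integral_swap]
  · have e2 : ∀ v, ∫ η in Ioi (0 : ℝ),
        (2 * Real.pi * Complex.I) * (((η : ℂ) * Complex.exp (-(r v) * η)) * f₀ v) =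
        - ((f₀ v : ℂ) * (-(2 * Real.pi * Complex.I) / (r v) ^ 2)) := by
      intro v
      rw [integral_const_mul, integral_mul_const, integral_mul_cexp_neg (by rw [hre]; exact hδ)]
      ring
    simp_rw [e2]
    rw [integral_neg]
    have hbnd : ∀ v, ‖(r v)⁻¹‖ ≤ δ⁻¹ := by
      intro v
      rw [norm_inv]
      apply inv_anti₀ hδ
      calc δ = |(r v).re| := by rw [hre, abs_of_pos hδ]
        _ ≤ _ := Complex.abs_re_le_norm _
    have hrc : Continuous fun v => (r v)⁻¹ :=
      Continuous.inv₀ (by simp only [hr]; fun_prop) hr0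
    have ibp := integral_mul_deriv_eq_deriv_mul_of_integrable (u := fun v => (f₀ v : ℂ))
      (v := fun v => (r v)⁻¹) (u' := fun v => ((deriv f₀ v : ℝ) : ℂ))
      (v' := fun v => -(2 * Real.pi * Complex.I) / (r v) ^ 2)
      (fun v _ => (h.hasDerivAt hs v).ofReal_comp) (fun v _ => hrd v) ?_
      (h.integrable_deriv_mul_inv hs c hδ) ?_
    · rw [ibp, neg_neg]
    · have e3 : ((fun v => (f₀ v : ℂ)) * fun v => -(2 * Real.pi * Complex.I) / (r v) ^ 2) =
          fun v => (f₀ v : ℂ) * (-(2 * Real.pi * Complex.I) * (r v)⁻¹ ^ 2) := by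
        ext v; simp [div_eq_mul_inv]
      rw [e3]
      refine h.ofReal_integrable.mul_bdd (c := ‖2 * Real.pi * Complex.I‖ * δ⁻¹ ^ 2)
        (Continuous.aestronglyMeasurable (by fun_prop))
        (Filter.Eventually.of_forall fun v => ?_)
      rw [norm_mul, norm_neg, norm_pow]
      gcongr
      exact hbnd v
    · exact h.ofReal_integrable.mul_bdd (c := δ⁻¹) hrc.aestronglyMeasurable
        (Filter.Eventually.of_forall hbnd)
  · have h1 := ((integrableOn_mul_exp_neg hδ).norm.mul_prod h.integrable.norm).const_mul
      ‖2 * Real.pi * Complex.I‖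
    refine h1.mono' ?_ (Filter.Eventually.of_forall ?_)
    · have := h.continuous
      refine Continuous.aestronglyMeasurable ?_
      simp only [Function.uncurry_def, hr]
      fun_prop
    · rintro ⟨η, v⟩
      simp only [Function.uncurry_apply_pair, norm_mul, Complex.norm_real, Complex.norm_exp]
      rw [← hre v]
      simp

end IsProfile

/-! ### The dispersion function on the real line and the critical period. -/

/-- The memory kernel `τ ↦ τ f̂₀(τ)`, `τ > 0`, of the linearized equation. -/
def memoryKernel (f₀ : ℝ → ℝ) : ℝ → ℂ :=
  (Ioi (0 : ℝ)).indicator fun η => (η : ℂ) * 𝓕 (fun v => (f₀ v : ℂ)) η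

namespace IsProfile

variable {s : ℝ} {f₀ : ℝ → ℝ}

theorem integrable_memoryKernel (h : IsProfile s f₀) (hs : 3 / 2 < s) :
    Integrable (memoryKernel f₀) := by
  refine Integrable.indicator ?_ measurableSet_Ioi
  have := (h.integrable_derivMult hs).const_mul (2 * Real.pi * Complex.I)⁻¹
  refine this.congr (Filter.Eventually.of_forall fun x => ?_)
  simp only [derivMult]
  field_simp

/-- Links the time frequency `-c` of the Volterra kernel with the velocity `c`: up to `2πi`, the
symbol is half of the Fourier inversion integral of `f₀'` at `c`. -/
theorem fourier_memoryKernel (c : ℝ) :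
    (2 * Real.pi * Complex.I) * 𝓕 (memoryKernel f₀) (-c) =
      ∫ η in Ioi (0 : ℝ), derivMult f₀ η * Real.fourierChar (η * c) := by
  rw [Real.fourier_real_eq, ← integral_const_mul, ← integral_indicator measurableSet_Ioi]
  congr 1; ext η
  by_cases hη : η ∈ Ioi (0 : ℝ)
  · simp only [memoryKernel, indicator_of_mem hη, Circle.smul_def, smul_eq_mul, derivMult, mul_neg,
      neg_neg]
    ring
  · simp [memoryKernel, indicator_of_notMem hη]

/-- `f₀` is real. Hence the two half-line parts of the inversion integral of `f₀'` are complex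
conjugates. -/
theorem derivMult_neg (η : ℝ) :
    derivMult f₀ (-η) = (starRingEnd ℂ) (derivMult f₀ η) := by
  have h2 : (starRingEnd ℂ) 2 = 2 := map_ofNat _ 2
  have h1 : 𝓕 (fun v => (f₀ v : ℂ)) (-η) = (starRingEnd ℂ) (𝓕 (fun v => (f₀ v : ℂ)) η) := by
    rw [Real.fourier_real_eq_integral_exp_smul, Real.fourier_real_eq_integral_exp_smul,
      ← integral_conj]
    congr 1; ext v
    simp [← Complex.exp_conj, h2]
  simp [derivMult, h1, h2]

/-- The boundary values of the dispersion function: real part. -/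
theorem re_integral_derivMult (h : IsProfile s f₀) (hs : 3 / 2 < s) (c : ℝ) :
    deriv f₀ c = 2 * (∫ η in Ioi (0 : ℝ), derivMult f₀ η * Real.fourierChar (η * c)).re := by
  have hint : Integrable fun η : ℝ => derivMult f₀ η * Real.fourierChar (η * c) :=
    (h.integrable_derivMult hs).mul_bdd (c := 1)
      (Continuous.aestronglyMeasurable (by
        have := Real.continuous_fourierChar
        fun_prop)) (Filter.Eventually.of_forall fun η => (Circle.norm_coe _).le)
  have h1 : ((deriv f₀ c : ℝ) : ℂ) = ∫ η, derivMult f₀ η * Real.fourierChar (η * c) := by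
    rw [h.ofReal_deriv hs, Real.fourierInv_eq]
    congr 1; ext η
    simp [Circle.smul_def, mul_comm]
  have h2 : ∫ η in Iic (0 : ℝ), derivMult f₀ η * Real.fourierChar (η * c) =
      (starRingEnd ℂ) (∫ η in Ioi (0 : ℝ), derivMult f₀ η * Real.fourierChar (η * c)) := by
    rw [← integral_conj]
    have := integral_comp_neg_Ioi 0 (fun η : ℝ => derivMult f₀ η * Real.fourierChar (η * c))
    rw [neg_zero] at this
    rw [← this]
    congr 1; ext η
    have e : ((Real.fourierChar (-η * c) : Circle) : ℂ) =
        (starRingEnd ℂ) ((Real.fourierChar (η * c) : Circle) : ℂ) := by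
      rw [neg_mul, AddChar.map_neg_eq_inv, Circle.coe_inv_eq_conj]
    rw [derivMult_neg, e, ← map_mul]
  have h3 := intervalIntegral.integral_Iic_add_Ioi (b := 0) hint.integrableOn hint.integrableOn
  rw [h2, ← h1] at h3
  have := congrArg Complex.re h3
  simp only [Complex.add_re, Complex.conj_re, Complex.ofReal_re] at this
  linarith

/-- The boundary values of the dispersion function at a critical point. -/
theorem integral_derivMult_of_deriv_eq_zero (h : IsProfile s f₀) (hs : 3 / 2 < s) {c : ℝ}
    (hc : deriv f₀ c = 0) :
    (2 * Real.pi * Complex.I) * ∫ η in Ioi (0 : ℝ), derivMult f₀ η * Real.fourierChar (η * c) =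
      ((∫ v, deriv f₀ v / (v - c) : ℝ) : ℂ) := by
  have hM := h.integrable_derivMult hs
  have hMc := h.continuous_derivMult
  have hint : Integrable fun η : ℝ => derivMult f₀ η * Real.fourierChar (η * c) :=
    hM.mul_bdd (c := 1)
      (Continuous.aestronglyMeasurable (by
        have := Real.continuous_fourierChar
        fun_prop)) (Filter.Eventually.of_forall fun η => (Circle.norm_coe _).le)
  have hpos : ∀ᶠ δ : ℝ in nhdsWithin 0 (Ioi 0), 0 < δ := self_mem_nhdsWithin
  -- Abel summation: the identity with damping `δ` is passed to the limit `δ → 0+` on both sides,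
  -- here with the majorant `|derivMult f₀|`.
  have l1 : Filter.Tendsto (fun δ : ℝ => ∫ η in Ioi (0 : ℝ),
      Complex.exp (-δ * η) * (derivMult f₀ η * Real.fourierChar (η * c))) (nhdsWithin 0 (Ioi 0))
      (nhds (∫ η in Ioi (0 : ℝ), derivMult f₀ η * Real.fourierChar (η * c))) := by
    refine tendsto_integral_filter_of_dominated_convergence (fun η => ‖derivMult f₀ η‖)
      (Filter.Eventually.of_forall fun δ => ?_) ?_ hM.norm.restrict ?_
    · exact (Continuous.aestronglyMeasurable (by fun_prop)).mul hint.restrict.aestronglyMeasurable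
    · filter_upwards [hpos] with δ hδ
      rw [ae_restrict_iff' measurableSet_Ioi]
      refine Filter.Eventually.of_forall fun η hη => ?_
      rw [norm_mul, norm_mul, Circle.norm_coe, mul_one, Complex.norm_exp]
      refine mul_le_of_le_one_left (norm_nonneg _) (Real.exp_le_one_iff.2 ?_)
      have : 0 ≤ δ * η := mul_nonneg hδ.le (mem_Ioi.1 hη).le
      simpa using this
    · refine Filter.Eventually.of_forall fun η => ?_
      have : Continuous fun δ : ℝ => Complex.exp (-δ * η) *
          (derivMult f₀ η * Real.fourierChar (η * c)) := by fun_prop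
      have h2 := this.tendsto 0
      simp only [Complex.ofReal_zero, neg_zero, zero_mul, Complex.exp_zero, one_mul] at h2
      exact h2.mono_left nhdsWithin_le_nhds
  -- The majorant `|f₀'(v)/(v - c)|` is integrable because `c` is critical; at `v = c` itself the
  -- integrand vanishes.
  have l2 : Filter.Tendsto (fun δ : ℝ => ∫ v, ((deriv f₀ v : ℝ) : ℂ) *
      ((δ : ℂ) + 2 * Real.pi * Complex.I * (v - c))⁻¹) (nhdsWithin 0 (Ioi 0))
      (nhds (∫ v, (2 * Real.pi * Complex.I)⁻¹ * ((deriv f₀ v / (v - c) : ℝ) : ℂ))) := by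
    refine tendsto_integral_filter_of_dominated_convergence
      (fun v => |deriv f₀ v / (v - c)|) ?_ ?_
      (h.integrable_deriv_div hs hc).abs ?_
    · filter_upwards [hpos] with δ hδ
      exact (h.integrable_deriv_mul_inv hs c hδ).aestronglyMeasurable
    · filter_upwards [hpos] with δ hδ
      refine Filter.Eventually.of_forall fun v => ?_
      rcases eq_or_ne v c with rfl | hv
      · simp [hc]
      · rw [norm_mul, Complex.norm_real, Real.norm_eq_abs, abs_div, div_eq_mul_inv, norm_inv]
        have h3 : 0 < |v - c| := abs_pos.2 (sub_ne_zero.2 hv)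
        gcongr
        calc |v - c| ≤ |2 * Real.pi * (v - c)| := by
              rw [abs_mul, abs_of_pos Real.two_pi_pos]
              nlinarith [Real.pi_gt_three]
          _ = |((δ : ℂ) + 2 * Real.pi * Complex.I * (v - c)).im| := by simp
          _ ≤ _ := Complex.abs_im_le_norm _
    · refine Filter.Eventually.of_forall fun v => ?_
      rcases eq_or_ne v c with rfl | hv
      · simp [hc]
      · have h0 : (2 * Real.pi * Complex.I * (v - c) : ℂ) ≠ 0 := by
          have : (v - c : ℂ) ≠ 0 := by exact_mod_cast sub_ne_zero.2 hv
          exact mul_ne_zero Complex.two_pi_I_ne_zero this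
        have : Filter.Tendsto (fun δ : ℝ => ((deriv f₀ v : ℝ) : ℂ) *
            ((δ : ℂ) + 2 * Real.pi * Complex.I * (v - c))⁻¹) (nhds 0)
            (nhds (((deriv f₀ v : ℝ) : ℂ) *
            (((0 : ℝ) : ℂ) + 2 * Real.pi * Complex.I * (v - c))⁻¹)) := by
          refine Filter.Tendsto.const_mul _ (Filter.Tendsto.inv₀ ?_ (by simpa using h0))
          exact (Continuous.tendsto (by fun_prop :
            Continuous fun δ : ℝ => (δ : ℂ) + 2 * Real.pi * Complex.I * (v - c)) 0)
        refine (this.mono_left nhdsWithin_le_nhds).trans (le_of_eq ?_)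
        congr 1
        push_cast
        rw [zero_add, mul_inv]
        ring
  have l3 := tendsto_nhds_unique (l1.congr' (by
    filter_upwards [hpos] with δ hδ using h.integral_exp_mul_derivMult hs c hδ)) l2
  rw [l3, integral_const_mul, integral_complex_ofReal, ← mul_assoc,
    mul_inv_cancel₀ Complex.two_pi_I_ne_zero, one_mul]

/-- A zero of the dispersion function on the real line is a critical velocity. -/
theorem critical_of_dispersion_eq_zero (h : IsProfile s f₀) (hs : 3 / 2 < s) {θ c : ℝ}
    (h0 : 1 + (θ : ℂ) * 𝓕 (memoryKernel f₀) (-c) = 0) :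
    HasDerivAt f₀ 0 c ∧ ∫ v, deriv f₀ v / (v - c) = 4 * Real.pi ^ 2 / θ := by
  have hθ : (θ : ℂ) ≠ 0 := by rintro h1; simp [h1] at h0
  have h1 : 𝓕 (memoryKernel f₀) (-c) = ((-1 / θ : ℝ) : ℂ) := by
    push_cast
    rw [eq_div_iff hθ]
    linear_combination h0
  have h2 := fourier_memoryKernel (f₀ := f₀) c
  rw [h1] at h2
  -- The half-line integral equals `-2πi/θ`, which is purely imaginary, while its real part is
  -- `f₀'(c)/2`.
  have hc : deriv f₀ c = 0 := by
    rw [h.re_integral_derivMult hs, ← h2]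
    simp
  refine ⟨hc ▸ h.hasDerivAt hs c, ?_⟩
  have h3 := h.integral_derivMult_of_deriv_eq_zero hs hc
  rw [← h2] at h3
  apply Complex.ofReal_injective
  rw [← h3]
  push_cast
  field_simp
  rw [Complex.I_sq]
  ring

/-- Below the critical period the dispersion function is bounded away from zero on the real
line, uniformly in the wave number. -/
theorem exists_dispersion_lower_bound (h : IsProfile s f₀) (hs : 3 / 2 < s) {T : ℝ} (hT : 0 < T)
    (hT₀ : ENNReal.ofReal T < criticalPeriod f₀) :
    ∃ κ : ℝ, 0 < κ ∧ ∀ θ ∈ Icc 0 (T ^ 2), ∀ ω : ℝ,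
      κ ≤ ‖1 + (θ : ℂ) * 𝓕 (memoryKernel f₀) ω‖ := by
  have hcont := VlasovPoisson.continuous_fourier (h.integrable_memoryKernel hs)
  -- A zero would give a critical point with principal integral `4π²/θ ≥ (2π/T)²`, that is, `T₀ ≤
  -- T`.
  have hne : ∀ θ ∈ Icc 0 (T ^ 2), ∀ ω : ℝ, 1 + (θ : ℂ) * 𝓕 (memoryKernel f₀) ω ≠ 0 := by
    intro θ hθ ω h0
    rw [← neg_neg ω] at h0
    obtain ⟨h1, h2⟩ := h.critical_of_dispersion_eq_zero hs h0
    have hθ0 : θ ≠ 0 := by rintro rfl; simp at h0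
    have hθ1 : 0 < θ := lt_of_le_of_ne hθ.1 hθ0.symm
    have h3 : ENNReal.ofReal ((2 * Real.pi / T) ^ 2) ≤ criticalWaveNumberSq f₀ := by
      unfold criticalWaveNumberSq
      refine le_trans (ENNReal.ofReal_le_ofReal ?_)
        (le_iSup₂ (f := fun c (_ : c ∈ {c : ℝ | HasDerivAt f₀ 0 c}) =>
          ENNReal.ofReal (∫ v : ℝ, deriv f₀ v / (v - c))) (-ω) h1)
      rw [h2, div_pow, mul_pow]
      norm_num
      gcongr
      exact hθ.2
    have h4 : ENNReal.ofReal (2 * Real.pi / T) ≤ criticalWaveNumberSq f₀ ^ (1 / 2 : ℝ) := by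
      refine le_trans (le_of_eq ?_) (ENNReal.rpow_le_rpow h3 (by norm_num))
      rw [ENNReal.ofReal_rpow_of_nonneg (by positivity) (by norm_num), ← Real.sqrt_eq_rpow,
        Real.sqrt_sq (by positivity)]
    refine absurd hT₀ (not_lt.2 ?_)
    unfold criticalPeriod
    refine (ENNReal.div_le_div_left h4 _).trans (le_of_eq ?_)
    rw [← ENNReal.ofReal_div_of_pos (by positivity)]
    congr 1
    have := Real.pi_pos
    field_simp
  -- Riemann-Lebesgue: outside a compact set of frequencies the perturbation of `1` is at most
  -- `1/2`, for all `θ ≤ T²` at once.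
  have hz := Real.zero_at_infty_fourier (memoryKernel f₀)
  have hz2 : ∀ᶠ ω in Filter.cocompact ℝ, ‖𝓕 (memoryKernel f₀) ω‖ < 1 / (2 * T ^ 2) :=
    hz.norm.eventually_lt_const (by rw [norm_zero]; positivity)
  obtain ⟨K, hK, hKc⟩ := Filter.mem_cocompact.1 hz2
  -- The frequency `0` is added only to make the compact set nonempty.
  have hcomp : IsCompact (Icc 0 (T ^ 2) ×ˢ (K ∪ {0})) :=
    isCompact_Icc.prod (hK.union isCompact_singleton)
  have hcN : Continuous fun p : ℝ × ℝ => ‖1 + (p.1 : ℂ) * 𝓕 (memoryKernel f₀) p.2‖ := by fun_prop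
  obtain ⟨p, hp, hmin⟩ := hcomp.exists_isMinOn ⟨(0, 0), ⟨le_rfl, by positivity⟩, Or.inr rfl⟩
    hcN.continuousOn
  refine ⟨min (1 / 2) ‖1 + (p.1 : ℂ) * 𝓕 (memoryKernel f₀) p.2‖,
    lt_min (by norm_num) (norm_pos_iff.2 (hne _ hp.1 _)), fun θ hθ ω => ?_⟩
  by_cases hω : ω ∈ K
  · exact (min_le_right _ _).trans (hmin (show (θ, ω) ∈ _ from ⟨hθ, Or.inl hω⟩))
  · refine (min_le_left _ _).trans ?_
    have h1 : ‖𝓕 (memoryKernel f₀) ω‖ < 1 / (2 * T ^ 2) := hKc hω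
    have h2 : ‖(θ : ℂ) * 𝓕 (memoryKernel f₀) ω‖ ≤ 1 / 2 := by
      rw [norm_mul, Complex.norm_real, Real.norm_of_nonneg hθ.1]
      calc θ * ‖𝓕 (memoryKernel f₀) ω‖ ≤ T ^ 2 * (1 / (2 * T ^ 2)) :=
            mul_le_mul hθ.2 h1.le (norm_nonneg _) (by positivity)
        _ = 1 / 2 := by field_simp
    have h3 := norm_sub_le (1 + (θ : ℂ) * 𝓕 (memoryKernel f₀) ω) ((θ : ℂ) * 𝓕 (memoryKernel f₀) ω)
    rw [add_sub_cancel_right, norm_one] at h3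
    linarith

end IsProfile

/-! ### Cauchy-Schwarz and Young inequalities for `ℝ≥0∞`-valued functions. -/

/-- Cauchy-Schwarz for lower Lebesgue integrals. -/
theorem sq_lintegral_mul_le {α : Type*} [MeasurableSpace α] (μ : Measure α) {f g : α → ℝ≥0∞}
    (hf : AEMeasurable f μ) (hg : AEMeasurable g μ) :
    (∫⁻ a, f a * g a ∂μ) ^ 2 ≤ (∫⁻ a, f a ^ 2 ∂μ) * ∫⁻ a, g a ^ 2 ∂μ := by
  have h := ENNReal.lintegral_mul_le_Lp_mul_Lq μ Real.HolderConjugate.two_two hf hg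
  calc (∫⁻ a, f a * g a ∂μ) ^ 2
      ≤ ((∫⁻ a, f a ^ (2 : ℝ) ∂μ) ^ (1 / 2 : ℝ) * (∫⁻ a, g a ^ (2 : ℝ) ∂μ) ^ (1 / 2 : ℝ)) ^ 2 := by
        gcongr
        exact h
    _ = _ := by
        rw [mul_pow, ← ENNReal.rpow_natCast, ← ENNReal.rpow_natCast, ← ENNReal.rpow_mul,
          ← ENNReal.rpow_mul]
        norm_num

/-- Cauchy-Schwarz for lower Lebesgue integrals, with one factor used as a weight. -/
theorem sq_lintegral_mul_le_weight {α : Type*} [MeasurableSpace α] (μ : Measure α)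
    {f g : α → ℝ≥0∞} (hf : AEMeasurable f μ) (hg : AEMeasurable g μ) :
    (∫⁻ a, f a * g a ∂μ) ^ 2 ≤ (∫⁻ a, f a ∂μ) * ∫⁻ a, f a * g a ^ 2 ∂μ := by
  have hh : ∀ x : ℝ≥0∞, (x ^ (1 / 2 : ℝ)) ^ 2 = x := by
    intro x
    rw [← ENNReal.rpow_natCast, ← ENNReal.rpow_mul]
    norm_num
  have h := sq_lintegral_mul_le μ (hf.pow_const (1 / 2 : ℝ)) ((hf.pow_const (1 / 2 : ℝ)).mul hg)
  simp only [mul_pow, hh, Pi.mul_apply, ← mul_assoc] at h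
  refine le_trans (le_of_eq ?_) h
  congr 2; ext a
  rw [← sq, hh]

theorem sq_tsum_mul_le (f g : ℕ → ℝ≥0∞) :
    (∑' n, f n * g n) ^ 2 ≤ (∑' n, f n ^ 2) * ∑' n, g n ^ 2 := by
  have h := sq_lintegral_mul_le Measure.count (f := f) (g := g)
    (Measurable.of_discrete).aemeasurable (Measurable.of_discrete).aemeasurable
  simpa only [lintegral_count] using h

theorem add_sq_le_four (a b c d : ℝ≥0∞) :
    (a + b + c + d) ^ 2 ≤ 4 * (a ^ 2 + b ^ 2 + c ^ 2 + d ^ 2) := by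
  have h := ENNReal.inner_le_Lp_mul_Lq (Finset.univ : Finset (Fin 4)) (fun _ => 1) ![a, b, c, d]
    Real.HolderConjugate.two_two
  have h2 : (a + b + c + d) ≤ 4 ^ (1 / 2 : ℝ) * (a ^ 2 + b ^ 2 + c ^ 2 + d ^ 2) ^ (1 / 2 : ℝ) := by
    simpa [Fin.sum_univ_succ, add_assoc] using h
  calc _ ≤ (4 ^ (1 / 2 : ℝ) * (a ^ 2 + b ^ 2 + c ^ 2 + d ^ 2) ^ (1 / 2 : ℝ)) ^ 2 := by gcongr
    _ = _ := by
      rw [mul_pow, ← ENNReal.rpow_natCast, ← ENNReal.rpow_natCast, ← ENNReal.rpow_mul,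
        ← ENNReal.rpow_mul]
      norm_num

theorem lintegral_comp_mul_left {ξ : ℝ} (hξ : 0 < ξ) {g : ℝ → ℝ≥0∞} (hg : Measurable g) :
    ∫⁻ τ, g (ξ * τ) = ENNReal.ofReal ξ⁻¹ * ∫⁻ η, g η := by
  rw [← lintegral_map hg (by fun_prop : Measurable fun τ : ℝ => ξ * τ),
    Real.map_volume_mul_left hξ.ne', lintegral_smul_measure, abs_of_pos (inv_pos.2 hξ), smul_eq_mul]

/-- Young's inequality `L¹ * L² ⊆ L²`. -/
theorem lintegral_sq_conv_le {a b : ℝ → ℝ≥0∞} (ha : Measurable a) (hb : Measurable b) :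
    ∫⁻ t, (∫⁻ r, a (t - r) * b r) ^ 2 ≤ (∫⁻ τ, a τ) ^ 2 * ∫⁻ r, b r ^ 2 := by
  have h1 : ∀ t, (∫⁻ r, a (t - r) * b r) ^ 2 ≤
      (∫⁻ τ, a τ) * ∫⁻ r, a (t - r) * b r ^ 2 := by
    intro t
    rw [← lintegral_sub_left_eq_self (fun τ => a τ) t]
    exact sq_lintegral_mul_le_weight volume (by fun_prop) hb.aemeasurable
  calc ∫⁻ t, (∫⁻ r, a (t - r) * b r) ^ 2
      ≤ ∫⁻ t, (∫⁻ τ, a τ) * ∫⁻ r, a (t - r) * b r ^ 2 := lintegral_mono h1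
    _ = (∫⁻ τ, a τ) * ∫⁻ t, ∫⁻ r, a (t - r) * b r ^ 2 := by
        rw [lintegral_const_mul]
        exact Measurable.lintegral_prod_right' (f := fun p : ℝ × ℝ => a (p.1 - p.2) * b p.2 ^ 2)
          (by fun_prop)
    _ = (∫⁻ τ, a τ) * ∫⁻ r, ∫⁻ t, a (t - r) * b r ^ 2 := by
        rw [lintegral_lintegral_swap]
        exact Measurable.aemeasurable (by
          change Measurable (fun p : ℝ × ℝ => a (p.1 - p.2) * b p.2 ^ 2); fun_prop)
    _ = (∫⁻ τ, a τ) * ∫⁻ r, (∫⁻ τ, a τ) * b r ^ 2 := by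
        congr 2; ext r
        rw [lintegral_mul_const _ (by fun_prop), lintegral_sub_right_eq_self (fun τ => a τ) r]
    _ = _ := by
        rw [lintegral_const_mul _ (by fun_prop)]
        ring

/-! ### `L²` estimates in time for the Volterra equation and its source. -/

/-- `u ↦ u + K * u` is bounded below on `L²` by the infimum of its Fourier multiplier. -/
theorem lintegral_sq_le_of_multiplier {K : ℝ → ℂ} (hK : Integrable K) (hKm : Measurable K) {κ : ℝ}
    (hκ : 0 ≤ κ) (hlow : ∀ ω, κ ≤ ‖1 + 𝓕 K ω‖) {u : ℝ → ℂ} (hu : Integrable u)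
    (hum : Measurable u) (hu2 : MemLp u 2) :
    ENNReal.ofReal (κ ^ 2) * ∫⁻ t, ‖u t‖ₑ ^ 2 ≤
      ∫⁻ t, ‖u t + ∫ r, K (t - r) * u r‖ₑ ^ 2 := by
  set c : ℝ → ℂ := fun t => ∫ r, K (t - r) * u r with hc
  have hcc : c = convolution u K (ContinuousLinearMap.mul ℂ ℂ) volume := by
    ext t
    simp only [hc, convolution_def, ContinuousLinearMap.mul_apply', mul_comm]
  have hci : Integrable c := by rw [hcc]; exact hu.integrable_convolution _ hK
  have hc2 : MemLp c 2 := by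
    rw [memLp_two_iff_lintegral hci.1]
    refine lt_of_le_of_lt (lintegral_mono fun t => ?_)
      (lt_of_le_of_lt (lintegral_sq_conv_le hKm.enorm hum.enorm) ?_)
    · gcongr
      refine (enorm_integral_le_lintegral_enorm _).trans (lintegral_mono fun r => ?_)
      rw [enorm_mul]
    · exact ENNReal.mul_lt_top (ENNReal.pow_lt_top hK.2) ((memLp_two_iff_lintegral hu2.1).1 hu2)
  have hF : ∀ ω, 𝓕 (u + c) ω = 𝓕 u ω * (1 + 𝓕 K ω) := by
    intro ω
    have h1 := Real.fourier_mul_convolution_eq hu hK ω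
    rw [← hcc] at h1
    have h2 : 𝓕 (u + c) ω = 𝓕 u ω + 𝓕 c ω :=
      congrFun (VectorFourier.fourierIntegral_add (L := innerₗ ℝ) Real.continuous_fourierChar
        (by exact continuous_inner) hu hci) ω
    rw [h2, h1]; ring
  have hP := lintegral_enorm_fourier_sq (hu.add hci) (hu2.add hc2)
  simp only [Pi.add_apply] at hP
  rw [← hP, ← lintegral_enorm_fourier_sq hu hu2, ← lintegral_const_mul']
  · refine lintegral_mono fun ω => ?_
    rw [hF, enorm_mul, mul_pow, mul_comm, ENNReal.ofReal_pow hκ]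
    gcongr
    rw [← ofReal_norm]
    exact ENNReal.ofReal_le_ofReal (hlow ω)
  · exact ENNReal.ofReal_ne_top

/-- A bounded solution of the Volterra equation `ρ + K * ρ = S` is controlled in `L²` on `(a, b]`
by `S`, its past before `a` and its values shortly before `b`. -/
theorem lintegral_sq_le_of_volterra {K : ℝ → ℂ} (hK : Integrable K) (hKm : Measurable K)
    (hsupp : ∀ τ ≤ 0, K τ = 0) {κ : ℝ} (hκ : 0 ≤ κ) (hlow : ∀ ω, κ ≤ ‖1 + 𝓕 K ω‖) {R : ℝ}
    (hR : 8 * (∫⁻ τ in Ioi R, ‖K τ‖ₑ) ^ 2 ≤ ENNReal.ofReal (κ ^ 2))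
    {ρ : ℝ → ℂ} (hρ : Measurable ρ) {B : ℝ} (hB : ∀ t, ‖ρ t‖ ≤ B) {S : ℝ → ℂ}
    {t₀ a b : ℝ} (hta : t₀ ≤ a)
    (heq : ∀ t ∈ Ioc a b, ρ t + ∫ r in t₀..t, K (t - r) * ρ r = S t) :
    ENNReal.ofReal (κ ^ 2) * ∫⁻ t in Ioc a b, ‖ρ t‖ₑ ^ 2 ≤
      8 * ((∫⁻ t in Ioc a b, ‖S t‖ₑ ^ 2) + (∫⁻ τ, ‖K τ‖ₑ) ^ 2 *
        ((∫⁻ t in Ioc t₀ a, ‖ρ t‖ₑ ^ 2) + ∫⁻ t in Ioc (b - R) b, ‖ρ t‖ₑ ^ 2)) := by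
  have hind : ∀ (I : Set ℝ) (v : ℝ → ℂ), MeasurableSet I →
      ∫⁻ t, ‖I.indicator v t‖ₑ ^ 2 = ∫⁻ t in I, ‖v t‖ₑ ^ 2 := by
    intro I v hI
    rw [← lintegral_indicator hI]
    congr 1; ext t
    by_cases ht : t ∈ I <;> simp [ht]
  -- Truncation to `(a, b]` puts the unknown into `L¹ ∩ L²` of the whole line, where the multiplier
  -- bound applies; the errors it causes are collected in `hpt`.
  set u : ℝ → ℂ := (Ioc a b).indicator ρ with hu
  have hum : Measurable u := hρ.indicator measurableSet_Ioc
  have hfin : ∀ c d : ℝ, ∫⁻ t in Ioc c d, ‖ρ t‖ₑ ^ 2 < ⊤ := by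
    intro c d
    refine lt_of_le_of_lt (lintegral_mono (g := fun _ => ENNReal.ofReal B ^ 2) fun t => ?_) ?_
    · change ‖ρ t‖ₑ ^ 2 ≤ ENNReal.ofReal B ^ 2
      rw [← ofReal_norm]
      gcongr
      exact hB t
    · rw [lintegral_const]
      refine ENNReal.mul_lt_top (ENNReal.pow_lt_top ENNReal.ofReal_lt_top) ?_
      simp
  have hρI : ∀ c d : ℝ, IntegrableOn ρ (Ioc c d) := fun c d =>
    Measure.integrableOn_of_bounded (M := B) (by simp) hρ.aestronglyMeasurable
      (Filter.Eventually.of_forall hB)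
  have hui : Integrable u := (hρI a b).integrable_indicator measurableSet_Ioc
  have hu2 : MemLp u 2 := by
    rw [memLp_two_iff_lintegral hui.1, hu, hind _ _ measurableSet_Ioc]
    exact hfin a b
  have hKρ : ∀ t, ∀ c d : ℝ, IntervalIntegrable (fun r => K (t - r) * ρ r) volume c d := by
    intro t c d
    have : Integrable (fun r => K (t - r) * ρ r) :=
      (hK.comp_sub_left t).mul_bdd (c := B) hρ.aestronglyMeasurable (Filter.Eventually.of_forall hB)
    exact this.intervalIntegrable
  set p₁ : ℝ → ℝ≥0∞ := fun t => ‖(Ioc a b).indicator S t‖ₑ with hp₁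
  set v₂ : ℝ → ℂ := (Ioc t₀ a).indicator ρ with hv₂
  set v₃ : ℝ → ℂ := (Ioc (b - R) b).indicator ρ with hv₃
  set L : ℝ → ℂ := (Ioi R).indicator K with hL
  have hv₂m : Measurable v₂ := hρ.indicator measurableSet_Ioc
  have hv₃m : Measurable v₃ := hρ.indicator measurableSet_Ioc
  have hLm : Measurable L := hKm.indicator measurableSet_Ioi
  -- Before `a` both terms vanish by causality. On `(a, b]` the error is the memory of the past,
  -- `v₂`. After `b` the memory of `u` persists: lags up to `R` see only the last values `v₃`,
  -- longer ones only the kernel tail `L`.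
  have hpt : ∀ t, ‖u t + ∫ r, K (t - r) * u r‖ₑ ≤ p₁ t + (∫⁻ r, ‖K (t - r)‖ₑ * ‖v₂ r‖ₑ) +
      (∫⁻ r, ‖K (t - r)‖ₑ * ‖v₃ r‖ₑ) + ∫⁻ r, ‖L (t - r)‖ₑ * ‖u r‖ₑ := by
    intro t
    rcases le_or_gt t a with hta' | hat
    · have h0 : ∀ r, K (t - r) * u r = 0 := by
        intro r
        rcases le_or_gt r a with h | h
        · have : r ∉ Ioc a b := fun hr => absurd hr.1 (not_lt.2 h)
          simp [hu, this]
        · rw [hsupp _ (by linarith), zero_mul]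
      have h1 : u t = 0 := by
        have : t ∉ Ioc a b := fun hr => absurd hr.1 (not_lt.2 hta')
        simp [hu, this]
      simp [h0, h1]
    rcases le_or_gt t b with htb | hbt
    · have ht : t ∈ Ioc a b := ⟨hat, htb⟩
      have h1 : ∫ r, K (t - r) * u r = ∫ r in a..t, K (t - r) * ρ r := by
        rw [intervalIntegral.integral_of_le hat.le, ← integral_indicator measurableSet_Ioc]
        congr 1; ext r
        by_cases hr : r ∈ Ioc a t
        · have : r ∈ Ioc a b := ⟨hr.1, hr.2.trans htb⟩
          simp [hu, hr, this]
        · rw [indicator_of_notMem hr]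
          rcases le_or_gt r a with h | h
          · have : r ∉ Ioc a b := fun hr => absurd hr.1 (not_lt.2 h)
            simp [hu, this]
          · have : t < r := by
              by_contra! h2; exact hr ⟨h, h2⟩
            rw [hsupp _ (by linarith), zero_mul]
      have h2 : u t + ∫ r, K (t - r) * u r = S t - ∫ r in t₀..a, K (t - r) * ρ r := by
        rw [h1, ← heq t ht, ← intervalIntegral.integral_add_adjacent_intervals (hKρ t t₀ a) (hKρ t a t)]
        simp only [hu, indicator_of_mem ht]
        ring
      have h3 : ‖∫ r in t₀..a, K (t - r) * ρ r‖ₑ ≤ ∫⁻ r, ‖K (t - r)‖ₑ * ‖v₂ r‖ₑ := by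
        rw [intervalIntegral.integral_of_le hta, ← integral_indicator measurableSet_Ioc]
        refine (enorm_integral_le_lintegral_enorm _).trans (lintegral_mono fun r => ?_)
        rw [← enorm_mul]
        by_cases hr : r ∈ Ioc t₀ a <;> simp [hv₂, hr]
      rw [h2]
      calc ‖S t - ∫ r in t₀..a, K (t - r) * ρ r‖ₑ
          ≤ ‖S t‖ₑ + ‖∫ r in t₀..a, K (t - r) * ρ r‖ₑ := enorm_sub_le
        _ ≤ p₁ t + ∫⁻ r, ‖K (t - r)‖ₑ * ‖v₂ r‖ₑ := by
          simp only [hp₁, indicator_of_mem ht]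
          gcongr
        _ ≤ _ := by rw [add_assoc _ (∫⁻ r, ‖K (t - r)‖ₑ * ‖v₃ r‖ₑ)]; exact le_self_add
    · have h1 : u t = 0 := by
        have : t ∉ Ioc a b := fun hr => absurd hr.2 (not_le.2 hbt)
        simp [hu, this]
      rw [h1, zero_add]
      refine (enorm_integral_le_lintegral_enorm _).trans ?_
      refine le_trans ?_ (add_le_add_left le_add_self _)
      rw [← lintegral_add_left (by fun_prop)]
      refine lintegral_mono fun r => ?_
      simp only [enorm_mul]
      by_cases hr : r ∈ Ioc a b
      · by_cases hr2 : b - R < r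
        · have : r ∈ Ioc (b - R) b := ⟨hr2, hr.2⟩
          simp [hu, hv₃, this, hr]
        · have : R < t - r := by linarith [not_lt.1 hr2]
          simp [hL, this]
      · simp [hu, hr]
  have hL1 : ∫⁻ τ, ‖L τ‖ₑ = ∫⁻ τ in Ioi R, ‖K τ‖ₑ := by
    rw [← lintegral_indicator measurableSet_Ioi]
    congr 1; ext t
    by_cases ht : t ∈ Ioi R
    · simp only [hL, indicator_of_mem ht]
    · simp only [hL, indicator_of_notMem ht, enorm_zero]
  have hmeas : ∀ k v : ℝ → ℂ, Measurable k → Measurable v →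
      Measurable fun t => (∫⁻ r, ‖k (t - r)‖ₑ * ‖v r‖ₑ) ^ 2 := by
    intro k v hk hv
    exact (Measurable.lintegral_prod_right' (f := fun p : ℝ × ℝ => ‖k (p.1 - p.2)‖ₑ * ‖v p.2‖ₑ)
      (by fun_prop)).pow_const 2
  set X := ∫⁻ t in Ioc a b, ‖ρ t‖ₑ ^ 2 with hX
  set A := (∫⁻ t in Ioc a b, ‖S t‖ₑ ^ 2) + (∫⁻ τ, ‖K τ‖ₑ) ^ 2 *
        ((∫⁻ t in Ioc t₀ a, ‖ρ t‖ₑ ^ 2) + ∫⁻ t in Ioc (b - R) b, ‖ρ t‖ₑ ^ 2) with hA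
  have hmain : ENNReal.ofReal (κ ^ 2) * X ≤ 4 * (A + (∫⁻ τ in Ioi R, ‖K τ‖ₑ) ^ 2 * X) := by
    calc ENNReal.ofReal (κ ^ 2) * X = ENNReal.ofReal (κ ^ 2) * ∫⁻ t, ‖u t‖ₑ ^ 2 := by
          rw [hu, hind _ _ measurableSet_Ioc]
      _ ≤ ∫⁻ t, ‖u t + ∫ r, K (t - r) * u r‖ₑ ^ 2 :=
          lintegral_sq_le_of_multiplier hK hKm hκ hlow hui hum hu2
      _ ≤ ∫⁻ t, 4 * (p₁ t ^ 2 + (∫⁻ r, ‖K (t - r)‖ₑ * ‖v₂ r‖ₑ) ^ 2 +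
          (∫⁻ r, ‖K (t - r)‖ₑ * ‖v₃ r‖ₑ) ^ 2 + (∫⁻ r, ‖L (t - r)‖ₑ * ‖u r‖ₑ) ^ 2) := by
          refine lintegral_mono fun t => ?_
          refine le_trans ?_ (add_sq_le_four _ _ _ _)
          gcongr
          exact hpt t
      _ = 4 * ((∫⁻ t, p₁ t ^ 2) + (∫⁻ t, (∫⁻ r, ‖K (t - r)‖ₑ * ‖v₂ r‖ₑ) ^ 2) +
          (∫⁻ t, (∫⁻ r, ‖K (t - r)‖ₑ * ‖v₃ r‖ₑ) ^ 2) +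
          ∫⁻ t, (∫⁻ r, ‖L (t - r)‖ₑ * ‖u r‖ₑ) ^ 2) := by
          rw [lintegral_const_mul' _ _ (by norm_num), lintegral_add_right _ (hmeas _ _ hLm hum),
            lintegral_add_right _ (hmeas _ _ hKm hv₃m), lintegral_add_right _ (hmeas _ _ hKm hv₂m)]
      _ ≤ 4 * ((∫⁻ t in Ioc a b, ‖S t‖ₑ ^ 2) +
          (∫⁻ τ, ‖K τ‖ₑ) ^ 2 * (∫⁻ t in Ioc t₀ a, ‖ρ t‖ₑ ^ 2) +
          (∫⁻ τ, ‖K τ‖ₑ) ^ 2 * (∫⁻ t in Ioc (b - R) b, ‖ρ t‖ₑ ^ 2) +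
          (∫⁻ τ in Ioi R, ‖K τ‖ₑ) ^ 2 * X) := by
          gcongr 4 * (?_ + ?_ + ?_ + ?_)
          · exact (hind _ _ measurableSet_Ioc).le
          · refine (lintegral_sq_conv_le hKm.enorm hv₂m.enorm).trans ?_
            rw [hv₂, hind _ _ measurableSet_Ioc]
          · refine (lintegral_sq_conv_le hKm.enorm hv₃m.enorm).trans ?_
            rw [hv₃, hind _ _ measurableSet_Ioc]
          · refine (lintegral_sq_conv_le hLm.enorm hum.enorm).trans ?_
            rw [hu, hind _ _ measurableSet_Ioc, hL1]
      _ = _ := by rw [hA]; ring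
  -- Absorption: by `hR` the last term of `hmain` is at most half of the left-hand side, which is
  -- finite and may be cancelled.
  have hXf : ENNReal.ofReal (κ ^ 2) * X ≠ ⊤ :=
    ENNReal.mul_ne_top ENNReal.ofReal_ne_top (hfin a b).ne
  have h2 : ENNReal.ofReal (κ ^ 2) * X + ENNReal.ofReal (κ ^ 2) * X ≤
      8 * A + ENNReal.ofReal (κ ^ 2) * X := by
    calc _ ≤ 4 * (A + (∫⁻ τ in Ioi R, ‖K τ‖ₑ) ^ 2 * X) +
          4 * (A + (∫⁻ τ in Ioi R, ‖K τ‖ₑ) ^ 2 * X) := add_le_add hmain hmain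
      _ = 8 * A + (8 * (∫⁻ τ in Ioi R, ‖K τ‖ₑ) ^ 2) * X := by ring
      _ ≤ _ := by gcongr
  exact (ENNReal.add_le_add_iff_right hXf).1 h2

/-- The `L²` bound in time of the nonlinear source term. -/
theorem lintegral_sq_duhamel_le {s ξ : ℝ} (hξ : 0 < ξ) {Q : ℝ → ℝ → ℂ}
    (hQ : Measurable (Function.uncurry Q)) (t₀ a b : ℝ) (hta : t₀ ≤ a) :
    ∫⁻ t in Ioc a b, ‖∫ r in t₀..t, (2 * Real.pi * Complex.I * ξ * (t - r)) *
        Q (ξ * (t - r)) r‖ₑ ^ 2 ≤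
      ENNReal.ofReal (ξ⁻¹ ^ 2) * (∫⁻ η, ENNReal.ofReal (sobolevWeight (1 - s) η)) *
        ∫⁻ r in Ioc t₀ b, ∫⁻ η, ENNReal.ofReal (sobolevWeight s η) * ‖Q η r‖ₑ ^ 2 := by
  have hw : ∀ q, Measurable fun ξ => ENNReal.ofReal (sobolevWeight q ξ) := fun q =>
    (continuous_sobolevWeight q).measurable.ennreal_ofReal
  set c := ∫⁻ η, ENNReal.ofReal (sobolevWeight (1 - s) η) with hc
  have hwsq : ∀ q η, ENNReal.ofReal (sobolevWeight (q / 2) η) ^ 2 =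
      ENNReal.ofReal (sobolevWeight q η) := by
    intro q η
    rw [← ENNReal.ofReal_pow (sobolevWeight_pos _ _).le, sq, sobolevWeight_mul]
    congr 2; ring
  have hQ1 : ∀ t, Measurable fun r => ‖Q (ξ * (t - r)) r‖ₑ := fun t =>
    (hQ.comp (by fun_prop : Measurable fun r : ℝ => (ξ * (t - r), r))).enorm
  -- Cauchy-Schwarz in `r`: with `η = ξ(t - r)`, the factor `2πη` is bounded by the weight of
  -- exponent `1/2 = (1 - s)/2 + s/2`. The square of the first part is integrable once `s > 3/2`,
  -- the second goes to `Q`.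
  have hpt : ∀ t ∈ Ioc a b, ‖∫ r in t₀..t, (2 * Real.pi * Complex.I * ξ * (t - r)) *
        Q (ξ * (t - r)) r‖ₑ ^ 2 ≤ ENNReal.ofReal ξ⁻¹ * c *
        ∫⁻ r in Ioc t₀ b, ENNReal.ofReal (sobolevWeight s (ξ * (t - r))) *
          ‖Q (ξ * (t - r)) r‖ₑ ^ 2 := by
    intro t ht
    rw [intervalIntegral.integral_of_le (hta.trans ht.1.le)]
    have h1 : ‖∫ r in Ioc t₀ t, (2 * Real.pi * Complex.I * ξ * (t - r)) *
        Q (ξ * (t - r)) r‖ₑ ≤ ∫⁻ r in Ioc t₀ t,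
          ENNReal.ofReal (sobolevWeight ((1 - s) / 2) (ξ * (t - r))) *
          (ENNReal.ofReal (sobolevWeight (s / 2) (ξ * (t - r))) * ‖Q (ξ * (t - r)) r‖ₑ) := by
      refine (enorm_integral_le_lintegral_enorm _).trans (lintegral_mono fun r => ?_)
      rw [enorm_mul, ← mul_assoc, ← ENNReal.ofReal_mul (sobolevWeight_pos _ _).le,
        sobolevWeight_mul, ← ofReal_norm]
      gcongr
      have h2 := abs_rpow_le_sobolevWeight zero_le_one (ξ * (t - r))
      rw [Real.rpow_one] at h2
      refine le_trans (le_of_eq ?_) (h2.trans (le_of_eq ?_))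
      · have h3 : (2 * Real.pi * Complex.I * ξ * (t - r) : ℂ) =
            ((2 * Real.pi * (ξ * (t - r)) : ℝ) : ℂ) * Complex.I := by push_cast; ring
        rw [h3, norm_mul, Complex.norm_I, mul_one, Complex.norm_real, Real.norm_eq_abs]
      · congr 1; ring
    calc _ ≤ (∫⁻ r in Ioc t₀ t, ENNReal.ofReal (sobolevWeight ((1 - s) / 2) (ξ * (t - r))) *
          (ENNReal.ofReal (sobolevWeight (s / 2) (ξ * (t - r))) * ‖Q (ξ * (t - r)) r‖ₑ)) ^ 2 := by
          gcongr
      _ ≤ _ := sq_lintegral_mul_le _ ((hw _).comp (by fun_prop)).aemeasurable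
          (((hw _).comp (by fun_prop)).mul (hQ1 t)).aemeasurable
      _ ≤ _ := by
          simp only [mul_pow, hwsq]
          gcongr
          · refine (setLIntegral_le_lintegral _ _).trans (le_of_eq ?_)
            rw [lintegral_sub_left_eq_self
              (fun τ => ENNReal.ofReal (sobolevWeight (1 - s) (ξ * τ))) t,
              lintegral_comp_mul_left hξ (hw _)]
          · exact ht.2
  have hmeas : Measurable fun p : ℝ × ℝ =>
      ENNReal.ofReal (sobolevWeight s (ξ * (p.1 - p.2))) * ‖Q (ξ * (p.1 - p.2)) p.2‖ₑ ^ 2 :=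
    ((hw s).comp (by fun_prop)).mul
      ((hQ.comp (by fun_prop : Measurable fun p : ℝ × ℝ => (ξ * (p.1 - p.2), p.2))).enorm.pow_const 2)
  -- Integrating in `t` before `r` turns `ξ(t - r)` into the free variable `η`; this substitution
  -- and the one in `hpt` contribute a factor `ξ⁻¹` each.
  calc _ ≤ ∫⁻ t in Ioc a b, ENNReal.ofReal ξ⁻¹ * c *
        ∫⁻ r in Ioc t₀ b, ENNReal.ofReal (sobolevWeight s (ξ * (t - r))) *
          ‖Q (ξ * (t - r)) r‖ₑ ^ 2 := setLIntegral_mono' measurableSet_Ioc hpt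
    _ ≤ ∫⁻ t, ENNReal.ofReal ξ⁻¹ * c *
        ∫⁻ r in Ioc t₀ b, ENNReal.ofReal (sobolevWeight s (ξ * (t - r))) *
          ‖Q (ξ * (t - r)) r‖ₑ ^ 2 := setLIntegral_le_lintegral _ _
    _ = ENNReal.ofReal ξ⁻¹ * c * ∫⁻ r in Ioc t₀ b, ∫⁻ t,
          ENNReal.ofReal (sobolevWeight s (ξ * (t - r))) * ‖Q (ξ * (t - r)) r‖ₑ ^ 2 := by
        rw [lintegral_const_mul _ (Measurable.lintegral_prod_right' hmeas),
          lintegral_lintegral_swap hmeas.aemeasurable]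
    _ = ENNReal.ofReal ξ⁻¹ * c * ∫⁻ r in Ioc t₀ b, ENNReal.ofReal ξ⁻¹ *
          ∫⁻ η, ENNReal.ofReal (sobolevWeight s η) * ‖Q η r‖ₑ ^ 2 := by
        congr 2; ext r
        rw [lintegral_sub_right_eq_self (fun τ => ENNReal.ofReal (sobolevWeight s (ξ * τ)) *
          ‖Q (ξ * τ) r‖ₑ ^ 2) r, lintegral_comp_mul_left hξ
            (g := fun η => ENNReal.ofReal (sobolevWeight s η) * ‖Q η r‖ₑ ^ 2)]
        exact (hw s).mul ((hQ.comp (by fun_prop : Measurable fun η : ℝ => (η, r))).enorm.pow_const 2)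
    _ = _ := by
        rw [lintegral_const_mul' _ _ ENNReal.ofReal_ne_top, ENNReal.ofReal_pow (by positivity)]
        ring

/-! ### Characters and moments over one period. -/

/-- The character `x ↦ e^{-2πiξx}`. -/
def char (ξ x : ℝ) : ℂ := Complex.exp (-(2 * Real.pi * Complex.I * ξ * x))

theorem norm_char (ξ x : ℝ) : ‖char ξ x‖ = 1 := by
  rw [char, Complex.norm_exp]
  simp

theorem continuous_char_uncurry : Continuous fun p : ℝ × ℝ => char p.1 p.2 := by
  unfold char; fun_prop

@[fun_prop]
theorem continuous_char_comp {α : Type*} [TopologicalSpace α] {g h : α → ℝ} (hg : Continuous g)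
    (hh : Continuous h) : Continuous fun a => char (g a) (h a) :=
  continuous_char_uncurry.comp (hg.prodMk hh)

@[fun_prop]
theorem measurable_char_comp {α : Type*} [MeasurableSpace α] {g h : α → ℝ} (hg : Measurable g)
    (hh : Measurable h) : Measurable fun a => char (g a) (h a) :=
  continuous_char_uncurry.measurable.comp (hg.prodMk hh)

theorem contDiff_char (ξ : ℝ) {n : WithTop ℕ∞} : ContDiff ℝ n (char ξ) := by
  unfold char
  have : ContDiff ℝ n (fun x : ℝ => (x : ℂ)) := Complex.ofRealCLM.contDiff
  fun_prop

theorem hasDerivAt_char (ξ x : ℝ) :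
    HasDerivAt (char ξ) (-(2 * Real.pi * Complex.I * ξ) * char ξ x) x := by
  have h1 : HasDerivAt (fun η : ℝ => (η : ℂ)) 1 x := Complex.ofRealCLM.hasDerivAt
  have h2 := ((h1.const_mul (2 * Real.pi * Complex.I * ξ)).fun_neg).cexp
  rw [mul_one] at h2
  convert! h2 using 1
  rw [char]; ring

theorem char_add_period {T : ℝ} (hT : T ≠ 0) (n : ℤ) (x : ℝ) :
    char (n / T) (x + T) = char (n / T) x := by
  have hT' : (T : ℂ) ≠ 0 := by exact_mod_cast hT
  unfold char
  rw [Complex.exp_eq_exp_iff_exists_int]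
  refine ⟨-n, ?_⟩
  push_cast
  field_simp
  ring

/-- The moment `∫∫ w(x, v) e^{-2πiξx} β(v) dv dx` over one period. -/
def moment (T ξ : ℝ) (w : ℝ × ℝ → ℝ) (β : ℝ → ℂ) : ℂ :=
  ∫ p in Ioc 0 T ×ˢ univ, (w p : ℂ) * (char ξ p.1 * β p.2)

section Moment

variable {T ξ : ℝ} {w : ℝ × ℝ → ℝ}

theorem integrable_moment (hw : IntegrableOn w (Ioc 0 T ×ˢ univ)) {β : ℝ → ℂ} (hβ : Measurable β)
    {C : ℝ} (hC : ∀ v, ‖β v‖ ≤ C) :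
    IntegrableOn (fun p : ℝ × ℝ => (w p : ℂ) * (char ξ p.1 * β p.2)) (Ioc 0 T ×ˢ univ) := by
  have hw' : IntegrableOn (fun p => (w p : ℂ)) (Ioc 0 T ×ˢ univ) := hw.ofReal
  refine hw'.mul_bdd (c := C) (Measurable.aestronglyMeasurable (by fun_prop))
    (Filter.Eventually.of_forall fun p => ?_)
  rw [norm_mul, norm_char, one_mul]
  exact hC _

theorem norm_moment_le (hw : IntegrableOn w (Ioc 0 T ×ˢ univ)) {β : ℝ → ℂ}
    {C : ℝ} (hC : ∀ v, ‖β v‖ ≤ C) :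
    ‖moment T ξ w β‖ ≤ C * ∫ p in Ioc 0 T ×ˢ univ, |w p| := by
  rw [← integral_const_mul]
  refine norm_integral_le_of_norm_le (hw.abs.const_mul C) (Filter.Eventually.of_forall fun p => ?_)
  rw [norm_mul, norm_mul, norm_char, one_mul, Complex.norm_real, mul_comm, Real.norm_eq_abs]
  gcongr
  exact hC _

theorem moment_sub (hw : IntegrableOn w (Ioc 0 T ×ˢ univ)) {β γ : ℝ → ℂ} (hβ : Measurable β)
    (hγ : Measurable γ) {C D : ℝ} (hC : ∀ v, ‖β v‖ ≤ C) (hD : ∀ v, ‖γ v‖ ≤ D) :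
    moment T ξ w (fun v => β v - γ v) = moment T ξ w β - moment T ξ w γ := by
  unfold moment
  rw [← integral_sub (integrable_moment hw hβ hC) (integrable_moment hw hγ hD)]
  congr 1; ext p; ring

theorem moment_const_mul (a : ℂ) (β : ℝ → ℂ) :
    moment T ξ w (fun v => a * β v) = a * moment T ξ w β := by
  unfold moment
  rw [← integral_const_mul]
  congr 1; ext p; ring

theorem measurable_moment {α : Type*} [MeasurableSpace α] {w : α → ℝ × ℝ → ℝ}
    (hw : Measurable (Function.uncurry w)) {β : α → ℝ → ℂ} (hβ : Measurable (Function.uncurry β)) :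
    Measurable fun a => moment T ξ (w a) (β a) := by
  unfold moment
  refine (StronglyMeasurable.integral_prod_right' (f := fun q : α × ℝ × ℝ =>
    (w q.1 q.2 : ℂ) * (char ξ q.2.1 * β q.1 q.2.2)) ?_).measurable
  refine Measurable.stronglyMeasurable ?_
  have h1 : Measurable fun q : α × ℝ × ℝ => w q.1 q.2 := hw
  have h2 : Measurable fun q : α × ℝ × ℝ => β q.1 q.2.2 :=
    hβ.comp (by fun_prop : Measurable fun q : α × ℝ × ℝ => (q.1, q.2.2))
  fun_prop

end Moment

/-! ### A priori bounds and measurability of the electric field. -/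

namespace IsSolution

variable {T : ℝ} {f : ℝ → ℝ → ℝ → ℝ} {E : ℝ → ℝ → ℝ}

theorem integrable_density (h : IsSolution T f E) (t : ℝ) :
    IntegrableOn (fun z => ∫ v : ℝ, f t z v) (Ioc 0 T) := by
  have := h.integrable t
  rw [IntegrableOn, Measure.volume_eq_prod, ← Measure.prod_restrict, Measure.restrict_univ] at this
  exact this.integral_prod_left

theorem integral_density (h : IsSolution T f E) (t : ℝ) :
    ∫ z in Ioc 0 T, ∫ v : ℝ, f t z v = ∫ p in Ioc 0 T ×ˢ univ, f t p.1 p.2 := by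
  have := h.integrable t
  rw [IntegrableOn, Measure.volume_eq_prod, ← Measure.prod_restrict, Measure.restrict_univ] at this
  rw [Measure.volume_eq_prod, ← Measure.prod_restrict, Measure.restrict_univ, integral_prod _ this]

theorem integrable_charge (h : IsSolution T f E) (t : ℝ) :
    IntegrableOn (fun z => 1 - ∫ v : ℝ, f t z v) (Ioc 0 T) :=
  (integrableOn_const (by simp)).sub (h.integrable_density t)

theorem intervalIntegrable_charge (h : IsSolution T f E) (hT : 0 < T) (t a b : ℝ) :
    IntervalIntegrable (fun z => 1 - ∫ v : ℝ, f t z v) volume a b := by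
  have hp : Function.Periodic (fun z => 1 - ∫ v : ℝ, f t z v) T := by
    intro z
    simp only [h.periodic_f]
  refine hp.intervalIntegrable₀ hT.ne' ?_ a b
  rw [intervalIntegrable_iff_integrableOn_Ioc_of_le hT.le]
  exact h.integrable_charge t

/-- Periodicity of `E t` makes the total charge over a period vanish at each time separately; the
Vlasov equation is not involved. -/
theorem mass (h : IsSolution T f E) (hT : 0 < T) (t : ℝ) :
    ∫ p in Ioc 0 T ×ˢ univ, f t p.1 p.2 = T := by
  have h1 := h.poisson t 0 (0 + T)
  rw [h.periodic_E, sub_self, zero_add, intervalIntegral.integral_of_le hT.le,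
    integral_sub (integrable_const _) (h.integrable_density t), h.integral_density] at h1
  simp [hT.le] at h1
  linarith

theorem abs_mass (h : IsSolution T f E) (hT : 0 < T) (t : ℝ) :
    ∫ p in Ioc 0 T ×ˢ univ, |f t p.1 p.2| = T := by
  simp_rw [abs_of_nonneg (h.nonneg t _ _)]
  exact h.mass hT t

/-- As `f ≥ 0`, the charge is at most `1 + ∫ f dv` in absolute value, and this has integral `2T`
over a period. -/
theorem abs_sub_le (h : IsSolution T f E) (hT : 0 < T) (t : ℝ) {x y : ℝ} (hx : x ∈ Icc 0 T)
    (hy : y ∈ Icc 0 T) : |E t y - E t x| ≤ 2 * T := by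
  wlog hxy : x ≤ y generalizing x y
  · rw [abs_sub_comm]; exact this hy hx (le_of_not_ge hxy)
  rw [h.poisson, intervalIntegral.integral_of_le hxy]
  have hsub : Ioc x y ⊆ Ioc 0 T := Ioc_subset_Ioc hx.1 hy.2
  have h3 : IntegrableOn (fun z => 1 + ∫ v : ℝ, f t z v) (Ioc 0 T) :=
    (integrableOn_const (by simp)).add (h.integrable_density t)
  have hpos : ∀ z, 0 ≤ ∫ v : ℝ, f t z v := fun z => integral_nonneg fun v => h.nonneg t z v
  calc |∫ z in Ioc x y, (1 - ∫ v : ℝ, f t z v)|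
      ≤ ∫ z in Ioc x y, (1 + ∫ v : ℝ, f t z v) := by
        rw [← Real.norm_eq_abs]
        refine norm_integral_le_of_norm_le (h3.mono_set hsub) (Filter.Eventually.of_forall fun z => ?_)
        rw [Real.norm_eq_abs, abs_le]
        constructor <;> linarith [hpos z]
    _ ≤ ∫ z in Ioc 0 T, (1 + ∫ v : ℝ, f t z v) :=
        setIntegral_mono_set h3 (Filter.Eventually.of_forall fun z => by
          have := hpos z; change (0:ℝ) ≤ _; linarith) hsub.eventuallyLE
    _ = 2 * T := by
        rw [integral_add (integrable_const _) (h.integrable_density t),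
          h.integral_density, h.mass hT]
        simp [hT.le]; ring

theorem continuous_field (h : IsSolution T f E) (hT : 0 < T) (t : ℝ) : Continuous (E t) := by
  have h1 : E t = fun x => E t 0 + ∫ z in (0 : ℝ)..x, (1 - ∫ v : ℝ, f t z v) := by
    ext x; rw [← h.poisson]; ring
  rw [h1]
  exact continuous_const.add
    (intervalIntegral.continuous_primitive (h.intervalIntegrable_charge hT t) 0)

/-- Since `E t` has mean zero, `T E(y)` is the integral over `z` of the differences `E(y) - E(z)`.
-/
theorem abs_field_le (h : IsSolution T f E) (hT : 0 < T) (t x : ℝ) : |E t x| ≤ 2 * T := by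
  have hper : Function.Periodic (E t) T := fun x => h.periodic_E t x
  obtain ⟨y, hy, hxy⟩ := hper.exists_mem_Ico₀ hT x
  rw [hxy]
  have hi : IntervalIntegrable (E t) volume 0 T := (h.continuous_field hT t).intervalIntegrable _ _
  have h1 : T * E t y = ∫ z in (0 : ℝ)..T, (E t y - E t z) := by
    rw [intervalIntegral.integral_sub (by simp) hi, h.mean_E]
    simp
  have h2 : ‖∫ z in (0 : ℝ)..T, (E t y - E t z)‖ ≤ 2 * T * |T - 0| := by
    refine intervalIntegral.norm_integral_le_of_norm_le_const fun z hz => ?_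
    rw [uIoc_of_le hT.le] at hz
    exact h.abs_sub_le hT t (Ioc_subset_Icc_self hz) (Ico_subset_Icc_self hy)
  rw [← h1, sub_zero, Real.norm_eq_abs, abs_mul, abs_of_pos hT, mul_comm] at h2
  exact le_of_mul_le_mul_right h2 hT

/-- Measurability of `E` is not part of `IsSolution`. The primitive of the charge is continuous in
`x` and measurable in `t`, hence jointly measurable, and the mean-zero condition expresses `E t 0`
through it. -/
theorem measurable_field (h : IsSolution T f E) (hT : 0 < T) :
    Measurable (Function.uncurry E) := by
  have hden : Measurable fun p : ℝ × ℝ => 1 - ∫ v : ℝ, f p.1 p.2 v := by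
    refine measurable_const.sub (StronglyMeasurable.integral_prod_right'
      (f := fun q : (ℝ × ℝ) × ℝ => f q.1.1 q.1.2 q.2) ?_).measurable
    exact (h.measurable.comp (by fun_prop :
      Measurable fun q : (ℝ × ℝ) × ℝ => (q.1.1, q.1.2, q.2))).stronglyMeasurable
  have hprim : ∀ x, Measurable fun t => ∫ z in (0 : ℝ)..x, (1 - ∫ v : ℝ, f t z v) := by
    intro x
    unfold intervalIntegral
    exact (StronglyMeasurable.integral_prod_right' hden.stronglyMeasurable).measurable.sub
      (StronglyMeasurable.integral_prod_right' hden.stronglyMeasurable).measurable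
  have hcont : ∀ t, Continuous fun x => ∫ z in (0 : ℝ)..x, (1 - ∫ v : ℝ, f t z v) := fun t =>
    intervalIntegral.continuous_primitive (h.intervalIntegrable_charge hT t) 0
  have hjoint : Measurable (Function.uncurry fun x t => ∫ z in (0 : ℝ)..x, (1 - ∫ v : ℝ, f t z v)) :=
    measurable_uncurry_of_continuous_of_measurable hcont hprim
  have h0 : ∀ t, E t 0 = -(T⁻¹ * ∫ x in (0 : ℝ)..T, ∫ z in (0 : ℝ)..x, (1 - ∫ v : ℝ, f t z v)) := by
    intro t
    have h1 : ∫ x in (0 : ℝ)..T, (E t x - E t 0) =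
        ∫ x in (0 : ℝ)..T, ∫ z in (0 : ℝ)..x, (1 - ∫ v : ℝ, f t z v) := by
      congr 1; ext x; exact h.poisson t 0 x
    rw [intervalIntegral.integral_sub ((h.continuous_field hT t).intervalIntegrable _ _) (by simp),
      h.mean_E] at h1
    rw [← h1]
    simp
    field_simp
  have hz : Measurable fun t => E t 0 := by
    simp_rw [h0]
    unfold intervalIntegral at hjoint ⊢
    refine ((Measurable.sub ?_ ?_).const_mul _).neg
    · exact (StronglyMeasurable.integral_prod_right' (f := fun q : ℝ × ℝ =>
        (∫ z in Ioc 0 q.2, (1 - ∫ v : ℝ, f q.1 z v)) - ∫ z in Ioc q.2 0, (1 - ∫ v : ℝ, f q.1 z v))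
        (hjoint.comp measurable_swap).stronglyMeasurable).measurable
    · exact (StronglyMeasurable.integral_prod_right' (f := fun q : ℝ × ℝ =>
        (∫ z in Ioc 0 q.2, (1 - ∫ v : ℝ, f q.1 z v)) - ∫ z in Ioc q.2 0, (1 - ∫ v : ℝ, f q.1 z v))
        (hjoint.comp measurable_swap).stronglyMeasurable).measurable
  have h2 : Function.uncurry E = fun p : ℝ × ℝ =>
      E p.1 0 + ∫ z in (0 : ℝ)..p.2, (1 - ∫ v : ℝ, f p.1 z v) := by
    ext ⟨t, x⟩
    simp only [Function.uncurry_apply_pair]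
    rw [← h.poisson]; ring
  rw [h2]
  exact (hz.comp measurable_fst).add (hjoint.comp measurable_swap)

/-- The density of force `E f`. -/
theorem integrable_force (h : IsSolution T f E) (hT : 0 < T) (t : ℝ) :
    IntegrableOn (fun p : ℝ × ℝ => E t p.1 * f t p.1 p.2) (Ioc 0 T ×ˢ univ) := by
  refine (h.integrable t).bdd_mul (c := 2 * T)
    (((h.continuous_field hT t).comp continuous_fst).aestronglyMeasurable)
    (Filter.Eventually.of_forall fun p => h.abs_field_le hT t p.1)

theorem abs_force_le (h : IsSolution T f E) (hT : 0 < T) (t : ℝ) :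
    ∫ p in Ioc 0 T ×ˢ univ, |E t p.1 * f t p.1 p.2| ≤ 2 * T * T := by
  calc _ ≤ ∫ p in Ioc 0 T ×ˢ univ, 2 * T * |f t p.1 p.2| := by
        refine integral_mono (h.integrable_force hT t).abs ((h.integrable t).abs.const_mul _) ?_
        intro p
        simp only [abs_mul]
        gcongr
        exact h.abs_field_le hT t p.1
    _ = _ := by rw [integral_const_mul, h.abs_mass hT]

theorem measurable_distribution (h : IsSolution T f E) :
    Measurable (Function.uncurry fun (t : ℝ) (p : ℝ × ℝ) => f t p.1 p.2) := h.measurable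

theorem measurable_force (h : IsSolution T f E) (hT : 0 < T) :
    Measurable (Function.uncurry fun (t : ℝ) (p : ℝ × ℝ) => E t p.1 * f t p.1 p.2) :=
  ((h.measurable_field hT).comp (by fun_prop : Measurable fun q : ℝ × ℝ × ℝ => (q.1, q.2.1))).mul
    h.measurable

end IsSolution

/-! ### From the weak Vlasov equation to transport along free characteristics. -/

theorem intervalIntegrable_of_bounded {g : ℝ → ℂ} (hg : Measurable g) {C : ℝ}
    (hC : ∀ u, ‖g u‖ ≤ C) (a b : ℝ) : IntervalIntegrable g volume a b := by
  rw [intervalIntegrable_iff]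
  exact Measure.integrableOn_of_bounded (M := C) (by simp) hg.aestronglyMeasurable
    (Filter.Eventually.of_forall hC)

/-- A function with quadratically small increments, up to the integral of `g`, is a primitive
of `g`. -/
theorem sub_eq_integral_of_quadratic {h g : ℝ → ℂ} {a b C : ℝ} (hab : a ≤ b)
    (hg : ∀ c d, IntervalIntegrable g volume c d)
    (hq : ∀ x y, a ≤ x → x ≤ y → y ≤ b → ‖h y - h x - ∫ u in x..y, g u‖ ≤ C * (y - x) ^ 2) :
    h b - h a = ∫ u in a..b, g u := by
  set H : ℝ → ℂ := fun y => h y - ∫ u in a..y, g u with hH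
  have hHq : ∀ x y, a ≤ x → x ≤ y → y ≤ b → ‖H y - H x‖ ≤ C * (y - x) ^ 2 := by
    intro x y hx hxy hy
    have e : H y - H x = h y - h x - ∫ u in x..y, g u := by
      simp only [hH]
      rw [← intervalIntegral.integral_add_adjacent_intervals (hg a x) (hg x y)]
      ring
    rw [e]; exact hq x y hx hxy hy
  -- Each of `n` equal pieces contributes at most `C ((b - a)/n)²`.
  have hconst : ∀ n : ℕ, 0 < n → ‖H b - H a‖ ≤ C * (b - a) ^ 2 / n := by
    intro n hn
    have hn' : (0 : ℝ) < n := by exact_mod_cast hn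
    set x : ℕ → ℝ := fun i => a + i * ((b - a) / n) with hx
    have hd : 0 ≤ (b - a) / n := div_nonneg (sub_nonneg.2 hab) hn'.le
    have e : H b - H a = ∑ i ∈ Finset.range n, (H (x (i + 1)) - H (x i)) := by
      rw [Finset.sum_range_sub (fun i => H (x i))]
      simp only [hx]
      congr 2
      · field_simp; ring
      · simp
    rw [e]
    calc _ ≤ ∑ i ∈ Finset.range n, C * ((b - a) / n) ^ 2 := by
          refine norm_sum_le_of_le _ fun i hi => ?_
          have h1 : x (i + 1) - x i = (b - a) / n := by simp only [hx]; push_cast; ring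
          have h2 := hHq (x i) (x (i + 1)) ?_ ?_ ?_
          · rwa [h1] at h2
          · simp only [hx]; have : 0 ≤ (i : ℝ) * ((b - a) / n) := by positivity
            linarith
          · linarith
          · have h3 : ((i + 1 : ℕ) : ℝ) ≤ n := by exact_mod_cast Finset.mem_range.1 hi
            calc x (i + 1) ≤ a + n * ((b - a) / n) := by
                  simp only [hx]; gcongr
              _ = b := by field_simp; ring
      _ = _ := by
          rw [Finset.sum_const, Finset.card_range, nsmul_eq_mul]
          field_simp
  have h0 : ‖H b - H a‖ ≤ 0 := by
    refine ge_of_tendsto (tendsto_const_div_atTop_nhds_zero_nat (C * (b - a) ^ 2)) ?_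
    filter_upwards [Filter.eventually_gt_atTop 0] with n hn using hconst n hn
  have h1 := sub_eq_zero.1 (norm_le_zero_iff.1 h0)
  simp only [hH, intervalIntegral.integral_same, sub_zero] at h1
  rw [← h1]; ring

theorem norm_char_sub_le (ζ ζ' v : ℝ) :
    ‖char ζ' v - char ζ v‖ ≤ 2 * Real.pi * |ζ' - ζ| * |v| := by
  have e : char ζ' v - char ζ v = char ζ v *
      (Complex.exp (Complex.I * (-(2 * Real.pi * (ζ' - ζ) * v) : ℝ)) - 1) := by
    simp only [char]
    rw [mul_sub, mul_one, ← Complex.exp_add]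
    congr 2; push_cast; ring
  rw [e, norm_mul, norm_char, one_mul]
  refine (Real.norm_exp_I_mul_ofReal_sub_one_le).trans (le_of_eq ?_)
  rw [Real.norm_eq_abs, abs_neg, abs_mul, abs_mul, abs_of_pos Real.two_pi_pos]

/-- With `y = -2π(ζ' - ζ)v`: Taylor's formula for `e^{iy}` when `|y| ≤ 1`, and the crude bound `2|y|
≤ 2y²` otherwise. -/
theorem norm_char_sub_sub_le (ζ ζ' v : ℝ) :
    ‖char ζ' v - char ζ v - (ζ' - ζ) * (-(2 * Real.pi * Complex.I) * (v * char ζ v))‖ ≤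
      2 * (2 * Real.pi * |ζ' - ζ| * |v|) ^ 2 := by
  set y : ℝ := -(2 * Real.pi * (ζ' - ζ) * v) with hy
  have e : char ζ' v - char ζ v - (ζ' - ζ) * (-(2 * Real.pi * Complex.I) * (v * char ζ v)) =
      char ζ v * (Complex.exp (Complex.I * y) - 1 - Complex.I * y) := by
    have : char ζ' v = char ζ v * Complex.exp (Complex.I * y) := by
      simp only [char]
      rw [← Complex.exp_add]
      congr 1; simp only [hy]; push_cast; ring
    rw [this]; simp only [hy]; push_cast; ring
  have hn : ‖Complex.I * (y : ℂ)‖ = |y| := by simp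
  have habs : 2 * Real.pi * |ζ' - ζ| * |v| = |y| := by
    rw [hy, abs_neg, abs_mul, abs_mul, abs_of_pos Real.two_pi_pos]
  rw [e, norm_mul, norm_char, one_mul, habs]
  rcases le_total |y| 1 with h | h
  · have := Complex.norm_exp_sub_one_sub_id_le (x := Complex.I * y) (by rw [hn]; exact h)
    rw [hn] at this
    nlinarith [sq_nonneg |y|]
  · have h1 : ‖Complex.exp (Complex.I * y) - 1‖ ≤ |y| := Real.norm_exp_I_mul_ofReal_sub_one_le
    have h2 := norm_sub_le (Complex.exp (Complex.I * y) - 1) (Complex.I * y)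
    rw [hn] at h2
    nlinarith

/-- Uniform bounds for a cut-off function and its derivative with polynomial weights. -/
theorem exists_weighted_bound {χ : ℝ → ℂ} (hχ : ContDiff ℝ ((⊤ : ℕ∞) : WithTop ℕ∞) χ)
    (hc : HasCompactSupport χ) :
    ∃ M : ℝ, 0 ≤ M ∧ ∀ v, ‖χ v‖ ≤ M ∧ |v| * ‖χ v‖ ≤ M ∧ |v| ^ 2 * ‖χ v‖ ≤ M ∧
      ‖deriv χ v‖ ≤ M ∧ |v| * ‖deriv χ v‖ ≤ M := by
  have hd : Continuous (deriv χ) := hχ.continuous_deriv (by simp)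
  have hb : ∀ g : ℝ → ℂ, Continuous g → HasCompactSupport g →
      ∃ C, ∀ v, ‖(((1 + |v| + |v| ^ 2) : ℝ) : ℂ) * g v‖ ≤ C := fun g hg hgc =>
    (HasCompactSupport.mul_left hgc).exists_bound_of_continuous (by fun_prop)
  obtain ⟨C, hC⟩ := hb χ hχ.continuous hc
  obtain ⟨D, hD⟩ := hb _ hd hc.deriv
  have hC0 : 0 ≤ C := (norm_nonneg _).trans (hC 0)
  have hD0 : 0 ≤ D := (norm_nonneg _).trans (hD 0)
  refine ⟨C + D, by positivity, fun v => ?_⟩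
  have h1 := hC v
  have h2 := hD v
  rw [norm_mul, Complex.norm_real, Real.norm_of_nonneg (by positivity)] at h1 h2
  have a1 := norm_nonneg (χ v)
  have a2 := norm_nonneg (deriv χ v)
  have a3 := abs_nonneg v
  have b1 := mul_nonneg a3 a1
  have b2 := mul_nonneg a3 a2
  have b3 := mul_nonneg (sq_nonneg |v|) a1
  have b4 := mul_nonneg (sq_nonneg |v|) a2
  refine ⟨?_, ?_, ?_, ?_, ?_⟩ <;> nlinarith

namespace IsSolution

variable {T : ℝ} {f : ℝ → ℝ → ℝ → ℝ} {E : ℝ → ℝ → ℝ}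

theorem norm_moment_distribution_le (h : IsSolution T f E) (hT : 0 < T) {ξ t : ℝ} {β : ℝ → ℂ}
    {C : ℝ} (hC : ∀ v, ‖β v‖ ≤ C) :
    ‖moment T ξ (fun p => f t p.1 p.2) β‖ ≤ C * T := by
  refine (norm_moment_le (h.integrable t) hC).trans (le_of_eq ?_)
  rw [h.abs_mass hT]

theorem norm_moment_force_le (h : IsSolution T f E) (hT : 0 < T) {ξ t : ℝ} {β : ℝ → ℂ}
    {C : ℝ} (hC : ∀ v, ‖β v‖ ≤ C) :
    ‖moment T ξ (fun p => E t p.1 * f t p.1 p.2) β‖ ≤ C * (2 * T * T) := by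
  refine (norm_moment_le (h.integrable_force hT t) hC).trans ?_
  have : 0 ≤ C := (norm_nonneg _).trans (hC 0)
  gcongr
  exact h.abs_force_le hT t

theorem measurable_weak_integrand (h : IsSolution T f E) (hT : 0 < T) (ξ : ℝ)
    {β γ : ℝ → ℝ → ℂ} (hβ : Measurable (Function.uncurry β)) (hγ : Measurable (Function.uncurry γ)) :
    Measurable fun u => moment T ξ (fun p => f u p.1 p.2) (β u) -
      moment T ξ (fun p => E u p.1 * f u p.1 p.2) (γ u) :=
  (measurable_moment h.measurable_distribution hβ).sub (measurable_moment (h.measurable_force hT) hγ)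

theorem intervalIntegrable_weak_integrand (h : IsSolution T f E) (hT : 0 < T) (ξ : ℝ)
    {β γ : ℝ → ℝ → ℂ} (hβ : Measurable (Function.uncurry β)) (hγ : Measurable (Function.uncurry γ))
    {C D : ℝ} (hC : ∀ u v, ‖β u v‖ ≤ C) (hD : ∀ u v, ‖γ u v‖ ≤ D) (a b : ℝ) :
    IntervalIntegrable (fun u => moment T ξ (fun p => f u p.1 p.2) (β u) -
      moment T ξ (fun p => E u p.1 * f u p.1 p.2) (γ u)) volume a b :=
  intervalIntegrable_of_bounded (h.measurable_weak_integrand hT ξ hβ hγ)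
    (C := C * T + D * (2 * T * T)) (fun u => (norm_sub_le _ _).trans
      (add_le_add (h.norm_moment_distribution_le hT (hC u)) (h.norm_moment_force_le hT (hD u)))) a b

/-- The weak Vlasov equation for test functions `e^{-2πiξx} β(v)`. -/
theorem moment_sub_moment (h : IsSolution T f E) (hT : 0 < T) (n : ℤ) {β : ℝ → ℂ}
    (hβ : ContDiff ℝ ((⊤ : ℕ∞) : WithTop ℕ∞) β) (hc : HasCompactSupport β) (t₁ t₂ : ℝ) :
    moment T (n / T) (fun p => f t₂ p.1 p.2) β - moment T (n / T) (fun p => f t₁ p.1 p.2) β =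
      ∫ u in t₁..t₂, (moment T (n / T) (fun p => f u p.1 p.2)
          (fun v => -(2 * Real.pi * Complex.I * (n / T : ℝ)) * (v * β v)) -
        moment T (n / T) (fun p => E u p.1 * f u p.1 p.2) (deriv β)) := by
  set ξ : ℝ := n / T with hξ
  obtain ⟨M, hM0, hM⟩ := exists_weighted_bound hβ hc
  have hdc : Continuous (deriv β) := hβ.continuous_deriv (by simp)
  have hβc := hβ.continuous
  have hvb : ∀ v : ℝ, ‖-(2 * Real.pi * Complex.I * ξ) * (v * β v)‖ ≤ 2 * Real.pi * |ξ| * M := by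
    intro v
    have := (hM v).2.1
    rw [norm_mul, norm_neg, norm_mul, norm_mul, norm_mul, norm_mul]
    simp only [Complex.norm_I, Complex.norm_real, Real.norm_eq_abs, Complex.norm_ofNat,
      abs_of_pos Real.pi_pos, mul_one]
    gcongr
  have hvm : Measurable fun v : ℝ => -(2 * Real.pi * Complex.I * ξ) * (v * β v) :=
    Continuous.measurable (by fun_prop)
  -- Test functions are real valued, so the weak equation is applied to the images under a
  -- real-linear `L`, in the end the real and the imaginary part.
  have key : ∀ L : ℂ →L[ℝ] ℝ,
      L (moment T ξ (fun p => f t₂ p.1 p.2) β - moment T ξ (fun p => f t₁ p.1 p.2) β) =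
      L (∫ u in t₁..t₂, (moment T ξ (fun p => f u p.1 p.2)
          (fun v => -(2 * Real.pi * Complex.I * ξ) * (v * β v)) -
        moment T ξ (fun p => E u p.1 * f u p.1 p.2) (deriv β))) := by
    intro L
    have hL : ∀ (r : ℝ) (z : ℂ), L ((r : ℂ) * z) = r * L z := by
      intro r z
      rw [← Complex.real_smul, map_smul, smul_eq_mul]
    have hmom : ∀ (w : ℝ × ℝ → ℝ) (γ : ℝ → ℂ) (C : ℝ), IntegrableOn w (Ioc 0 T ×ˢ univ) →
        Measurable γ → (∀ v, ‖γ v‖ ≤ C) →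
        L (moment T ξ w γ) = ∫ p in Ioc 0 T ×ˢ univ, w p * L (char ξ p.1 * γ p.2) := by
      intro w γ C hw hγ hC
      rw [moment, ← L.integral_comp_comm (integrable_moment hw hγ hC)]
      simp_rw [hL]
    have htest : IsTestFunction T (fun x v => L (char ξ x * β v)) := by
      refine ⟨?_, fun x v => ?_, ?_⟩
      · exact L.contDiff.comp (((contDiff_char ξ).comp contDiff_fst).mul (hβ.comp contDiff_snd))
      · simp only [hξ, char_add_period hT.ne']
      · obtain ⟨R, hR⟩ := hc.isCompact.isBounded.subset_closedBall 0
        refine ⟨R, fun x v hv => ?_⟩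
        have : v ∉ tsupport β := fun hmem => by
          have := hR hmem
          rw [mem_closedBall_zero_iff, Real.norm_eq_abs] at this
          linarith
        simp only [image_eq_zero_of_notMem_tsupport this, mul_zero, map_zero]
    have hv := h.vlasov _ htest t₁ t₂
    rw [map_sub, hmom _ _ M (h.integrable t₂) hβc.measurable fun v => (hM v).1,
      hmom _ _ M (h.integrable t₁) hβc.measurable fun v => (hM v).1, hv,
      ← L.intervalIntegral_comp_comm (h.intervalIntegrable_weak_integrand hT ξ
        (β := fun _ => fun v => -(2 * Real.pi * Complex.I * ξ) * (v * β v)) (γ := fun _ => deriv β)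
        (hvm.comp measurable_snd) (hdc.measurable.comp measurable_snd) (fun _ => hvb)
        (fun _ v => (hM v).2.2.2.1) t₁ t₂)]
    congr 1; ext u
    rw [map_sub, hmom _ _ _ (h.integrable u) hvm hvb,
      hmom _ _ M (h.integrable_force hT u) hdc.measurable fun v => (hM v).2.2.2.1, ← integral_sub]
    · congr 1; ext p
      have d1 : deriv (fun x => L (char ξ x * β p.2)) p.1 =
          L (-(2 * Real.pi * Complex.I * ξ) * char ξ p.1 * β p.2) :=
        (L.hasFDerivAt.comp_hasDerivAt p.1 ((hasDerivAt_char ξ p.1).mul_const (β p.2))).deriv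
      have d2 : deriv (fun v => L (char ξ p.1 * β v)) p.2 = L (char ξ p.1 * deriv β p.2) :=
        (L.hasFDerivAt.comp_hasDerivAt p.2 ((((hβ.differentiable (by simp)) p.2).hasDerivAt).const_mul
          (char ξ p.1))).deriv
      rw [d1, d2]
      have e : L (char ξ p.1 * (-(2 * Real.pi * Complex.I * ξ) * (p.2 * β p.2))) =
          p.2 * L (-(2 * Real.pi * Complex.I * ξ) * char ξ p.1 * β p.2) := by
        rw [← hL]; congr 1; ring
      rw [e]; ring
    · have := L.integrable_comp (integrable_moment (ξ := ξ) (h.integrable u) hvm hvb)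
      simpa only [hL] using this
    · have := L.integrable_comp (integrable_moment (ξ := ξ) (h.integrable_force hT u) hdc.measurable
        fun v => (hM v).2.2.2.1)
      simpa only [hL] using this
  exact Complex.ext (key Complex.reCLM) (key Complex.imCLM)

end IsSolution

namespace IsSolution

variable {T : ℝ} {f : ℝ → ℝ → ℝ → ℝ} {E : ℝ → ℝ → ℝ}

/-- The weak Vlasov equation along characteristics, with a velocity cut-off `χ`. -/
theorem moment_transport (h : IsSolution T f E) (hT : 0 < T) (n : ℤ) {χ : ℝ → ℂ}
    (hχ : ContDiff ℝ ((⊤ : ℕ∞) : WithTop ℕ∞) χ) (hc : HasCompactSupport χ) {t₀ t : ℝ}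
    (ht : t₀ ≤ t) :
    moment T (n / T) (fun p => f t p.1 p.2) (fun v => char (n / T * (t - t)) v * χ v) -
      moment T (n / T) (fun p => f t₀ p.1 p.2) (fun v => char (n / T * (t - t₀)) v * χ v) =
      ∫ u in t₀..t, -moment T (n / T) (fun p => E u p.1 * f u p.1 p.2)
        (fun v => char (n / T * (t - u)) v *
          (-(2 * Real.pi * Complex.I * (n / T * (t - u) : ℝ)) * χ v + deriv χ v)) := by
  set ξ : ℝ := n / T with hξ
  obtain ⟨M, hM0, hM⟩ := exists_weighted_bound hχ hc
  have hdc : Continuous (deriv χ) := hχ.continuous_deriv (by simp)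
  have hχc := hχ.continuous
  -- At time `u` the test function is `b (ξ (t - u))`, which is carried by free transport and
  -- reaches frequency `0` at time `t`; `b'` is the derivative in `v`.
  set b : ℝ → ℝ → ℂ := fun ζ v => char ζ v * χ v with hb
  set b' : ℝ → ℝ → ℂ := fun ζ v =>
    char ζ v * (-(2 * Real.pi * Complex.I * ζ) * χ v + deriv χ v) with hb'
  set Z : ℝ := |ξ| * (t - t₀) with hZ
  have hZ0 : 0 ≤ Z := mul_nonneg (abs_nonneg _) (by linarith)
  have hπ := Real.pi_pos
  have hnI : ∀ z : ℝ, ‖(2 * Real.pi * Complex.I * z : ℂ)‖ = 2 * Real.pi * |z| := by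
    intro z
    simp [abs_of_pos hπ]
  have hbd : ∀ ζ v, HasDerivAt (b ζ) (b' ζ v) v := by
    intro ζ v
    have := (hasDerivAt_char ζ v).mul (((hχ.differentiable (by simp)) v).hasDerivAt)
    convert! this using 1
    simp only [hb']; ring
  have hb1 : ∀ ζ v, ‖b ζ v‖ ≤ M := fun ζ v => by
    simp only [hb, norm_mul, norm_char, one_mul]; exact (hM v).1
  have hbv : ∀ ζ v, |v| * ‖b ζ v‖ ≤ M := fun ζ v => by
    simp only [hb, norm_mul, norm_char, one_mul]; exact (hM v).2.1
  have hbvv : ∀ ζ v, |v| ^ 2 * ‖b ζ v‖ ≤ M := fun ζ v => by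
    simp only [hb, norm_mul, norm_char, one_mul]; exact (hM v).2.2.1
  have hb'1 : ∀ ζ v, ‖b' ζ v‖ ≤ 2 * Real.pi * |ζ| * ‖χ v‖ + ‖deriv χ v‖ := fun ζ v => by
    simp only [hb', norm_mul, norm_char, one_mul]
    refine (norm_add_le _ _).trans ?_
    rw [norm_mul, norm_neg, hnI]
  have hbcont : Continuous (Function.uncurry b) := by
    simp only [hb, Function.uncurry_def]; fun_prop
  have hb'cont : Continuous (Function.uncurry b') := by
    simp only [hb', Function.uncurry_def]; fun_prop
  have hbsm : ∀ ζ, ContDiff ℝ ((⊤ : ℕ∞) : WithTop ℕ∞) (b ζ) := fun ζ => (contDiff_char ζ).mul hχ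
  have hbcs : ∀ ζ, HasCompactSupport (b ζ) := fun ζ => HasCompactSupport.mul_left hc
  have hbderiv : ∀ ζ, deriv (b ζ) = b' ζ := fun ζ => funext fun v => (hbd ζ v).deriv
  -- Lipschitz bounds in the frequency variable
  have hlip : ∀ ζ ζ' v, |ζ'| ≤ Z → ‖b' ζ' v - b' ζ v‖ ≤
      |ζ' - ζ| * (2 * Real.pi * (2 * Real.pi * Z * M + 2 * M)) := by
    intro ζ ζ' v hζ'
    have e : b' ζ' v - b' ζ v = (char ζ' v - char ζ v) *
        (-(2 * Real.pi * Complex.I * ζ') * χ v + deriv χ v) +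
        char ζ v * (-(2 * Real.pi * Complex.I * (ζ' - ζ : ℝ)) * χ v) := by
      simp only [hb']; push_cast; ring
    rw [e]
    have h1 := norm_char_sub_le ζ ζ' v
    have h2 : ‖-(2 * Real.pi * Complex.I * ζ') * χ v + deriv χ v‖ ≤
        2 * Real.pi * Z * ‖χ v‖ + ‖deriv χ v‖ := by
      refine (norm_add_le _ _).trans ?_
      rw [norm_mul, norm_neg, hnI]
      gcongr
    calc _ ≤ (2 * Real.pi * |ζ' - ζ| * |v|) * (2 * Real.pi * Z * ‖χ v‖ + ‖deriv χ v‖) +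
          2 * Real.pi * |ζ' - ζ| * ‖χ v‖ := by
          refine (norm_add_le _ _).trans (add_le_add ?_ (le_of_eq ?_))
          · rw [norm_mul]; gcongr
          · rw [norm_mul, norm_char, one_mul, norm_mul, norm_neg, hnI]
      _ = |ζ' - ζ| * (2 * Real.pi * (2 * Real.pi * Z * (|v| * ‖χ v‖) + (|v| * ‖deriv χ v‖ + ‖χ v‖))) := by
          ring
      _ ≤ _ := by
          obtain ⟨m1, m2, -, -, m5⟩ := hM v
          gcongr
          linarith
  -- Lipschitz bound in time
  set D : ℝ := M + (2 * Real.pi * Z * M + M) with hD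
  set Λ : ℝ := 2 * Real.pi * |ξ| * M * T + D * (2 * T * T) with hΛ
  have htime : ∀ ζ x y, |ζ| ≤ Z → x ≤ y →
      ‖moment T ξ (fun p => f y p.1 p.2) (fun v => v * b ζ v) -
        moment T ξ (fun p => f x p.1 p.2) (fun v => v * b ζ v)‖ ≤ Λ * (y - x) := by
    intro ζ x y hζ hxy
    have hsm : ContDiff ℝ ((⊤ : ℕ∞) : WithTop ℕ∞) (fun v : ℝ => (v : ℂ) * b ζ v) :=
      Complex.ofRealCLM.contDiff.mul (hbsm ζ)
    have hcs : HasCompactSupport (fun v : ℝ => (v : ℂ) * b ζ v) :=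
      HasCompactSupport.mul_left (hbcs ζ)
    rw [hξ, h.moment_sub_moment hT n hsm hcs x y, ← abs_of_nonneg (sub_nonneg.2 hxy)]
    refine intervalIntegral.norm_integral_le_of_norm_le_const fun u _ => ?_
    refine (norm_sub_le _ _).trans (add_le_add
      (h.norm_moment_distribution_le hT fun v => ?_) (h.norm_moment_force_le hT fun v => ?_))
    · rw [norm_mul, norm_neg, hnI, norm_mul, norm_mul, Complex.norm_real, Real.norm_eq_abs,
        ← mul_assoc |v|, ← sq, hξ]
      gcongr
      exact hbvv ζ v
    · have h1 : HasDerivAt (fun v : ℝ => (v : ℂ) * b ζ v) (1 * b ζ v + v * b' ζ v) v :=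
        (Complex.ofRealCLM.hasDerivAt (x := v)).mul (hbd ζ v)
      rw [h1.deriv, one_mul]
      refine (norm_add_le _ _).trans (add_le_add (hb1 ζ v) ?_)
      rw [norm_mul, Complex.norm_real, Real.norm_eq_abs]
      obtain ⟨m1, m2, -, -, m5⟩ := hM v
      calc |v| * ‖b' ζ v‖ ≤ |v| * (2 * Real.pi * Z * ‖χ v‖ + ‖deriv χ v‖) := by
            gcongr
            refine (hb'1 ζ v).trans ?_
            gcongr
        _ = 2 * Real.pi * Z * (|v| * ‖χ v‖) + |v| * ‖deriv χ v‖ := by ring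
        _ ≤ _ := by gcongr
  have hvbb : ∀ ζ (v : ℝ), ‖(v : ℂ) * b ζ v‖ ≤ M := fun ζ v => by
    rw [norm_mul, Complex.norm_real]; exact hbv ζ v
  have hbm : ∀ ζ, Measurable (b ζ) := fun ζ => (hbsm ζ).continuous.measurable
  have hvbm : ∀ ζ, Measurable fun v : ℝ => (v : ℂ) * b ζ v := fun ζ =>
    Measurable.mul (by fun_prop) (hbm ζ)
  have hb'm : ∀ ζ, Measurable (b' ζ) := fun ζ =>
    (hb'cont.comp (by fun_prop : Continuous fun v : ℝ => (ζ, v))).measurable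
  have hb'M : ∀ ζ v, ‖b' ζ v‖ ≤ 2 * Real.pi * |ζ| * M + M := fun ζ v =>
    (hb'1 ζ v).trans (by have := hM v; gcongr; exacts [this.1, this.2.2.2.1])
  -- interval integrability of the right-hand side
  have hgm : Measurable fun u => moment T ξ (fun p => E u p.1 * f u p.1 p.2) (b' (ξ * (t - u))) :=
    measurable_moment (h.measurable_force hT) (β := fun u => b' (ξ * (t - u)))
      (hb'cont.comp (by fun_prop : Continuous fun q : ℝ × ℝ => (ξ * (t - q.1), q.2))).measurable
  have hgint : ∀ c d, IntervalIntegrable (fun u =>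
      moment T ξ (fun p => E u p.1 * f u p.1 p.2) (b' (ξ * (t - u)))) volume c d := by
    intro c d
    have hbound : ∀ u, ‖moment T ξ (fun p => E u p.1 * f u p.1 p.2) (b' (ξ * (t - u)))‖ ≤
        (2 * Real.pi * |ξ * (t - u)| * M + M) * (2 * T * T) := fun u =>
      h.norm_moment_force_le hT (hb'M _)
    exact IntervalIntegrable.mono_fun' (g := fun u =>
      (2 * Real.pi * |ξ * (t - u)| * M + M) * (2 * T * T))
      (Continuous.intervalIntegrable (by fun_prop) _ _) hgm.aestronglyMeasurable
      (Filter.Eventually.of_forall hbound)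
  -- The weak equation admits only time-independent test functions. Over `[x, y]` the function is
  -- therefore frozen at `b ζx`, with an error quadratic in `y - x`.
  refine sub_eq_integral_of_quadratic
    (h := fun u => moment T ξ (fun p => f u p.1 p.2) (b (ξ * (t - u))))
    (C := 2 * (2 * Real.pi * |ξ|) ^ 2 * M * T + (2 * Real.pi * |ξ| * Λ +
      |ξ| * (2 * Real.pi * (2 * Real.pi * Z * M + 2 * M)) * (2 * T * T))) ht
    (fun c d => (hgint c d).neg) ?_
  intro x y hx hxy hy
  have hζ : ∀ u ∈ Icc t₀ t, |ξ * (t - u)| ≤ Z := by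
    intro u hu
    rw [abs_mul, abs_of_nonneg (a := t - u) (by linarith [hu.2]), hZ]
    gcongr
    exact hu.1
  set ζx := ξ * (t - x) with hζx
  set ζy := ξ * (t - y) with hζy
  have hζxZ : |ζx| ≤ Z := hζ x ⟨hx, hxy.trans hy⟩
  have hdiff : ζy - ζx = -(ξ * (y - x)) := by simp only [hζx, hζy]; ring
  set m : ℝ → (ℝ → ℂ) → ℂ := fun u β => moment T ξ (fun p => f u p.1 p.2) β with hm
  set mE : ℝ → (ℝ → ℂ) → ℂ := fun u β => moment T ξ (fun p => E u p.1 * f u p.1 p.2) β with hmE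
  have hw := h.moment_sub_moment hT n (hbsm ζx) (hbcs ζx) x y
  rw [← hξ, hbderiv] at hw
  simp only [moment_const_mul] at hw
  -- the first remainder
  set r : ℝ → ℂ := fun v => b ζy v - b ζx v - ((ζy - ζx : ℝ) : ℂ) *
    (-(2 * Real.pi * Complex.I)) * (v * b ζx v) with hr
  have hr1 : ∀ v, ‖r v‖ ≤ 2 * (2 * Real.pi * |ξ|) ^ 2 * M * (y - x) ^ 2 := by
    intro v
    have e : r v = (char ζy v - char ζx v -
        (ζy - ζx) * (-(2 * Real.pi * Complex.I) * (v * char ζx v))) * χ v := by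
      simp only [hr, hb]; push_cast; ring
    rw [e, norm_mul]
    calc _ ≤ 2 * (2 * Real.pi * |ζy - ζx| * |v|) ^ 2 * ‖χ v‖ := by
          gcongr
          exact norm_char_sub_sub_le ζx ζy v
      _ = 2 * (2 * Real.pi * |ξ|) ^ 2 * (|v| ^ 2 * ‖χ v‖) * (y - x) ^ 2 := by
          rw [hdiff, abs_neg, abs_mul, abs_of_nonneg (sub_nonneg.2 hxy)]; ring
      _ ≤ _ := by
          gcongr
          exact (hM v).2.2.1
  have hmr : m y r = m y (b ζy) - m y (b ζx) - ((ζy - ζx : ℝ) : ℂ) *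
      (-(2 * Real.pi * Complex.I)) * m y (fun v => v * b ζx v) := by
    simp only [hm, hr]
    rw [moment_sub (h.integrable y) (β := fun v => b ζy v - b ζx v)
      (γ := fun v => ((ζy - ζx : ℝ) : ℂ) * (-(2 * Real.pi * Complex.I)) * (v * b ζx v))
      (C := M + M) (D := ‖((ζy - ζx : ℝ) : ℂ) * (-(2 * Real.pi * Complex.I))‖ * M)
      ((hbm ζy).sub (hbm ζx)) ((hvbm ζx).const_mul _)
      (fun v => (norm_sub_le _ _).trans (add_le_add (hb1 _ v) (hb1 _ v)))
      (fun v => by rw [norm_mul]; gcongr; exact hvbb ζx v),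
      moment_sub (h.integrable y) (hbm _) (hbm _) (hb1 _) (hb1 _), moment_const_mul]
  have hint1 : IntervalIntegrable (fun u => -(2 * Real.pi * Complex.I * ξ) *
      m u (fun v => v * b ζx v) - mE u (b' ζx)) volume x y := by
    have := h.intervalIntegrable_weak_integrand hT ξ
      (β := fun _ => fun v => -(2 * Real.pi * Complex.I * ξ) * (v * b ζx v)) (γ := fun _ => b' ζx)
      (((hvbm ζx).const_mul (-(2 * Real.pi * Complex.I * ξ))).comp measurable_snd) ((hb'm ζx).comp measurable_snd)
      (C := 2 * Real.pi * |ξ| * M)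
      (fun _ v => by rw [norm_mul, norm_neg, hnI]; gcongr; exact hvbb ζx v) (fun _ => hb'M ζx) x y
    simpa only [moment_const_mul] using this
  -- The transport term of the weak equation cancels the first-order change of `b ζ` in `ζ`. What
  -- remains is the Taylor remainder `r`, the variation in time of the moment of `v b`, and the
  -- variation of the force term.
  have hmain : m y (b ζy) - m x (b ζx) - ∫ u in x..y, -mE u (b' (ξ * (t - u))) =
      m y r + ∫ u in x..y, (2 * Real.pi * Complex.I * ξ *
        (m y (fun v => v * b ζx v) - m u (fun v => v * b ζx v)) +
        (mE u (b' (ξ * (t - u))) - mE u (b' ζx))) := by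
    have e1 : ∫ u in x..y, (2 * Real.pi * Complex.I * ξ *
        (m y (fun v => v * b ζx v) - m u (fun v => v * b ζx v)) +
        (mE u (b' (ξ * (t - u))) - mE u (b' ζx))) =
        ∫ u in x..y, ((2 * Real.pi * Complex.I * ξ * m y (fun v => v * b ζx v) +
          (-(2 * Real.pi * Complex.I * ξ) * m u (fun v => v * b ζx v) - mE u (b' ζx))) -
          -mE u (b' (ξ * (t - u)))) := by
      congr 1; ext u; ring
    rw [e1, intervalIntegral.integral_sub (by exact (by simp : IntervalIntegrable _ _ _ _).add hint1)
      (by exact (hgint x y).neg), intervalIntegral.integral_add (by simp) hint1, ← hw, hmr, hdiff,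
      intervalIntegral.integral_const, Complex.real_smul]
    push_cast
    ring
  change ‖m y (b ζy) - m x (b ζx) - ∫ u in x..y, -mE u (b' (ξ * (t - u)))‖ ≤ _
  rw [hmain]
  refine (norm_add_le _ _).trans ?_
  rw [add_mul]
  refine add_le_add ((h.norm_moment_distribution_le hT hr1).trans (le_of_eq (by ring))) ?_
  have hb2 : ∀ u ∈ uIoc x y, ‖2 * Real.pi * Complex.I * ξ *
        (m y (fun v => v * b ζx v) - m u (fun v => v * b ζx v)) +
        (mE u (b' (ξ * (t - u))) - mE u (b' ζx))‖ ≤ (2 * Real.pi * |ξ| * Λ +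
      |ξ| * (2 * Real.pi * (2 * Real.pi * Z * M + 2 * M)) * (2 * T * T)) * (y - x) := by
    intro u hu
    rw [uIoc_of_le hxy] at hu
    have hΛ0 : 0 ≤ Λ := by positivity
    have hux : u - x ≤ y - x := by linarith [hu.2]
    have k1 := htime ζx u y hζxZ hu.2
    have k2 : ‖mE u (b' (ξ * (t - u))) - mE u (b' ζx)‖ ≤
        (|ξ| * (y - x) * (2 * Real.pi * (2 * Real.pi * Z * M + 2 * M))) * (2 * T * T) := by
      simp only [hmE]
      rw [← moment_sub (h.integrable_force hT u) (hb'm _) (hb'm _) (hb'M _) (hb'M _)]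
      refine h.norm_moment_force_le hT fun v => ?_
      refine (hlip ζx (ξ * (t - u)) v (hζ u ⟨by linarith [hu.1], by linarith [hu.2]⟩)).trans ?_
      have : |ξ * (t - u) - ζx| ≤ |ξ| * (y - x) := by
        have e : ξ * (t - u) - ζx = -(ξ * (u - x)) := by simp only [hζx]; ring
        rw [e, abs_neg, abs_mul, abs_of_pos (by linarith [hu.1] : (0:ℝ) < u - x)]
        gcongr
      gcongr
    refine (norm_add_le _ _).trans ?_
    rw [norm_mul, hnI]
    calc _ ≤ 2 * Real.pi * |ξ| * (Λ * (y - x)) +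
          (|ξ| * (y - x) * (2 * Real.pi * (2 * Real.pi * Z * M + 2 * M))) * (2 * T * T) := by
          refine add_le_add ?_ k2
          gcongr
          refine k1.trans ?_
          gcongr
          exact hu.1.le
      _ = _ := by ring
  refine (intervalIntegral.norm_integral_le_of_norm_le_const hb2).trans (le_of_eq ?_)
  rw [abs_of_nonneg (sub_nonneg.2 hxy)]
  ring

end IsSolution

/-! ### Removal of the velocity cut-off: Duhamel's formula. -/

theorem tendsto_moment {T ξ : ℝ} {w : ℝ × ℝ → ℝ} (hw : IntegrableOn w (Ioc 0 T ×ˢ univ))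
    {β : ℕ → ℝ → ℂ} {γ : ℝ → ℂ} (hβ : ∀ k, Measurable (β k)) {C : ℝ} (hC : ∀ k v, ‖β k v‖ ≤ C)
    (hlim : ∀ v, Filter.Tendsto (fun k => β k v) Filter.atTop (nhds (γ v))) :
    Filter.Tendsto (fun k => moment T ξ w (β k)) Filter.atTop (nhds (moment T ξ w γ)) := by
  unfold moment
  refine tendsto_integral_of_dominated_convergence (fun p => C * |w p|)
    (fun k => (integrable_moment hw (hβ k) (hC k)).aestronglyMeasurable) (hw.abs.const_mul C)
    (fun k => Filter.Eventually.of_forall fun p => ?_)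
    (Filter.Eventually.of_forall fun p => ((hlim p.2).const_mul _).const_mul _)
  rw [norm_mul, norm_mul, norm_char, one_mul, Complex.norm_real, mul_comm, Real.norm_eq_abs]
  gcongr
  exact hC k _

namespace IsSolution

variable {T : ℝ} {f : ℝ → ℝ → ℝ → ℝ} {E : ℝ → ℝ → ℝ}

/-- Duhamel's formula for the Fourier coefficients of the charge density. -/
theorem moment_duhamel (h : IsSolution T f E) (hT : 0 < T) (n : ℤ) {t₀ t : ℝ} (ht : t₀ ≤ t) :
    moment T (n / T) (fun p => f t p.1 p.2) (char 0) -
      moment T (n / T) (fun p => f t₀ p.1 p.2) (char (n / T * (t - t₀))) =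
      ∫ u in t₀..t, 2 * Real.pi * Complex.I * (n / T * (t - u) : ℝ) *
        moment T (n / T) (fun p => E u p.1 * f u p.1 p.2) (char (n / T * (t - u))) := by
  set ξ : ℝ := n / T with hξ
  let φ : ContDiffBump (0 : ℝ) := ⟨1, 2, one_pos, one_lt_two⟩
  set χ : ℝ → ℂ := fun v => (φ v : ℂ) with hχ
  have hχs : ContDiff ℝ ((⊤ : ℕ∞) : WithTop ℕ∞) χ := Complex.ofRealCLM.contDiff.comp φ.contDiff
  have hχc : HasCompactSupport χ := φ.hasCompactSupport.comp_left Complex.ofReal_zero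
  obtain ⟨M, hM0, hM⟩ := exists_weighted_bound hχs hχc
  -- The cut-offs `χ(c k * v)` tend to `1` while their derivatives are `O(c k)`. Passing to the
  -- limit needs no velocity moments of `f`, only its integrability and the boundedness of `E`.
  set c : ℕ → ℝ := fun k => ((k : ℝ) + 1)⁻¹ with hc
  have hc0 : ∀ k, 0 < c k := fun k => by positivity
  have hc1 : ∀ k, c k ≤ 1 := fun k => inv_le_one_of_one_le₀ (by simp)
  have hclim : Filter.Tendsto c Filter.atTop (nhds 0) := by
    simpa [hc] using tendsto_one_div_add_atTop_nhds_zero_nat (𝕜 := ℝ)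
  set ψ : ℕ → ℝ → ℂ := fun k v => χ (c k * v) with hψ
  have hψs : ∀ k, ContDiff ℝ ((⊤ : ℕ∞) : WithTop ℕ∞) (ψ k) := fun k =>
    hχs.comp (contDiff_const.mul contDiff_id)
  have hψc : ∀ k, HasCompactSupport (ψ k) := fun k =>
    hχc.comp_homeomorph (Homeomorph.mulLeft₀ (c k) (hc0 k).ne')
  have hψd : ∀ k v, deriv (ψ k) v = c k * deriv χ (c k * v) := by
    intro k v
    have h1 := (((hχs.differentiable (by simp)) (c k * v)).hasDerivAt).scomp v
      ((hasDerivAt_id v).const_mul (c k))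
    have h2 : deriv (ψ k) v = _ := h1.deriv
    rw [h2, mul_one, Complex.real_smul]
  have hψ1 : ∀ k v, ‖ψ k v‖ ≤ M := fun k v => (hM _).1
  have hψ2 : ∀ k v, ‖deriv (ψ k) v‖ ≤ M := fun k v => by
    rw [hψd, norm_mul, Complex.norm_real, Real.norm_eq_abs, abs_of_pos (hc0 k)]
    exact (mul_le_mul (hc1 k) (hM _).2.2.2.1 (norm_nonneg _) zero_le_one).trans (by simp)
  have hψl : ∀ v, Filter.Tendsto (fun k => ψ k v) Filter.atTop (nhds 1) := by
    intro v
    have h0 : χ 0 = 1 := by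
      simp only [hχ]
      rw [φ.one_of_mem_closedBall (by simp [φ])]; simp
    have h1 : Filter.Tendsto (fun k => c k * v) Filter.atTop (nhds 0) := by
      simpa using hclim.mul_const v
    rw [← h0]
    exact (hχs.continuous.tendsto 0).comp h1
  have hψl' : ∀ v, Filter.Tendsto (fun k => deriv (ψ k) v) Filter.atTop (nhds 0) := by
    intro v
    have h1 : Filter.Tendsto (fun k => c k * M) Filter.atTop (nhds 0) := by
      simpa using hclim.mul_const M
    refine squeeze_zero_norm (fun k => ?_) h1
    rw [hψd, norm_mul, Complex.norm_real, Real.norm_eq_abs, abs_of_pos (hc0 k)]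
    have := hc0 k
    gcongr
    exact (hM _).2.2.2.1
  have hψm : ∀ k, Measurable (ψ k) := fun k => (hψs k).continuous.measurable
  have hψdm : ∀ k, Measurable (deriv (ψ k)) := fun k => measurable_deriv _
  -- the integrands
  set β : ℕ → ℝ → ℝ → ℂ := fun k u v => char (ξ * (t - u)) v *
    (-(2 * Real.pi * Complex.I * (ξ * (t - u) : ℝ)) * ψ k v + deriv (ψ k) v) with hβ
  have hβ1 : ∀ k u v, ‖β k u v‖ ≤ 2 * Real.pi * |ξ * (t - u)| * M + M := by
    intro k u v
    have hπ := Real.pi_pos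
    simp only [hβ, norm_mul, norm_char, one_mul]
    refine (norm_add_le _ _).trans (add_le_add ?_ (hψ2 k v))
    rw [norm_mul]
    have e : ‖-(2 * Real.pi * Complex.I * (ξ * (t - u) : ℝ) : ℂ)‖ = 2 * Real.pi * |ξ * (t - u)| := by
      rw [norm_neg, norm_mul, Complex.norm_real, Real.norm_eq_abs]
      simp [abs_of_pos hπ]
    rw [e]
    gcongr
    exact hψ1 k v
  have hβm : ∀ k, Measurable (Function.uncurry (β k)) := by
    intro k
    have h1 : Measurable fun q : ℝ × ℝ => ψ k q.2 := (hψm k).comp measurable_snd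
    have h2 : Measurable fun q : ℝ × ℝ => deriv (ψ k) q.2 := (hψdm k).comp measurable_snd
    simp only [hβ, Function.uncurry_def]
    fun_prop
  have hβl : ∀ u v, Filter.Tendsto (fun k => β k u v) Filter.atTop
      (nhds (-(2 * Real.pi * Complex.I * (ξ * (t - u) : ℝ)) * char (ξ * (t - u)) v)) := by
    intro u v
    have := (((hψl v).const_mul (-(2 * Real.pi * Complex.I * (ξ * (t - u) : ℝ)))).add
      (hψl' v)).const_mul (char (ξ * (t - u)) v)
    rwa [mul_one, add_zero, mul_comm (char _ _)] at this
  have hL : ∀ (ζ r : ℝ), Filter.Tendsto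
      (fun k => moment T ξ (fun p => f r p.1 p.2) (fun v => char ζ v * ψ k v)) Filter.atTop
      (nhds (moment T ξ (fun p => f r p.1 p.2) (char ζ))) := by
    intro ζ r
    refine tendsto_moment (h.integrable r) (C := M) (fun k => ?_) (fun k v => ?_) (fun v => ?_)
    · have := hψm k
      fun_prop
    · rw [norm_mul, norm_char, one_mul]; exact hψ1 k v
    · simpa using (hψl v).const_mul (char ζ v)
  have hlhs := (hL (ξ * (t - t)) t).sub (hL (ξ * (t - t₀)) t₀)
  have hrhs : Filter.Tendsto (fun k => ∫ u in t₀..t, -moment T ξ (fun p => E u p.1 * f u p.1 p.2)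
      (β k u)) Filter.atTop (nhds (∫ u in t₀..t, 2 * Real.pi * Complex.I * (ξ * (t - u) : ℝ) *
        moment T ξ (fun p => E u p.1 * f u p.1 p.2) (char (ξ * (t - u))))) := by
    refine intervalIntegral.tendsto_integral_filter_of_dominated_convergence
      (fun u => (2 * Real.pi * |ξ * (t - u)| * M + M) * (2 * T * T))
      (Filter.Eventually.of_forall fun k =>
        (measurable_moment (h.measurable_force hT) (hβm k)).neg.aestronglyMeasurable)
      (Filter.Eventually.of_forall fun k => Filter.Eventually.of_forall fun u _ => ?_)
      (Continuous.intervalIntegrable (by fun_prop) _ _)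
      (Filter.Eventually.of_forall fun u _ => ?_)
    · rw [norm_neg]
      exact h.norm_moment_force_le hT (hβ1 k u)
    · have h1 := (tendsto_moment (ξ := ξ) (h.integrable_force hT u)
        (fun k => (hβm k).comp measurable_prodMk_left) (fun k => hβ1 k u) (hβl u)).neg
      rw [moment_const_mul, neg_mul, neg_neg] at h1
      exact h1
  have heq := tendsto_nhds_unique (hlhs.congr fun k => h.moment_transport hT n (hψs k) (hψc k) ht)
    hrhs
  rwa [sub_self, mul_zero] at heq

end IsSolution

/-! ### The Poisson equation in Fourier coefficients and the Volterra equation. -/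

theorem char_zero_left (x : ℝ) : char 0 x = 1 := by simp [char]

theorem char_zero_right (ξ : ℝ) : char ξ 0 = 1 := by simp [char]

theorem integral_char (ξ a b : ℝ) :
    2 * Real.pi * Complex.I * ξ * ∫ x in a..b, char ξ x = char ξ a - char ξ b := by
  have h := intervalIntegral.integral_eq_sub_of_hasDerivAt (a := a) (b := b)
    (f := char ξ) (f' := fun x => -(2 * Real.pi * Complex.I * ξ) * char ξ x)
    (fun x _ => hasDerivAt_char ξ x) (Continuous.intervalIntegrable (by fun_prop) _ _)
  rw [intervalIntegral.integral_const_mul] at h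
  linear_combination -h

theorem integral_char_period {T : ℝ} (hT : 0 < T) {n : ℤ} (hn : n ≠ 0) :
    ∫ x in Ioc 0 T, char (n / T) x = 0 := by
  have hξ : (n / T : ℝ) ≠ 0 := div_ne_zero (by exact_mod_cast hn) hT.ne'
  have h := integral_char (n / T) 0 T
  have h1 := char_add_period hT.ne' n 0
  rw [zero_add] at h1
  rw [h1, sub_self, intervalIntegral.integral_of_le hT.le] at h
  refine (mul_eq_zero.1 h).resolve_left ?_
  have : ((n / T : ℝ) : ℂ) ≠ 0 := by exact_mod_cast hξ
  exact mul_ne_zero Complex.two_pi_I_ne_zero this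

/-- Fourier coefficients of a primitive. -/
theorem integral_primitive_mul_char {T : ℝ} (hT : 0 < T) {n : ℤ} (hn : n ≠ 0) {c : ℝ → ℝ}
    (hc : IntegrableOn c (Ioc 0 T)) (hc0 : ∫ z in Ioc 0 T, c z = 0) {e : ℝ → ℝ} {e₀ : ℝ}
    (he : ∀ x, e x = e₀ + ∫ z in (0 : ℝ)..x, c z) :
    2 * Real.pi * Complex.I * (n / T : ℝ) * ∫ x in Ioc 0 T, (e x : ℂ) * char (n / T) x =
      ∫ z in Ioc 0 T, (c z : ℂ) * char (n / T) z := by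
  set ξ : ℝ := n / T with hξ
  have hξ0 : ξ ≠ 0 := div_ne_zero (by exact_mod_cast hn) hT.ne'
  set μ := (volume : Measure ℝ).restrict (Ioc 0 T) with hμ
  -- Fubini on the triangle `z ≤ x`. Integrating the character over `(z, T]` produces `e^{-2πiξz} -
  -- 1`, and the `-1` drops out by `hc0`.
  set Φ : ℝ → ℝ → ℂ := fun x z => (Iic x).indicator (fun z => (c z : ℂ) * char ξ x) z with hΦ
  have hcc : Integrable (fun z => (c z : ℂ)) μ := hc.ofReal
  have hch : Integrable (char ξ) μ := by
    refine Measure.integrableOn_of_bounded (M := 1) (by simp)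
      (Continuous.aestronglyMeasurable (by fun_prop)) (Filter.Eventually.of_forall fun x => ?_)
    rw [norm_char]
  have hΦi : Integrable (Function.uncurry Φ) (μ.prod μ) := by
    have h1 : Integrable (fun p : ℝ × ℝ => (c p.2 : ℂ) * char ξ p.1) (μ.prod μ) := by
      simpa only [mul_comm] using hch.mul_prod hcc
    have h2 : Function.uncurry Φ = {p : ℝ × ℝ | p.2 ≤ p.1}.indicator
        (fun p : ℝ × ℝ => (c p.2 : ℂ) * char ξ p.1) := by
      ext ⟨x, z⟩
      simp [Φ, indicator]
    rw [h2]
    exact h1.indicator (measurableSet_le measurable_snd measurable_fst)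
  have hswap := integral_integral_swap hΦi
  have hl : ∀ x ∈ Ioc 0 T, ∫ z, Φ x z ∂μ = ((∫ z in (0 : ℝ)..x, c z : ℝ) : ℂ) * char ξ x := by
    intro x hx
    simp only [hΦ]
    rw [integral_indicator measurableSet_Iic, integral_mul_const, hμ,
      Measure.restrict_restrict measurableSet_Iic, integral_complex_ofReal, inter_comm, Ioc_inter_Iic,
      min_eq_right hx.2, intervalIntegral.integral_of_le hx.1.le]
  have hr : ∀ z ∈ Ioc 0 T, 2 * Real.pi * Complex.I * ξ * ∫ x, Φ x z ∂μ =
      (c z : ℂ) * char ξ z - c z := by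
    intro z hz
    have e1 : (fun x => Φ x z) = (Ici z).indicator (fun x => (c z : ℂ) * char ξ x) := by
      ext x; simp [Φ, indicator]
    have h1 := char_add_period hT.ne' n 0
    rw [zero_add, ← hξ, char_zero_right] at h1
    have h2 : Ici z ∩ Ioc 0 T = Icc z T := by
      ext x; simp only [mem_inter_iff, mem_Ici, mem_Ioc, mem_Icc]
      constructor
      · rintro ⟨h1, h2, h3⟩; exact ⟨h1, h3⟩
      · rintro ⟨h1, h2⟩; exact ⟨h1, hz.1.trans_le h1, h2⟩
    rw [e1, integral_indicator measurableSet_Ici, integral_const_mul, hμ,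
      Measure.restrict_restrict measurableSet_Ici, h2, integral_Icc_eq_integral_Ioc,
      ← intervalIntegral.integral_of_le hz.2, ← mul_left_comm, integral_char, h1]
    ring
  have hE : ∫ x in Ioc 0 T, (e x : ℂ) * char ξ x = ∫ x, (e₀ * char ξ x + ∫ z, Φ x z ∂μ) ∂μ := by
    refine setIntegral_congr_fun measurableSet_Ioc fun x hx => ?_
    rw [hl x hx, he]; push_cast; ring
  have hcch : Integrable (fun z => (c z : ℂ) * char ξ z) μ :=
    hcc.mul_bdd (c := 1) (Continuous.aestronglyMeasurable (by fun_prop))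
      (Filter.Eventually.of_forall fun z => (norm_char _ _).le)
  have hadd : ∫ x, (e₀ * char ξ x + ∫ z, Φ x z ∂μ) ∂μ =
      (∫ x, e₀ * char ξ x ∂μ) + ∫ x, ∫ z, Φ x z ∂μ ∂μ :=
    integral_add (hch.const_mul _) hΦi.integral_prod_left
  rw [hE, hadd, integral_const_mul, integral_char_period hT hn, mul_zero, zero_add,
    hswap, ← integral_const_mul, setIntegral_congr_fun measurableSet_Ioc hr,
    integral_sub hcch hcc]
  have : ∫ z, (c z : ℂ) ∂μ = 0 := by rw [integral_complex_ofReal, hc0]; simp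
  rw [this, sub_zero]

theorem moment_sub_density {T ξ : ℝ} {w w' : ℝ × ℝ → ℝ} (hw : IntegrableOn w (Ioc 0 T ×ˢ univ))
    (hw' : IntegrableOn w' (Ioc 0 T ×ˢ univ)) {β : ℝ → ℂ} (hβ : Measurable β) {C : ℝ}
    (hC : ∀ v, ‖β v‖ ≤ C) :
    moment T ξ (fun p => w p - w' p) β = moment T ξ w β - moment T ξ w' β := by
  unfold moment
  rw [← integral_sub (integrable_moment hw hβ hC) (integrable_moment hw' hβ hC)]
  congr 1; ext p; push_cast; ring

theorem fourier_eq_integral_char (u : ℝ → ℂ) (ζ : ℝ) : 𝓕 u ζ = ∫ v, u v * char ζ v := by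
  rw [Real.fourier_real_eq_integral_exp_smul]
  congr 1; ext v
  rw [smul_eq_mul, mul_comm, char]
  congr 2; push_cast; ring

/-- Used twice: for `a = 1` it shows that the homogeneous profile has no nonzero modes, for `a = E`
it produces the memory term. -/
theorem moment_prod (T ξ ζ : ℝ) (a b : ℝ → ℝ) :
    moment T ξ (fun p => a p.1 * b p.2) (char ζ) =
      (∫ x in Ioc 0 T, (a x : ℂ) * char ξ x) * 𝓕 (fun v => (b v : ℂ)) ζ := by
  unfold moment
  rw [Measure.volume_eq_prod, ← Measure.prod_restrict, Measure.restrict_univ,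
    fourier_eq_integral_char, ← integral_prod_mul]
  congr 1; ext p; push_cast; ring

namespace IsSolution

variable {T : ℝ} {f : ℝ → ℝ → ℝ → ℝ} {E : ℝ → ℝ → ℝ}

theorem moment_char_zero (h : IsSolution T f E) (ξ t : ℝ) :
    moment T ξ (fun p => f t p.1 p.2) (char 0) =
      ∫ z in Ioc 0 T, ((∫ v, f t z v : ℝ) : ℂ) * char ξ z := by
  have hi := integrable_moment (ξ := ξ) (h.integrable t) (β := char 0) (by fun_prop) (C := 1)
    (fun v => (norm_char _ _).le)
  unfold moment
  rw [IntegrableOn, Measure.volume_eq_prod, ← Measure.prod_restrict, Measure.restrict_univ] at hi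
  rw [Measure.volume_eq_prod, ← Measure.prod_restrict, Measure.restrict_univ, integral_prod _ hi]
  congr 1; ext z
  rw [← integral_complex_ofReal, ← integral_mul_const]
  congr 1; ext v
  rw [char_zero_left, mul_one]

/-- The Poisson equation for the Fourier coefficients. -/
theorem fourier_poisson (h : IsSolution T f E) (hT : 0 < T) {n : ℤ} (hn : n ≠ 0) (t : ℝ) :
    2 * Real.pi * Complex.I * (n / T : ℝ) * ∫ x in Ioc 0 T, (E t x : ℂ) * char (n / T) x =
      -moment T (n / T) (fun p => f t p.1 p.2) (char 0) := by
  have hm : ∫ z in Ioc 0 T, (1 - ∫ v, f t z v) = 0 := by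
    rw [integral_sub (integrable_const _) (h.integrable_density t), h.integral_density, h.mass hT]
    simp [hT.le]
  have hch : IntegrableOn (char (n / T)) (Ioc 0 T) :=
    Measure.integrableOn_of_bounded (M := 1) (by simp)
      (Continuous.aestronglyMeasurable (by fun_prop))
      (Filter.Eventually.of_forall fun x => (norm_char _ _).le)
  have hd : IntegrableOn (fun z => ((∫ v, f t z v : ℝ) : ℂ) * char (n / T) z) (Ioc 0 T) := by
    have h1 : IntegrableOn (fun z => ((∫ v, f t z v : ℝ) : ℂ)) (Ioc 0 T) :=
      (h.integrable_density t).ofReal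
    exact h1.mul_bdd (c := 1) (Continuous.aestronglyMeasurable (by fun_prop))
      (Filter.Eventually.of_forall fun z => (norm_char _ _).le)
  rw [integral_primitive_mul_char hT hn (h.integrable_charge t) hm (e₀ := E t 0)
    (fun x => by rw [← h.poisson]; ring), h.moment_char_zero]
  calc _ = ∫ z in Ioc 0 T, (char (n / T) z - ((∫ v, f t z v : ℝ) : ℂ) * char (n / T) z) := by
        congr 1; ext z; push_cast; ring
    _ = _ := by rw [integral_sub hch hd, integral_char_period hT hn, zero_sub]

theorem integrable_profile {s : ℝ} {f₀ : ℝ → ℝ} (h₀ : IsProfile s f₀) (T : ℝ) {a : ℝ → ℝ}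
    (ha : Continuous a) :
    IntegrableOn (fun p : ℝ × ℝ => a p.1 * f₀ p.2) (Ioc 0 T ×ˢ univ) := by
  rw [IntegrableOn, Measure.volume_eq_prod, ← Measure.prod_restrict, Measure.restrict_univ]
  exact (ha.integrableOn_Ioc).mul_prod h₀.integrable

/-- The linearized Volterra equation for the Fourier coefficients of the charge density, with the
nonlinear term as a source. -/
theorem volterra (h : IsSolution T f E) (hT : 0 < T) {s : ℝ} {f₀ : ℝ → ℝ} (h₀ : IsProfile s f₀)
    {n : ℤ} (hn : n ≠ 0) {t₀ t : ℝ} (ht : t₀ ≤ t) :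
    moment T (n / T) (fun p => f t p.1 p.2) (char 0) +
      (∫ r in t₀..t, ((t - r : ℝ) : ℂ) * 𝓕 (fun v => (f₀ v : ℂ)) (n / T * (t - r)) *
        moment T (n / T) (fun p => f r p.1 p.2) (char 0)) =
      moment T (n / T) (fun p => f t₀ p.1 p.2 - f₀ p.2) (char (n / T * (t - t₀))) +
      ∫ r in t₀..t, 2 * Real.pi * Complex.I * (n / T : ℝ) * (t - r) *
        moment T (n / T) (fun p => E r p.1 * (f r p.1 p.2 - f₀ p.2)) (char (n / T * (t - r))) := by
  set ξ : ℝ := n / T with hξ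
  have hchm : ∀ ζ, Measurable (char ζ) := fun ζ => by fun_prop
  have hc1 : ∀ ζ v, ‖char ζ v‖ ≤ 1 := fun ζ v => (norm_char _ _).le
  have hi1 : IntegrableOn (fun p : ℝ × ℝ => f₀ p.2) (Ioc 0 T ×ˢ univ) := by
    simpa using integrable_profile h₀ T (a := fun _ => 1) continuous_const
  have hsplit : moment T ξ (fun p => f t₀ p.1 p.2) (char (ξ * (t - t₀))) =
      moment T ξ (fun p => f t₀ p.1 p.2 - f₀ p.2) (char (ξ * (t - t₀))) := by
    have h2 := moment_prod T ξ (ξ * (t - t₀)) (fun _ => 1) f₀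
    simp only [one_mul, Complex.ofReal_one] at h2
    rw [moment_sub_density (h.integrable t₀) hi1 (hchm _) (hc1 _), h2, hξ,
      integral_char_period hT hn, zero_mul, sub_zero]
  -- The part `E f₀` of the force factorizes, and the Poisson equation replaces `2πiξ Ê` by minus
  -- the charge mode; this is the linear term.
  have hforce : ∀ r, 2 * Real.pi * Complex.I * (ξ * (t - r) : ℝ) *
        moment T ξ (fun p => E r p.1 * f r p.1 p.2) (char (ξ * (t - r))) =
      2 * Real.pi * Complex.I * ξ * (t - r) *
        moment T ξ (fun p => E r p.1 * (f r p.1 p.2 - f₀ p.2)) (char (ξ * (t - r))) -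
      ((t - r : ℝ) : ℂ) * 𝓕 (fun v => (f₀ v : ℂ)) (ξ * (t - r)) *
        moment T ξ (fun p => f r p.1 p.2) (char 0) := by
    intro r
    have hi2 := integrable_profile h₀ T (h.continuous_field hT r)
    have h1 := moment_sub_density (ξ := ξ) (h.integrable_force hT r) hi2
      (hchm (ξ * (t - r))) (hc1 _)
    have h2 := h.fourier_poisson hT hn r
    simp only [← mul_sub] at h1
    rw [h1, moment_prod]
    rw [← hξ] at h2
    push_cast
    linear_combination ((t : ℂ) - r) * 𝓕 (fun v => (f₀ v : ℂ)) (ξ * (t - r)) * h2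
  have hmf : Measurable fun r => moment T ξ (fun p => f r p.1 p.2) (char 0) :=
    measurable_moment h.measurable_distribution (β := fun _ => char 0) (by
      simp only [Function.uncurry_def]; fun_prop)
  have hrm : ∀ r, ‖moment T ξ (fun p => f r p.1 p.2) (char 0)‖ ≤ 1 * T := fun r =>
    h.norm_moment_distribution_le hT (hc1 0)
  have hI2 : IntervalIntegrable (fun r => ((t - r : ℝ) : ℂ) * 𝓕 (fun v => (f₀ v : ℂ)) (ξ * (t - r)) *
        moment T ξ (fun p => f r p.1 p.2) (char 0)) volume t₀ t := by
    have hfc := h₀.continuous_fourier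
    exact (intervalIntegrable_of_bounded hmf hrm _ _).continuousOn_mul (by fun_prop)
  have hI1 : IntervalIntegrable (fun r => 2 * Real.pi * Complex.I * ξ * (t - r) *
        moment T ξ (fun p => E r p.1 * (f r p.1 p.2 - f₀ p.2)) (char (ξ * (t - r))))
        volume t₀ t := by
    have e : (fun r : ℝ => 2 * Real.pi * Complex.I * ξ * (t - r) *
        moment T ξ (fun p => E r p.1 * (f r p.1 p.2 - f₀ p.2)) (char (ξ * (t - r)))) = fun r =>
        2 * Real.pi * Complex.I * (ξ * (t - r) : ℝ) *
        moment T ξ (fun p => E r p.1 * f r p.1 p.2) (char (ξ * (t - r))) +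
        ((t - r : ℝ) : ℂ) * 𝓕 (fun v => (f₀ v : ℂ)) (ξ * (t - r)) *
        moment T ξ (fun p => f r p.1 p.2) (char 0) := by
      ext r; rw [hforce]; ring
    rw [e]
    refine IntervalIntegrable.add ?_ hI2
    have hmE : Measurable fun r => moment T ξ (fun p => E r p.1 * f r p.1 p.2) (char (ξ * (t - r))) :=
      measurable_moment (h.measurable_force hT) (β := fun r => char (ξ * (t - r))) (by
        simp only [Function.uncurry_def]; fun_prop)
    exact (intervalIntegrable_of_bounded hmE
      (fun r => h.norm_moment_force_le hT (hc1 _)) _ _).continuousOn_mul (by fun_prop)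
  have hd := h.moment_duhamel hT n ht
  rw [← hξ] at hd
  simp only [hforce] at hd
  rw [intervalIntegral.integral_sub hI1 hI2, hsplit] at hd
  linear_combination hd

end IsSolution

/-! ### Fourier series in `x`, weighted norms of moments and decay of free transport. -/

/-- The positive frequencies `(n + 1) / T` of the torus of length `T`. -/
def freq (T : ℝ) (n : ℕ) : ℝ := ((n + 1 : ℤ) : ℝ) / T

theorem freq_pos {T : ℝ} (hT : 0 < T) (n : ℕ) : 0 < freq T n := by
  unfold freq
  have : (0 : ℝ) < ((n + 1 : ℤ) : ℝ) := by exact_mod_cast Nat.succ_pos n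
  positivity

theorem inv_freq_le {T : ℝ} (hT : 0 < T) (n : ℕ) : (freq T n)⁻¹ ≤ T := by
  unfold freq
  rw [inv_div]
  refine div_le_self hT.le ?_
  push_cast
  linarith [(Nat.cast_nonneg n : (0 : ℝ) ≤ n)]

theorem summable_inv_freq_sq (T : ℝ) : Summable fun n => (freq T n)⁻¹ ^ 2 := by
  have h1 := ((summable_nat_add_iff 1).2 (Real.summable_one_div_nat_pow.2 one_lt_two)).mul_left
    (T ^ 2)
  refine h1.congr fun n => ?_
  unfold freq
  push_cast
  rw [inv_div, div_pow]
  ring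

theorem fourier_neg_coe (T : ℝ) (n : ℤ) (x : ℝ) :
    fourier (-n) (x : AddCircle T) = char (n / T) x := by
  rw [fourier_coe_apply, char]
  congr 1
  push_cast
  ring

/-- Bessel's inequality for the positive frequencies. -/
theorem tsum_sq_integral_mul_char_le {T : ℝ} (hT : 0 < T) {φ : ℝ → ℂ}
    (hφ : AEStronglyMeasurable φ (volume.restrict (Ioc 0 T))) :
    ∑' n, ‖∫ x in Ioc 0 T, φ x * char (freq T n) x‖ₑ ^ 2 ≤
      ENNReal.ofReal T * ∫⁻ x in Ioc 0 T, ‖φ x‖ₑ ^ 2 := by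
  by_cases htop : ∫⁻ x in Ioc 0 T, ‖φ x‖ₑ ^ 2 = ⊤
  · rw [htop, ENNReal.mul_top (by simpa using hT)]
    exact le_top
  have hL : MemLp φ 2 (volume.restrict (Ioc 0 T)) := by
    refine ⟨hφ, ?_⟩
    rw [eLpNorm_lt_top_iff_lintegral_rpow_enorm_lt_top (by simp) (by simp)]
    simpa using lt_top_iff_ne_top.2 htop
  have hs := hasSum_sq_fourierCoeffOn hT hL
  have hcoef : ∀ n : ℤ, fourierCoeffOn hT φ n =
      (T⁻¹ : ℝ) • ∫ x in Ioc 0 T, φ x * char (n / T) x := by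
    intro n
    rw [fourierCoeffOn_eq_integral, sub_zero, one_div, intervalIntegral.integral_of_le hT.le]
    congr 1
    refine integral_congr_ae (Filter.Eventually.of_forall fun x => ?_)
    simp only [smul_eq_mul]
    rw [mul_comm, fourier_neg_coe]
  have hterm : ∀ n : ℤ, ‖∫ x in Ioc 0 T, φ x * char (n / T) x‖ₑ ^ 2 =
      ENNReal.ofReal (T ^ 2) * ENNReal.ofReal (‖fourierCoeffOn hT φ n‖ ^ 2) := by
    intro n
    rw [← ENNReal.ofReal_mul (by positivity), hcoef, norm_smul, Real.norm_eq_abs,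
      abs_of_pos (inv_pos.2 hT), mul_pow, ← mul_assoc, inv_pow, mul_inv_cancel₀ (by positivity),
      one_mul, ENNReal.ofReal_pow (norm_nonneg _), ofReal_norm]
  have hint : Integrable (fun x => ‖φ x‖ ^ 2) (volume.restrict (Ioc 0 T)) :=
    (memLp_two_iff_integrable_sq_norm hφ).1 hL
  calc _ = ∑' n : ℕ, (fun m : ℤ => ‖∫ x in Ioc 0 T, φ x * char (m / T) x‖ₑ ^ 2) ((n : ℤ) + 1) := rfl
    _ ≤ ∑' m : ℤ, ‖∫ x in Ioc 0 T, φ x * char (m / T) x‖ₑ ^ 2 :=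
        ENNReal.tsum_comp_le_tsum_of_injective (f := fun n : ℕ => (n : ℤ) + 1)
          (fun a b h => by simpa using h) _
    _ = ENNReal.ofReal (T ^ 2) * ENNReal.ofReal (T⁻¹ * ∫ x in Ioc 0 T, ‖φ x‖ ^ 2) := by
        simp_rw [hterm]
        rw [ENNReal.tsum_mul_left, ← ENNReal.ofReal_tsum_of_nonneg (fun n => by positivity)
          hs.summable, hs.tsum_eq, sub_zero, smul_eq_mul, intervalIntegral.integral_of_le hT.le]
    _ = _ := by
        have hpos : 0 ≤ ∫ x in Ioc 0 T, ‖φ x‖ ^ 2 := integral_nonneg fun x => by positivity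
        rw [← ENNReal.ofReal_mul (by positivity), ← mul_assoc,
          show T ^ 2 * T⁻¹ = T by field_simp, ENNReal.ofReal_mul hT.le,
          ofReal_integral_eq_lintegral_ofReal hint (Filter.Eventually.of_forall fun x => by positivity)]
        simp_rw [ENNReal.ofReal_pow (norm_nonneg _), ofReal_norm]

/-- The supremum of a periodic function of mean zero is bounded by its positive frequencies. -/
theorem enorm_le_tsum_integral_mul_char {T : ℝ} (hT : 0 < T) {φ : ℝ → ℝ} (hφ : Continuous φ)
    (hper : ∀ x, φ (x + T) = φ x) (hmean : ∫ x in (0 : ℝ)..T, φ x = 0) (y : ℝ) :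
    ‖φ y‖ₑ ≤ ENNReal.ofReal (2 * T⁻¹) *
      ∑' n, ‖∫ x in Ioc 0 T, (φ x : ℂ) * char (freq T n) x‖ₑ := by
  have : Fact (0 < T) := ⟨hT⟩
  by_cases htop : ∑' n, ‖∫ x in Ioc 0 T, (φ x : ℂ) * char (freq T n) x‖ₑ = ⊤
  · rw [htop, ENNReal.mul_top (by simpa using hT)]
    exact le_top
  have hperC : Function.Periodic (fun x => (φ x : ℂ)) T := fun x => by simp only [hper]
  let F : C(AddCircle T, ℂ) := ⟨hperC.lift, continuous_coinduced_dom.2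
    (by change Continuous fun x => (φ x : ℂ); fun_prop)⟩
  have hF : ∀ x : ℝ, F (x : AddCircle T) = φ x := fun x => rfl
  have hcoef : ∀ n : ℤ, fourierCoeff F n =
      (T⁻¹ : ℝ) • ∫ x in Ioc 0 T, (φ x : ℂ) * char (n / T) x := by
    intro n
    rw [fourierCoeff_eq_intervalIntegral _ _ 0, zero_add, one_div,
      intervalIntegral.integral_of_le hT.le]
    congr 1
    refine integral_congr_ae (Filter.Eventually.of_forall fun x => ?_)
    simp only [smul_eq_mul]
    rw [mul_comm, fourier_neg_coe, hF]
  have hen : ∀ n : ℤ, ‖fourierCoeff F n‖ₑ =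
      ENNReal.ofReal T⁻¹ * ‖∫ x in Ioc 0 T, (φ x : ℂ) * char (n / T) x‖ₑ := by
    intro n
    rw [hcoef, enorm_smul, Real.enorm_of_nonneg (inv_pos.2 hT).le]
  have hneg : ∀ n : ℤ, ‖∫ x in Ioc 0 T, (φ x : ℂ) * char ((-n : ℤ) / T) x‖ₑ =
      ‖∫ x in Ioc 0 T, (φ x : ℂ) * char (n / T) x‖ₑ := by
    intro n
    rw [← RCLike.enorm_conj, ← integral_conj]
    congr 2; ext x
    rw [map_mul, Complex.conj_ofReal, char, char, ← Complex.exp_conj]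
    congr 2
    have h2 : (starRingEnd ℂ) 2 = 2 := map_ofNat _ 2
    simp [neg_div, h2]
  have hzero : ∫ x in Ioc 0 T, (φ x : ℂ) * char ((0 : ℤ) / T) x = 0 := by
    simp only [Int.cast_zero, zero_div, char_zero_left, mul_one]
    rw [integral_complex_ofReal, ← intervalIntegral.integral_of_le hT.le, hmean]
    rfl
  -- The zero mode vanishes and, `φ` being real, negative frequencies repeat the positive ones;
  -- hence the factor `2`.
  have hsum : ∑' n : ℤ, ‖fourierCoeff F n‖ₑ = ENNReal.ofReal (2 * T⁻¹) *
      ∑' n, ‖∫ x in Ioc 0 T, (φ x : ℂ) * char (freq T n) x‖ₑ := by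
    rw [tsum_of_add_one_of_neg_add_one ENNReal.summable ENNReal.summable]
    simp_rw [hen, hneg, hzero]
    rw [enorm_zero, mul_zero, add_zero, ENNReal.tsum_mul_left, ENNReal.ofReal_mul zero_le_two,
      ENNReal.ofReal_ofNat, mul_assoc, two_mul]
    rfl
  have hsummable : Summable (fourierCoeff F) := by
    refine Summable.of_nnnorm ?_
    rw [← ENNReal.tsum_coe_ne_top_iff_summable]
    change ∑' n : ℤ, ‖fourierCoeff F n‖ₑ ≠ ⊤
    rw [hsum]
    exact ENNReal.mul_ne_top ENNReal.ofReal_ne_top htop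
  have hpt := has_pointwise_sum_fourier_series_of_summable hsummable (y : AddCircle T)
  have h1 : ‖φ y‖ₑ = ‖F (y : AddCircle T)‖ₑ := by
    rw [hF, ← ofReal_norm, ← ofReal_norm, Complex.norm_real]
  rw [h1, ← hpt.tsum_eq, ← hsum]
  refine (enorm_tsum_le_tsum_enorm).trans (ENNReal.tsum_le_tsum fun n => ?_)
  rw [enorm_smul]
  refine mul_le_of_le_one_right' ?_
  rw [← ofReal_norm, ENNReal.ofReal_le_one, fourier_apply, Circle.norm_coe]

theorem sq_mixedENorm (T s : ℝ) (g : ℝ → ℝ → ℝ) :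
    mixedENorm T s g ^ 2 = ∫⁻ x in Ioc 0 T, sobolevENorm s (g x) ^ 2 := by
  rw [mixedENorm, ← ENNReal.rpow_natCast, ← ENNReal.rpow_mul]
  norm_num

/-- The weighted norms of all moments of `a(x) g(x, v)` are controlled by `sup |a|` and the norm
of `g` in `L²_x H^s_v`. -/
theorem tsum_lintegral_moment_le {T : ℝ} (hT : 0 < T) (s : ℝ) {g : ℝ → ℝ → ℝ}
    (hg : Measurable (Function.uncurry g))
    (hgi : IntegrableOn (Function.uncurry g) (Ioc 0 T ×ˢ univ)) {a : ℝ → ℝ} (ha : Measurable a)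
    {A : ℝ} (hA : ∀ x, |a x| ≤ A) {e : ℝ≥0∞} (he : ∀ x, ‖a x‖ₑ ≤ e) :
    ∑' n, ∫⁻ η, ENNReal.ofReal (sobolevWeight s η) *
        ‖moment T (freq T n) (fun p => a p.1 * g p.1 p.2) (char η)‖ₑ ^ 2 ≤
      ENNReal.ofReal T * e ^ 2 * mixedENorm T s g ^ 2 := by
  have hw : Measurable fun ξ => ENNReal.ofReal (sobolevWeight s ξ) :=
    (continuous_sobolevWeight s).measurable.ennreal_ofReal
  have hg' : Measurable fun p : ℝ × ℝ => g p.1 p.2 := hg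
  have hmm : ∀ n, Measurable fun η =>
      moment T (freq T n) (fun p => a p.1 * g p.1 p.2) (char η) := fun n =>
    measurable_moment (α := ℝ) (w := fun _ p => a p.1 * g p.1 p.2) (β := char)
      (by simp only [Function.uncurry_def]
          exact (ha.comp (measurable_fst.comp measurable_snd)).mul (hg.comp measurable_snd))
      (by simp only [Function.uncurry_def]; fun_prop)
  set μ := (volume : Measure ℝ).restrict (Ioc 0 T) with hμ
  set γ : ℝ → ℝ → ℂ := fun η x => 𝓕 (fun v => (g x v : ℂ)) η with hγ
  have hγm : Measurable (Function.uncurry γ) := by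
    simp only [hγ, fourier_eq_integral_char, Function.uncurry_def]
    refine (StronglyMeasurable.integral_prod_right' (f := fun q : (ℝ × ℝ) × ℝ =>
      (g q.1.2 q.2 : ℂ) * char q.1.1 q.2) (Measurable.stronglyMeasurable ?_)).measurable
    have h1 : Measurable fun q : (ℝ × ℝ) × ℝ => g q.1.2 q.2 :=
      hg.comp (by fun_prop : Measurable fun q : (ℝ × ℝ) × ℝ => (q.1.2, q.2))
    fun_prop
  have hgi' : Integrable (fun p : ℝ × ℝ => g p.1 p.2) (μ.prod volume) := by
    rw [IntegrableOn, Measure.volume_eq_prod, ← Measure.prod_restrict, Measure.restrict_univ] at hgi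
    exact hgi
  have hag : IntegrableOn (fun p : ℝ × ℝ => a p.1 * g p.1 p.2) (Ioc 0 T ×ˢ univ) :=
    hgi.bdd_mul (c := A) (ha.comp measurable_fst).aestronglyMeasurable
      (Filter.Eventually.of_forall fun p => hA p.1)
  have hmom : ∀ n η, moment T (freq T n) (fun p => a p.1 * g p.1 p.2) (char η) =
      ∫ x in Ioc 0 T, (a x * γ η x) * char (freq T n) x := by
    intro n η
    have hi := integrable_moment (ξ := freq T n) hag (β := char η) (by fun_prop) (C := 1)
      (fun v => (norm_char _ _).le)
    unfold moment
    rw [IntegrableOn, Measure.volume_eq_prod, ← Measure.prod_restrict, Measure.restrict_univ] at hi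
    rw [Measure.volume_eq_prod, ← Measure.prod_restrict, Measure.restrict_univ, integral_prod _ hi]
    congr 1; ext x
    simp only [hγ]
    rw [fourier_eq_integral_char, ← integral_const_mul, ← integral_mul_const]
    congr 1; ext v
    push_cast; ring
  clear_value γ
  -- Bessel's inequality in `x` for each fixed velocity frequency `η`; the integration in `η` and
  -- Tonelli's theorem come afterwards.
  have hpoint : ∀ η, ∑' n, ‖moment T (freq T n) (fun p => a p.1 * g p.1 p.2) (char η)‖ₑ ^ 2 ≤
      ENNReal.ofReal T * e ^ 2 * ∫⁻ x, ‖γ η x‖ₑ ^ 2 ∂μ := by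
    intro η
    simp_rw [hmom]
    have hγη : Measurable (γ η) := hγm.of_uncurry_left
    refine (tsum_sq_integral_mul_char_le hT (Measurable.aestronglyMeasurable (by fun_prop))).trans ?_
    rw [mul_assoc, ← lintegral_const_mul (e ^ 2) (by fun_prop)]
    refine mul_le_mul_right (lintegral_mono fun x => ?_) _
    rw [enorm_mul, mul_pow]
    gcongr
    have : ‖(a x : ℂ)‖ₑ = ‖a x‖ₑ := by rw [← ofReal_norm, ← ofReal_norm, Complex.norm_real]
    rw [this]
    exact he x
  calc _ = ∫⁻ η, ENNReal.ofReal (sobolevWeight s η) *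
        ∑' n, ‖moment T (freq T n) (fun p => a p.1 * g p.1 p.2) (char η)‖ₑ ^ 2 := by
        simp_rw [← ENNReal.tsum_mul_left]
        exact (lintegral_tsum fun n => (hw.mul ((hmm n).enorm.pow_const 2)).aemeasurable).symm
    _ ≤ ∫⁻ η, ENNReal.ofReal T * e ^ 2 *
        ∫⁻ x, ENNReal.ofReal (sobolevWeight s η) * ‖γ η x‖ₑ ^ 2 ∂μ := by
        refine lintegral_mono fun η => ?_
        have hγη : Measurable (γ η) := hγm.of_uncurry_left
        dsimp only
        rw [lintegral_const_mul _ (by fun_prop), mul_left_comm]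
        gcongr
        exact hpoint η
    _ = ENNReal.ofReal T * e ^ 2 *
        ∫⁻ x, (∫⁻ η, ENNReal.ofReal (sobolevWeight s η) * ‖γ η x‖ₑ ^ 2) ∂μ := by
        have hjm : Measurable (Function.uncurry fun η x =>
            ENNReal.ofReal (sobolevWeight s η) * ‖γ η x‖ₑ ^ 2) :=
          (hw.comp measurable_fst).mul (hγm.enorm.pow_const 2)
        rw [lintegral_const_mul _ hjm.lintegral_prod_right, lintegral_lintegral_swap hjm.aemeasurable]
    _ ≤ _ := by
        rw [sq_mixedENorm]
        gcongr 1
        refine lintegral_mono_ae ?_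
        filter_upwards [hgi'.prod_right_ae] with x hx
        rw [hγ]
        exact lintegral_sobolevWeight_le hx s

/-- Free transport disperses: decay of the source term. -/
theorem lintegral_sq_free_transport_le {s ξ : ℝ} (hs : 0 ≤ s) (hξ : 0 < ξ) {G : ℝ → ℂ}
    (hG : Measurable G) {t₀ a b : ℝ} (hta : t₀ ≤ a) :
    ∫⁻ t in Ioc a b, ‖G (ξ * (t - t₀))‖ₑ ^ 2 ≤
      ENNReal.ofReal (ξ⁻¹ * sobolevWeight (-s) (ξ * (a - t₀))) *
        ∫⁻ η, ENNReal.ofReal (sobolevWeight s η) * ‖G η‖ₑ ^ 2 := by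
  have hw : Measurable fun ξ => ENNReal.ofReal (sobolevWeight s ξ) :=
    (continuous_sobolevWeight s).measurable.ennreal_ofReal
  set F : ℝ → ℝ≥0∞ := fun η => ENNReal.ofReal (sobolevWeight s η) * ‖G η‖ₑ ^ 2 with hF
  have hFm : Measurable F := by fun_prop
  set c := ENNReal.ofReal (sobolevWeight (-s) (ξ * (a - t₀))) with hc
  -- The weight is inserted together with its inverse, and for `t ≥ a` the inverse weight is at most
  -- its value at `ξ (a - t₀)`. This factor makes the data disappear as `t₀ → -∞`.
  have hp : ∀ t ∈ Ioc a b, ‖G (ξ * (t - t₀))‖ₑ ^ 2 ≤ c * F (ξ * (t - t₀)) := by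
    intro t ht
    rw [hF, ← mul_assoc, hc, ← ENNReal.ofReal_mul (sobolevWeight_pos _ _).le]
    refine le_mul_of_one_le_left' ?_
    rw [ENNReal.one_le_ofReal]
    have h1 : sobolevWeight (-s) (ξ * (t - t₀)) ≤ sobolevWeight (-s) (ξ * (a - t₀)) := by
      unfold sobolevWeight
      refine Real.rpow_le_rpow_of_nonpos (by positivity) ?_ (by linarith)
      have : 0 ≤ a - t₀ := by linarith
      have := ht.1
      gcongr
    calc (1 : ℝ) = sobolevWeight (-s) (ξ * (t - t₀)) * sobolevWeight s (ξ * (t - t₀)) := by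
          rw [sobolevWeight_mul, neg_add_cancel, sobolevWeight, Real.rpow_zero]
      _ ≤ _ := by
          gcongr
          exact (sobolevWeight_pos _ _).le
  calc _ ≤ ∫⁻ t in Ioc a b, c * F (ξ * (t - t₀)) := setLIntegral_mono (by fun_prop) hp
    _ ≤ ∫⁻ t, c * F (ξ * (t - t₀)) := setLIntegral_le_lintegral _ _
    _ = c * ∫⁻ t, F (ξ * t) := by
        rw [lintegral_const_mul _ (by fun_prop),
          lintegral_sub_right_eq_self (fun t => F (ξ * t)) t₀]
    _ = _ := by
        rw [lintegral_comp_mul_left hξ hFm, ← mul_assoc, mul_comm c,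
          ENNReal.ofReal_mul (inv_pos.2 hξ).le]

/-! ### The bootstrap on the whole time axis. -/

theorem lintegral_le_of_forall_Ioc {u : ℝ → ℝ≥0∞} (hu : Measurable u) {C : ℝ≥0∞}
    (h : ∀ a b : ℝ, a ≤ b → ∫⁻ t in Ioc a b, u t ≤ C) : ∫⁻ t, u t ≤ C := by
  have hc := (aecover_Ioc (μ := volume) Filter.tendsto_neg_atTop_atBot
    (Filter.tendsto_id (α := ℝ))).lintegral_tendsto_of_countably_generated hu.aemeasurable
  refine le_of_tendsto hc ?_
  filter_upwards [Filter.eventually_ge_atTop 0] with m hm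
  exact h _ _ (by simpa using by linarith : -m ≤ m)

theorem tendsto_lintegral_tail {u : ℝ → ℝ≥0∞} (hu : Measurable u) (hfin : ∫⁻ t, u t ≠ ⊤)
    {S : ℝ → Set ℝ} (hS : ∀ m, MeasurableSet (S m))
    (hout : ∀ t, ∀ᶠ m in Filter.atTop, t ∉ S m) :
    Filter.Tendsto (fun m => ∫⁻ t in S m, u t) Filter.atTop (nhds 0) := by
  have h := tendsto_lintegral_filter_of_dominated_convergence (l := Filter.atTop) (μ := volume)
    (F := fun m => (S m).indicator u) (f := fun _ => 0) u
    (Filter.Eventually.of_forall fun m => hu.indicator (hS m))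
    (Filter.Eventually.of_forall fun m => Filter.Eventually.of_forall fun t =>
      indicator_le_self _ _ t) hfin
    (Filter.Eventually.of_forall fun t => tendsto_const_nhds.congr' (by
      filter_upwards [hout t] with m hm
      rw [indicator_of_notMem hm]))
  simpa only [lintegral_indicator (hS _), lintegral_zero] using h

/-- Absorption into the left-hand side; finiteness of `Z` is what permits the cancellation. -/
theorem le_two_mul_of_le_add {Z C c : ℝ≥0∞} (hZ : Z ≠ ⊤) (hc : 2 * c ≤ 1) (h : Z ≤ c * Z + C) :
    Z ≤ 2 * C := by
  have h1 : Z + Z ≤ Z + 2 * C := by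
    calc Z + Z = 2 * Z := (two_mul Z).symm
      _ ≤ 2 * (c * Z + C) := by gcongr
      _ = 2 * c * Z + 2 * C := by ring
      _ ≤ 1 * Z + 2 * C := by gcongr
      _ = _ := by rw [one_mul]
  exact (ENNReal.add_le_add_iff_left hZ).1 h1

/-- A bootstrap argument: a quantity `z` that is controlled by modes `x n` which in turn satisfy a
dispersive estimate with a source that is a small multiple of `z` vanishes almost everywhere. -/
theorem lintegral_eq_zero_of_modes {x q γ ω : ℕ → ℝ → ℝ≥0∞} {z : ℝ → ℝ≥0∞} {w : ℕ → ℝ≥0∞}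
    {A B δ L N : ℝ≥0∞} {R : ℝ} (hx : ∀ n, Measurable (x n)) (hq : ∀ n, Measurable (q n))
    (hz : Measurable z) (hA : A ≠ ⊤) (hB : B ≠ ⊤) (hδ : δ ≠ ⊤) (hL : L ≠ ⊤) (hN : N ≠ ⊤)
    (hw : ∑' n, w n ≠ ⊤) (hxL : ∀ n t, x n t ≤ L) (hzN : ∀ t, z t ≤ N)
    (hzx : ∀ t, z t ≤ B * ∑' n, x n t) (hqz : ∀ t, ∑' n, q n t ≤ δ * z t)
    (hγ : ∀ t, ∑' n, γ n t ≤ δ) (hω0 : ∀ n, ω n 0 ≤ 1)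
    (hω : ∀ n, Filter.Tendsto (ω n) Filter.atTop (nhds 0)) (hsmall : 2 * (B * A * δ) ≤ 1)
    (hest : ∀ n t₀ a b, t₀ ≤ a → a ≤ b → ∫⁻ t in Ioc a b, x n t ≤
      A * (ω n (a - t₀) * γ n t₀ + (∫⁻ t in Ioc t₀ b, q n t) +
        w n * ((∫⁻ t in Ioc t₀ a, x n t) + ∫⁻ t in Ioc (b - R) b, x n t))) :
    ∫⁻ t, z t = 0 := by
  -- `C₁` collects the data at the initial time and the layer `(b - R, b]`, where `x n ≤ L`; it is
  -- finite because the weights `w` are summable.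
  set C₁ := A * (δ + (∑' n, w n) * (L * ENNReal.ofReal R)) with hC₁
  have hC₁t : C₁ ≠ ⊤ := by finiteness
  have hsumx : ∀ μ : Measure ℝ, ∑' n, ∫⁻ t, x n t ∂μ = ∫⁻ t, ∑' n, x n t ∂μ := fun μ =>
    (lintegral_tsum fun n => (hx n).aemeasurable).symm
  have hZX : ∀ μ : Measure ℝ, ∫⁻ t, z t ∂μ ≤ B * ∑' n, ∫⁻ t, x n t ∂μ := by
    intro μ
    rw [hsumx, ← lintegral_const_mul _ (Measurable.tsum hx)]
    exact lintegral_mono hzx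
  have hQZ : ∀ μ : Measure ℝ, ∑' n, ∫⁻ t, q n t ∂μ ≤ δ * ∫⁻ t, z t ∂μ := by
    intro μ
    rw [← lintegral_tsum fun n => (hq n).aemeasurable, ← lintegral_const_mul _ hz]
    exact lintegral_mono hqz
  -- uniform bounds
  have hX : ∀ a b : ℝ, a ≤ b → ∑' n, ∫⁻ t in Ioc a b, x n t ≤
      A * δ * (∫⁻ t in Ioc a b, z t) + C₁ := by
    intro a b hab
    calc ∑' n, ∫⁻ t in Ioc a b, x n t ≤
        ∑' n, A * (γ n a + (∫⁻ t in Ioc a b, q n t) + w n * (L * ENNReal.ofReal R)) := by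
          refine ENNReal.tsum_le_tsum fun n => (hest n a a b le_rfl hab).trans ?_
          -- With `t₀ = a` there is no past.
          rw [sub_self, Ioc_self, Measure.restrict_empty, lintegral_zero_measure, zero_add]
          gcongr
          · exact mul_le_of_le_one_left' (hω0 n)
          · calc _ ≤ ∫⁻ t in Ioc (b - R) b, L := lintegral_mono (hxL n)
              _ = _ := by simp
      _ = A * ((∑' n, γ n a) + (∑' n, ∫⁻ t in Ioc a b, q n t) +
            (∑' n, w n) * (L * ENNReal.ofReal R)) := by
          rw [ENNReal.tsum_mul_left, ENNReal.tsum_add, ENNReal.tsum_add, ENNReal.tsum_mul_right]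
      _ ≤ A * (δ + δ * (∫⁻ t in Ioc a b, z t) + (∑' n, w n) * (L * ENNReal.ofReal R)) := by
          gcongr
          · exact hγ a
          · exact hQZ _
      _ = _ := by rw [hC₁]; ring
  -- On a bounded interval `z ≤ N` gives the finiteness needed for absorption, and the resulting
  -- bound does not depend on the interval.
  have hZ : ∫⁻ t, z t ≤ 2 * (B * C₁) := by
    refine lintegral_le_of_forall_Ioc hz fun a b hab => ?_
    refine le_two_mul_of_le_add ?_ hsmall ?_
    · refine (lt_of_le_of_lt (lintegral_mono hzN) ?_).ne
      rw [lintegral_const, Measure.restrict_apply_univ, Real.volume_Ioc]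
      finiteness
    · calc _ ≤ B * _ := hZX _
        _ ≤ B * (A * δ * (∫⁻ t in Ioc a b, z t) + C₁) := by gcongr; exact hX a b hab
        _ = _ := by ring
  have hZt : ∫⁻ t, z t ≠ ⊤ := ne_top_of_le_ne_top (by finiteness) hZ
  have hXt : ∀ n, ∫⁻ t, x n t ≠ ⊤ := by
    intro n
    refine ne_top_of_le_ne_top (b := A * δ * (∫⁻ t, z t) + C₁) (by finiteness) ?_
    refine lintegral_le_of_forall_Ioc (hx n) fun a b hab => ?_
    calc _ ≤ _ := ENNReal.le_tsum n
      _ ≤ _ := hX a b hab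
      _ ≤ _ := by gcongr; exact Measure.restrict_le_self
  -- the modes on the whole line
  have hXq : ∀ n, ∫⁻ t, x n t ≤ A * ∫⁻ t, q n t := by
    intro n
    by_cases hqt : ∫⁻ t, q n t = ⊤
    · by_cases hA0 : A = 0
      · have h0 : ∫⁻ t, x n t ≤ 0 := lintegral_le_of_forall_Ioc (hx n) fun a b hab => by
          simpa [hA0] using hest n a a b le_rfl hab
        exact h0.trans zero_le
      · rw [hqt, ENNReal.mul_top hA0]
        exact le_top
    have hwt : w n ≠ ⊤ := ENNReal.ne_top_of_tsum_ne_top hw n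
    have hl := (aecover_Ioc (μ := volume) Filter.tendsto_neg_atTop_atBot
      (Filter.tendsto_id (α := ℝ))).lintegral_tendsto_of_countably_generated (hx n).aemeasurable
    have h1 : Filter.Tendsto (fun m : ℝ => ∫⁻ t in Iic (-m), x n t) Filter.atTop (nhds 0) :=
      tendsto_lintegral_tail (hx n) (hXt n) (fun m => measurableSet_Iic) fun t => by
        filter_upwards [Filter.eventually_gt_atTop (-t)] with m hm
        simp only [mem_Iic, not_le]; linarith
    have h2 : Filter.Tendsto (fun m : ℝ => ∫⁻ t in Ioi (m - R), x n t) Filter.atTop (nhds 0) :=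
      tendsto_lintegral_tail (hx n) (hXt n) (fun m => measurableSet_Ioi) fun t => by
        filter_upwards [Filter.eventually_ge_atTop (t + R)] with m hm
        simp only [mem_Ioi, not_lt]; linarith
    have hr : Filter.Tendsto (fun m : ℝ => A * (ω n m * δ + (∫⁻ t, q n t) +
        w n * ((∫⁻ t in Iic (-m), x n t) + ∫⁻ t in Ioi (m - R), x n t))) Filter.atTop
        (nhds (A * (0 * δ + (∫⁻ t, q n t) + w n * (0 + 0)))) := by
      refine ENNReal.Tendsto.const_mul ?_ (Or.inr hA)
      refine Filter.Tendsto.add (Filter.Tendsto.add ?_ tendsto_const_nhds) ?_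
      · exact ENNReal.Tendsto.mul_const (hω n) (Or.inr hδ)
      · exact ENNReal.Tendsto.const_mul (h1.add h2) (Or.inr hwt)
    rw [zero_mul, zero_add, zero_add, mul_zero, add_zero] at hr
    refine le_of_tendsto_of_tendsto hl hr ?_
    filter_upwards [Filter.eventually_ge_atTop 0] with m hm
    -- Initial time `-2m`, window `(-m, m]`: the data disperse for a time `m` before the window
    -- opens, and both boundary integrals are dominated by tails of an integrable function.
    have h3 := hest n (-m - m) (-m) m (by linarith) (by linarith)
    rw [show -m - (-m - m) = m by ring] at h3
    refine h3.trans ?_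
    gcongr
    · exact (ENNReal.le_tsum n).trans (hγ _)
    · exact Measure.restrict_le_self
    · exact Ioc_subset_Iic_self
    · exact Ioc_subset_Ioi_self
  -- No constant is left: `∫ z ≤ B A δ ∫ z ≤ (1/2) ∫ z`, with `∫ z` finite.
  have hfin : ∫⁻ t, z t ≤ 2 * 0 := by
    refine le_two_mul_of_le_add hZt hsmall ?_
    calc _ ≤ _ := hZX volume
      _ ≤ B * ∑' n, A * ∫⁻ t, q n t := by gcongr with n; exact hXq n
      _ = B * A * ∑' n, ∫⁻ t, q n t := by rw [ENNReal.tsum_mul_left, mul_assoc]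
      _ ≤ B * A * (δ * ∫⁻ t, z t) := by gcongr; exact hQZ volume
      _ = _ := by ring
  simpa using hfin

/-! ### Mode kernels, and the modes of a solution. -/

/-- The squared weighted `L²` norm of a function of the frequency. -/
def weightedNormSq (s : ℝ) (u : ℝ → ℂ) : ℝ≥0∞ :=
  ∫⁻ η, ENNReal.ofReal (sobolevWeight s η) * ‖u η‖ₑ ^ 2

/-- The memory kernel of the Volterra equation at frequency `ξ`. -/
def modeKernel (f₀ : ℝ → ℝ) (ξ τ : ℝ) : ℂ := (ξ⁻¹ : ℝ) * memoryKernel f₀ (ξ * τ)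

section Kernel

variable {f₀ : ℝ → ℝ} {ξ : ℝ}

theorem modeKernel_of_nonpos (hξ : 0 < ξ) {τ : ℝ} (hτ : τ ≤ 0) : modeKernel f₀ ξ τ = 0 := by
  have : ξ * τ ∉ Ioi (0 : ℝ) := not_lt.2 (mul_nonpos_of_nonneg_of_nonpos hξ.le hτ)
  simp [modeKernel, memoryKernel, this]

theorem modeKernel_of_nonneg (hξ : 0 < ξ) {τ : ℝ} (hτ : 0 ≤ τ) :
    modeKernel f₀ ξ τ = (τ : ℂ) * 𝓕 (fun v => (f₀ v : ℂ)) (ξ * τ) := by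
  rcases hτ.eq_or_lt with rfl | hτ
  · rw [modeKernel_of_nonpos hξ le_rfl]; simp
  · have h1 : ξ * τ ∈ Ioi (0 : ℝ) := mul_pos hξ hτ
    have h2 : (ξ : ℂ) ≠ 0 := by exact_mod_cast hξ.ne'
    rw [modeKernel, memoryKernel, indicator_of_mem h1]
    push_cast
    field_simp

theorem integrable_modeKernel (hξ : 0 < ξ) (hk : Integrable (memoryKernel f₀)) :
    Integrable (modeKernel f₀ ξ) :=
  (hk.comp_mul_left' hξ.ne').const_mul _

/-- By scaling, all modes share one symbol and differ only in the coupling `θ = ξ⁻²`, which stays in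
`[0, T²]`; this makes the lower bound uniform in `n`. -/
theorem fourier_modeKernel (hξ : 0 < ξ) (ω : ℝ) :
    𝓕 (modeKernel f₀ ξ) ω = ((ξ⁻¹ ^ 2 : ℝ) : ℂ) * 𝓕 (memoryKernel f₀) (ω / ξ) := by
  rw [fourier_eq_integral_char, fourier_eq_integral_char]
  have h := Measure.integral_comp_mul_left (fun η => memoryKernel f₀ η * char (ω / ξ) η) ξ
  rw [abs_of_pos (inv_pos.2 hξ)] at h
  have e : ∀ τ, modeKernel f₀ ξ τ * char ω τ =
      (ξ⁻¹ : ℝ) * (memoryKernel f₀ (ξ * τ) * char (ω / ξ) (ξ * τ)) := by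
    intro τ
    have h2 : char (ω / ξ) (ξ * τ) = char ω τ := by
      have h2 : (ξ : ℂ) ≠ 0 := by exact_mod_cast hξ.ne'
      unfold char
      congr 2
      push_cast
      field_simp
    rw [h2, modeKernel, mul_assoc]
  simp_rw [e]
  rw [integral_const_mul, h, Complex.real_smul]
  push_cast; ring

theorem setLIntegral_enorm_modeKernel (hξ : 0 < ξ) (hm : Measurable (memoryKernel f₀)) (R : ℝ) :
    ∫⁻ τ in Ioi R, ‖modeKernel f₀ ξ τ‖ₑ =
      ENNReal.ofReal (ξ⁻¹ ^ 2) * ∫⁻ η in Ioi (ξ * R), ‖memoryKernel f₀ η‖ₑ := by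
  rw [← lintegral_indicator measurableSet_Ioi, ← lintegral_indicator measurableSet_Ioi]
  have h := lintegral_comp_mul_left hξ
    (g := (Ioi (ξ * R)).indicator fun η => ‖memoryKernel f₀ η‖ₑ)
    (hm.enorm.indicator measurableSet_Ioi)
  rw [sq, ENNReal.ofReal_mul (inv_pos.2 hξ).le, mul_assoc, ← h,
    ← lintegral_const_mul (ENNReal.ofReal ξ⁻¹) (f := fun τ =>
      (Ioi (ξ * R)).indicator (fun η => ‖memoryKernel f₀ η‖ₑ) (ξ * τ))
    ((hm.enorm.indicator measurableSet_Ioi).comp (measurable_const_mul ξ))]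
  congr 1; ext τ
  by_cases hτ : τ ∈ Ioi R
  · have h1 : ξ * τ ∈ Ioi (ξ * R) := mul_lt_mul_of_pos_left hτ hξ
    rw [indicator_of_mem hτ, indicator_of_mem h1, modeKernel, enorm_mul]
    congr 1
    rw [← ofReal_norm, Complex.norm_real, Real.norm_eq_abs, abs_of_pos (inv_pos.2 hξ)]
  · have h1 : ξ * τ ∉ Ioi (ξ * R) := fun h => hτ (lt_of_mul_lt_mul_left h hξ.le)
    rw [indicator_of_notMem hτ, indicator_of_notMem h1, mul_zero]

theorem lintegral_enorm_modeKernel (hξ : 0 < ξ) (hm : Measurable (memoryKernel f₀)) :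
    ∫⁻ τ, ‖modeKernel f₀ ξ τ‖ₑ = ENNReal.ofReal (ξ⁻¹ ^ 2) * ∫⁻ η, ‖memoryKernel f₀ η‖ₑ := by
  have h := lintegral_comp_mul_left hξ (g := fun η => ‖memoryKernel f₀ η‖ₑ) hm.enorm
  rw [sq, ENNReal.ofReal_mul (inv_pos.2 hξ).le, mul_assoc, ← h, ← lintegral_const_mul _ (by fun_prop)]
  congr 1; ext τ
  rw [modeKernel, enorm_mul]
  congr 1
  rw [← ofReal_norm, Complex.norm_real, Real.norm_eq_abs, abs_of_pos (inv_pos.2 hξ)]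

end Kernel

/-- The modes of the charge density. -/
def chargeMode (T : ℝ) (f : ℝ → ℝ → ℝ → ℝ) (n : ℕ) (t : ℝ) : ℂ :=
  moment T (freq T n) (fun p => f t p.1 p.2) (char 0)

/-- The Fourier transform of the perturbation `f - f₀` at the `n`-th spatial frequency. -/
def perturbationMode (T : ℝ) (f₀ : ℝ → ℝ) (f : ℝ → ℝ → ℝ → ℝ) (n : ℕ) (t η : ℝ) : ℂ :=
  moment T (freq T n) (fun p => f t p.1 p.2 - f₀ p.2) (char η)

/-- The Fourier transform of the nonlinear term `E (f - f₀)` at the `n`-th spatial frequency. -/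
def nonlinearMode (T : ℝ) (f₀ : ℝ → ℝ) (f : ℝ → ℝ → ℝ → ℝ) (E : ℝ → ℝ → ℝ) (n : ℕ)
    (η t : ℝ) : ℂ :=
  moment T (freq T n) (fun p => E t p.1 * (f t p.1 p.2 - f₀ p.2)) (char η)

/-- The supremum of the electric field. -/
def fieldSup (E : ℝ → ℝ → ℝ) (t : ℝ) : ℝ≥0∞ := ⨆ y : ℚ, ‖E t y‖ₑ

namespace IsSolution

variable {T s : ℝ} {f : ℝ → ℝ → ℝ → ℝ} {E : ℝ → ℝ → ℝ} {f₀ : ℝ → ℝ}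

theorem measurable_fieldSup (h : IsSolution T f E) (hT : 0 < T) : Measurable (fieldSup E) := by
  refine Measurable.iSup fun y => Measurable.enorm ?_
  exact (h.measurable_field hT).comp (measurable_id.prodMk measurable_const)

/-- `fieldSup` is a supremum over the rationals so as to be measurable in time; continuity of `E t`
recovers all points. -/
theorem enorm_field_le_fieldSup (h : IsSolution T f E) (hT : 0 < T) (t x : ℝ) :
    ‖E t x‖ₑ ≤ fieldSup E t := by
  have hcl : IsClosed {x | ‖E t x‖ₑ ≤ fieldSup E t} :=
    isClosed_le (h.continuous_field hT t).enorm continuous_const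
  have hsub : range ((↑) : ℚ → ℝ) ⊆ {x | ‖E t x‖ₑ ≤ fieldSup E t} := by
    rintro _ ⟨y, rfl⟩
    exact le_iSup (fun y : ℚ => ‖E t y‖ₑ) y
  have := hcl.closure_subset_iff.2 hsub
  rw [Rat.denseRange_cast.closure_range] at this
  exact this (mem_univ x)

theorem fieldSup_le (h : IsSolution T f E) (hT : 0 < T) (t : ℝ) :
    fieldSup E t ≤ ENNReal.ofReal (2 * T) := by
  refine iSup_le fun y => ?_
  rw [← ofReal_norm]
  exact ENNReal.ofReal_le_ofReal (h.abs_field_le hT t y)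

theorem measurable_chargeMode (h : IsSolution T f E) (n : ℕ) : Measurable (chargeMode T f n) :=
  measurable_moment h.measurable_distribution (β := fun _ => char 0) (by
    simp only [Function.uncurry_def]; fun_prop)

theorem norm_chargeMode_le (h : IsSolution T f E) (hT : 0 < T) (n : ℕ) (t : ℝ) :
    ‖chargeMode T f n t‖ ≤ T :=
  (h.norm_moment_distribution_le hT (C := 1) fun _ => (norm_char _ _).le).trans_eq (one_mul T)

theorem measurable_nonlinearMode (h : IsSolution T f E) (hT : 0 < T) (h₀ : IsProfile s f₀)
    (n : ℕ) : Measurable (Function.uncurry (nonlinearMode T f₀ f E n)) := by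
  have h1 := h.measurable_field hT
  have h2 := h.measurable
  have h3 := h₀.continuous.measurable
  refine measurable_moment (α := ℝ × ℝ) (w := fun q p => E q.2 p.1 * (f q.2 p.1 p.2 - f₀ p.2))
    (β := fun q => char q.1) ?_ (by simp only [Function.uncurry_def]; fun_prop)
  exact (h1.comp (by fun_prop : Measurable fun r : (ℝ × ℝ) × ℝ × ℝ => (r.1.2, r.2.1))).mul
    ((h2.comp (by fun_prop : Measurable fun r : (ℝ × ℝ) × ℝ × ℝ => (r.1.2, r.2.1, r.2.2))).sub
      (h3.comp (by fun_prop : Measurable fun r : (ℝ × ℝ) × ℝ × ℝ => r.2.2)))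

theorem measurable_perturbation (h : IsSolution T f E) (h₀ : IsProfile s f₀) (t : ℝ) :
    Measurable (Function.uncurry fun x v => f t x v - f₀ v) :=
  (h.measurable.comp (by fun_prop : Measurable fun p : ℝ × ℝ => (t, p.1, p.2))).sub
    (h₀.continuous.measurable.comp measurable_snd)

theorem integrable_perturbation (h : IsSolution T f E) (h₀ : IsProfile s f₀) (t : ℝ) :
    IntegrableOn (Function.uncurry fun x v => f t x v - f₀ v) (Ioc 0 T ×ˢ univ) := by
  have h1 := integrable_profile h₀ T (a := fun _ => 1) continuous_const
  simp only [one_mul] at h1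
  exact (h.integrable t).sub h1

theorem measurable_perturbationMode (h : IsSolution T f E) (h₀ : IsProfile s f₀)
    (n : ℕ) (t : ℝ) : Measurable (perturbationMode T f₀ f n t) :=
  measurable_moment (α := ℝ) (w := fun _ p => f t p.1 p.2 - f₀ p.2) (β := char)
    ((h.measurable_perturbation h₀ t).comp measurable_snd)
    (by simp only [Function.uncurry_def]; fun_prop)

theorem tsum_perturbationMode_le (h : IsSolution T f E) (hT : 0 < T) (h₀ : IsProfile s f₀)
    (t : ℝ) : ∑' n, weightedNormSq s (perturbationMode T f₀ f n t) ≤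
      ENNReal.ofReal T * mixedENorm T s (fun x v => f t x v - f₀ v) ^ 2 := by
  have h1 := tsum_lintegral_moment_le hT s (h.measurable_perturbation h₀ t)
    (h.integrable_perturbation h₀ t) (a := fun _ => 1) measurable_const (A := 1) (by simp) (e := 1)
    (by simp)
  simp only [one_mul, one_pow, mul_one] at h1
  exact h1

/-- Smallness of the perturbation enters here: the nonlinear source is at most `T ε₀²` times `sup
|E|²`. -/
theorem tsum_nonlinearMode_le (h : IsSolution T f E) (hT : 0 < T) (h₀ : IsProfile s f₀)
    (t : ℝ) : ∑' n, weightedNormSq s (fun η => nonlinearMode T f₀ f E n η t) ≤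
      ENNReal.ofReal T * fieldSup E t ^ 2 * mixedENorm T s (fun x v => f t x v - f₀ v) ^ 2 :=
  tsum_lintegral_moment_le hT s (h.measurable_perturbation h₀ t)
    (h.integrable_perturbation h₀ t) (h.continuous_field hT t).measurable (h.abs_field_le hT t)
    (h.enorm_field_le_fieldSup hT t)

theorem enorm_fourier_field (h : IsSolution T f E) (hT : 0 < T) (n : ℕ) (t : ℝ) :
    ‖∫ x in Ioc 0 T, (E t x : ℂ) * char (freq T n) x‖ₑ =
      ENNReal.ofReal (freq T n)⁻¹ * ENNReal.ofReal (2 * Real.pi)⁻¹ * ‖chargeMode T f n t‖ₑ := by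
  have h1 := h.fourier_poisson hT (n := (n + 1 : ℤ)) (by positivity) t
  have hξ := freq_pos hT n
  have hπ := Real.pi_pos
  have h2 : chargeMode T f n t = -(2 * Real.pi * Complex.I * freq T n *
      ∫ x in Ioc 0 T, (E t x : ℂ) * char (freq T n) x) := by
    rw [chargeMode, freq, h1, neg_neg]
  have h3 : ‖(2 * Real.pi * Complex.I * freq T n : ℂ)‖ₑ = ENNReal.ofReal (2 * Real.pi * freq T n) := by
    rw [← ofReal_norm]
    simp [abs_of_pos hπ, abs_of_pos hξ]
  rw [h2, enorm_neg, enorm_mul, h3, ← mul_assoc, ← ENNReal.ofReal_mul (by positivity),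
    ← ENNReal.ofReal_mul (by positivity),
    show (freq T n)⁻¹ * (2 * Real.pi)⁻¹ * (2 * Real.pi * freq T n) = 1 by field_simp,
    ENNReal.ofReal_one, one_mul]

/-- The electric field is controlled by the modes of the charge density. -/
theorem sq_fieldSup_le (h : IsSolution T f E) (hT : 0 < T) (t : ℝ) :
    fieldSup E t ^ 2 ≤ ENNReal.ofReal (2 * T⁻¹) ^ 2 *
      (ENNReal.ofReal (2 * Real.pi)⁻¹ ^ 2 * ∑' n, ENNReal.ofReal ((freq T n)⁻¹ ^ 2)) *
      ∑' n, ‖chargeMode T f n t‖ₑ ^ 2 := by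
  have h1 : fieldSup E t ≤ ENNReal.ofReal (2 * T⁻¹) * ∑' n, ENNReal.ofReal (freq T n)⁻¹ *
      ENNReal.ofReal (2 * Real.pi)⁻¹ * ‖chargeMode T f n t‖ₑ := by
    refine iSup_le fun y => ?_
    simp_rw [← h.enorm_fourier_field hT]
    exact enorm_le_tsum_integral_mul_char hT (h.continuous_field hT t) (h.periodic_E t)
      (h.mean_E t) y
  -- Cauchy-Schwarz in `n`: the factor `ξ⁻¹` gained from the Poisson equation is square summable.
  calc _ ≤ (ENNReal.ofReal (2 * T⁻¹) * ∑' n, ENNReal.ofReal (freq T n)⁻¹ *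
      ENNReal.ofReal (2 * Real.pi)⁻¹ * ‖chargeMode T f n t‖ₑ) ^ 2 := by gcongr
    _ ≤ ENNReal.ofReal (2 * T⁻¹) ^ 2 * ((∑' n, (ENNReal.ofReal (freq T n)⁻¹ *
        ENNReal.ofReal (2 * Real.pi)⁻¹) ^ 2) * ∑' n, ‖chargeMode T f n t‖ₑ ^ 2) := by
        rw [mul_pow]
        gcongr
        exact sq_tsum_mul_le _ _
    _ = _ := by
        simp_rw [mul_pow, ← ENNReal.ofReal_pow (inv_pos.2 (freq_pos hT _)).le]
        rw [ENNReal.tsum_mul_right]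
        ring

end IsSolution

/-- Unit mass implies integrability, since the integral of a non-integrable function is `0` by
convention. -/
theorem IsProfile.of_memH {s : ℝ} {f₀ : ℝ → ℝ} (hcont : Continuous f₀) (hmass : ∫ v : ℝ, f₀ v = 1)
    (hH : MemH s f₀) : IsProfile s f₀ := by
  have hi : Integrable f₀ := by
    by_contra hn
    rw [integral_undef hn] at hmass
    exact zero_ne_one hmass
  exact ⟨hcont, hi, (lintegral_sobolevWeight_le hi s).trans_lt (ENNReal.pow_lt_top hH)⟩

theorem IsProfile.measurable_memoryKernel {s : ℝ} {f₀ : ℝ → ℝ} (h : IsProfile s f₀) :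
    Measurable (memoryKernel f₀) := by
  have := h.continuous_fourier.measurable
  exact Measurable.indicator (by fun_prop) measurableSet_Ioi

theorem measurable_weightedNormSq {s : ℝ} {Q : ℝ → ℝ → ℂ} (hQ : Measurable (Function.uncurry Q)) :
    Measurable fun t => weightedNormSq s fun η => Q η t := by
  have hw : Measurable fun ξ => ENNReal.ofReal (sobolevWeight s ξ) :=
    (continuous_sobolevWeight s).measurable.ennreal_ofReal
  have h1 : Measurable (Function.uncurry fun t η =>
      ENNReal.ofReal (sobolevWeight s η) * ‖Q η t‖ₑ ^ 2) :=
    (hw.comp measurable_snd).mul ((hQ.comp measurable_swap).enorm.pow_const 2)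
  exact h1.lintegral_prod_right

/-! ### The dispersive estimate for each mode. -/

/-- The source of the Volterra equation. -/
theorem lintegral_sq_source_le {T s : ℝ} (hT : 0 < T) (hs : 0 ≤ s) {f : ℝ → ℝ → ℝ → ℝ}
    {E : ℝ → ℝ → ℝ} {f₀ : ℝ → ℝ} (h : IsSolution T f E) (h₀ : IsProfile s f₀) (n : ℕ) {t₀ a b : ℝ}
    (hta : t₀ ≤ a) :
    ∫⁻ t in Ioc a b, ‖perturbationMode T f₀ f n t₀ (freq T n * (t - t₀)) +
        ∫ r in t₀..t, 2 * Real.pi * Complex.I * freq T n * (t - r) *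
          nonlinearMode T f₀ f E n (freq T n * (t - r)) r‖ₑ ^ 2 ≤
      4 * ENNReal.ofReal T * (ENNReal.ofReal (sobolevWeight (-s) (freq T n * (a - t₀))) *
        weightedNormSq s (perturbationMode T f₀ f n t₀)) +
      4 * ENNReal.ofReal (T ^ 2) * (∫⁻ η, ENNReal.ofReal (sobolevWeight (1 - s) η)) *
        ∫⁻ t in Ioc t₀ b, weightedNormSq s (fun η => nonlinearMode T f₀ f E n η t) := by
  have hξ := freq_pos hT n
  have hP := h.measurable_perturbationMode h₀ n t₀
  have hsrc := lintegral_sq_free_transport_le (b := b) hs hξ hP hta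
  have hduh := lintegral_sq_duhamel_le (s := s) hξ (h.measurable_nonlinearMode hT h₀ n) t₀ a b hta
  calc _ ≤ ∫⁻ t in Ioc a b, (4 * ‖perturbationMode T f₀ f n t₀ (freq T n * (t - t₀))‖ₑ ^ 2 +
        4 * ‖∫ r in t₀..t, 2 * Real.pi * Complex.I * freq T n * (t - r) *
          nonlinearMode T f₀ f E n (freq T n * (t - r)) r‖ₑ ^ 2) := by
        refine lintegral_mono fun t => ?_
        have := add_sq_le_four ‖perturbationMode T f₀ f n t₀ (freq T n * (t - t₀))‖ₑ
          ‖∫ r in t₀..t, 2 * Real.pi * Complex.I * freq T n * (t - r) *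
            nonlinearMode T f₀ f E n (freq T n * (t - r)) r‖ₑ 0 0
        simp only [add_zero, ne_eq, OfNat.ofNat_ne_zero, not_false_eq_true, zero_pow, mul_add] at this
        refine le_trans ?_ this
        gcongr
        exact enorm_add_le _ _
    _ = 4 * (∫⁻ t in Ioc a b, ‖perturbationMode T f₀ f n t₀ (freq T n * (t - t₀))‖ₑ ^ 2) +
        4 * ∫⁻ t in Ioc a b, ‖∫ r in t₀..t, 2 * Real.pi * Complex.I * freq T n * (t - r) *
          nonlinearMode T f₀ f E n (freq T n * (t - r)) r‖ₑ ^ 2 := by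
        rw [lintegral_add_left (by fun_prop), lintegral_const_mul _ (by fun_prop),
          lintegral_const_mul' _ _ (by simp)]
    _ ≤ 4 * (ENNReal.ofReal ((freq T n)⁻¹ * sobolevWeight (-s) (freq T n * (a - t₀))) *
        weightedNormSq s (perturbationMode T f₀ f n t₀)) + 4 * (ENNReal.ofReal ((freq T n)⁻¹ ^ 2) *
        (∫⁻ η, ENNReal.ofReal (sobolevWeight (1 - s) η)) *
        ∫⁻ t in Ioc t₀ b, weightedNormSq s (fun η => nonlinearMode T f₀ f E n η t)) := by
        gcongr
        · exact hsrc
        · exact hduh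
    _ ≤ _ := by
        have h1 := inv_freq_le hT n
        have h2 := (inv_pos.2 hξ).le
        rw [ENNReal.ofReal_mul h2, ← mul_assoc, ← mul_assoc, ← mul_assoc, ← mul_assoc, ← mul_assoc]
        gcongr

/-- The dispersive estimate for the modes of the charge density. -/
theorem exists_mode_estimate {T s : ℝ} {f₀ : ℝ → ℝ} (h₀ : IsProfile s f₀) (hs : 3 / 2 < s)
    (hT : 0 < T) (hT₀ : ENNReal.ofReal T < criticalPeriod f₀) :
    ∃ A : ℝ≥0∞, A ≠ ⊤ ∧ ∃ R : ℝ, ∀ f E, IsSolution T f E → ∀ n t₀ a b, t₀ ≤ a →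
      ∫⁻ t in Ioc a b, ‖chargeMode T f n t‖ₑ ^ 2 ≤
        A * (ENNReal.ofReal (sobolevWeight (-s) (freq T n * (a - t₀))) *
            weightedNormSq s (perturbationMode T f₀ f n t₀) +
          (∫⁻ t in Ioc t₀ b, weightedNormSq s (fun η => nonlinearMode T f₀ f E n η t)) +
          ENNReal.ofReal ((freq T n)⁻¹ ^ 2) * ((∫⁻ t in Ioc t₀ a, ‖chargeMode T f n t‖ₑ ^ 2) +
            ∫⁻ t in Ioc (b - R) b, ‖chargeMode T f n t‖ₑ ^ 2)) := by
  obtain ⟨κ, hκ, hlow⟩ := h₀.exists_dispersion_lower_bound hs hT hT₀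
  have hk := h₀.integrable_memoryKernel hs
  have hkm := h₀.measurable_memoryKernel
  set k₁ := ∫⁻ η, ‖memoryKernel f₀ η‖ₑ with hk₁
  have hk₁t : k₁ ≠ ⊤ := hk.2.ne
  set c := ∫⁻ η, ENNReal.ofReal (sobolevWeight (1 - s) η) with hc
  have hct : c ≠ ⊤ := by
    have := (integrable_sobolevWeight (r := s - 1) (by linarith)).lintegral_lt_top.ne
    rwa [neg_sub] at this
  have hκ2 : 0 < ENNReal.ofReal (κ ^ 2) := ENNReal.ofReal_pos.2 (by positivity)
  -- `m` makes the tail of the unscaled kernel small; as `ξ T ≥ 1`, the lag `R = T * m` then serves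
  -- every frequency.
  obtain ⟨m, hm0, hm⟩ : ∃ m : ℝ, 0 ≤ m ∧
      8 * (ENNReal.ofReal (T ^ 2) * ∫⁻ η in Ioi m, ‖memoryKernel f₀ η‖ₑ) ^ 2 ≤
        ENNReal.ofReal (κ ^ 2) := by
    have h1 := tendsto_lintegral_tail hkm.enorm hk₁t (S := Ioi) (fun _ => measurableSet_Ioi)
      fun t => by
        filter_upwards [Filter.eventually_ge_atTop t] with m hm
        exact not_lt.2 hm
    have h2 := ENNReal.Tendsto.const_mul (a := 8) (ENNReal.Tendsto.pow (n := 2)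
      (ENNReal.Tendsto.const_mul (a := ENNReal.ofReal (T ^ 2)) h1 (Or.inr ENNReal.ofReal_ne_top)))
      (Or.inr (by simp))
    rw [mul_zero, zero_pow two_ne_zero, mul_zero] at h2
    obtain ⟨m, hm1, hm2⟩ := ((h2.eventually_lt_const hκ2).and
      (Filter.eventually_ge_atTop 0)).exists
    exact ⟨m, hm2, hm1.le⟩
  refine ⟨(ENNReal.ofReal (κ ^ 2))⁻¹ * 8 * (4 * ENNReal.ofReal T + 4 * ENNReal.ofReal (T ^ 2) * c +
    ENNReal.ofReal (T ^ 2) * k₁ ^ 2), ?_, T * m, ?_⟩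
  · have := ENNReal.inv_ne_top.2 hκ2.ne'
    finiteness
  intro f E h n t₀ a b hta
  set ξ := freq T n with hξd
  have hξ : 0 < ξ := freq_pos hT n
  have hξT : ξ⁻¹ ≤ T := inv_freq_le hT n
  have hξ0 : 0 ≤ ξ⁻¹ := (inv_pos.2 hξ).le
  have hξ2 : ξ⁻¹ ^ 2 ≤ T ^ 2 := by gcongr
  have hmain := lintegral_sq_le_of_volterra (integrable_modeKernel hξ hk)
    (hkm.comp (measurable_const_mul ξ) |>.const_mul _) (fun τ => modeKernel_of_nonpos hξ) hκ.le
    (fun ω => by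
      rw [fourier_modeKernel hξ]
      exact hlow _ ⟨by positivity, hξ2⟩ _)
    (R := T * m) (by
      refine le_trans ?_ hm
      rw [setLIntegral_enorm_modeKernel hξ hkm]
      gcongr
      calc m = ξ * ξ⁻¹ * m := by field_simp
        _ ≤ ξ * T * m := by gcongr
        _ = _ := mul_assoc _ _ _)
    (h.measurable_chargeMode n) (h.norm_chargeMode_le hT n)
    (S := fun t => perturbationMode T f₀ f n t₀ (ξ * (t - t₀)) +
        ∫ r in t₀..t, 2 * Real.pi * Complex.I * ξ * (t - r) *
          nonlinearMode T f₀ f E n (ξ * (t - r)) r) hta (b := b) (fun t ht => by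
      have hv := h.volterra hT h₀ (n := (n + 1 : ℤ)) (by positivity) (hta.trans ht.1.le)
      refine Eq.trans ?_ hv
      congr 1
      refine intervalIntegral.integral_congr fun r hr => ?_
      rw [uIcc_of_le (hta.trans ht.1.le)] at hr
      rw [modeKernel_of_nonneg hξ (sub_nonneg.2 hr.2)]
      rfl)
  rw [lintegral_enorm_modeKernel hξ hkm] at hmain
  have hsource := lintegral_sq_source_le hT (by linarith) h h₀ n (b := b) hta
  set X := ∫⁻ t in Ioc a b, ‖chargeMode T f n t‖ₑ ^ 2 with hX
  set Y := (∫⁻ t in Ioc t₀ a, ‖chargeMode T f n t‖ₑ ^ 2) +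
    ∫⁻ t in Ioc (b - T * m) b, ‖chargeMode T f n t‖ₑ ^ 2 with hY
  set G := ENNReal.ofReal (sobolevWeight (-s) (ξ * (a - t₀))) *
    weightedNormSq s (perturbationMode T f₀ f n t₀) with hG
  set Q := ∫⁻ t in Ioc t₀ b, weightedNormSq s (fun η => nonlinearMode T f₀ f E n η t) with hQ
  calc X = (ENNReal.ofReal (κ ^ 2))⁻¹ * (ENNReal.ofReal (κ ^ 2) * X) := by
        rw [← mul_assoc, ENNReal.inv_mul_cancel hκ2.ne' ENNReal.ofReal_ne_top, one_mul]
    _ ≤ (ENNReal.ofReal (κ ^ 2))⁻¹ * (8 * ((4 * ENNReal.ofReal T * G +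
          4 * ENNReal.ofReal (T ^ 2) * c * Q) + (ENNReal.ofReal (ξ⁻¹ ^ 2) * k₁) ^ 2 * Y)) := by
        refine mul_le_mul_right (hmain.trans ?_) _
        gcongr
    -- Of the two factors `ξ⁻²` in front of `Y` one is kept as the summable weight of the bootstrap,
    -- and the other is bounded by `T²`.
    _ = (ENNReal.ofReal (κ ^ 2))⁻¹ * 8 * (4 * ENNReal.ofReal T * G +
          4 * ENNReal.ofReal (T ^ 2) * c * Q + ENNReal.ofReal (ξ⁻¹ ^ 2) * k₁ ^ 2 *
            (ENNReal.ofReal (ξ⁻¹ ^ 2) * Y)) := by ring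
    _ ≤ (ENNReal.ofReal (κ ^ 2))⁻¹ * 8 * (4 * ENNReal.ofReal T * (G + Q + ENNReal.ofReal (ξ⁻¹ ^ 2) * Y) +
          4 * ENNReal.ofReal (T ^ 2) * c * (G + Q + ENNReal.ofReal (ξ⁻¹ ^ 2) * Y) +
          ENNReal.ofReal (T ^ 2) * k₁ ^ 2 * (G + Q + ENNReal.ofReal (ξ⁻¹ ^ 2) * Y)) := by
        gcongr
        · exact le_self_add.trans le_self_add
        · exact le_add_self.trans le_self_add
        · exact le_add_self
    _ = _ := by ring

theorem tendsto_sobolevWeight_neg {s ξ : ℝ} (hs : 0 < s) (hξ : 0 < ξ) :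
    Filter.Tendsto (fun τ => ENNReal.ofReal (sobolevWeight (-s) (ξ * τ))) Filter.atTop (nhds 0) := by
  have h1 : Filter.Tendsto (fun τ : ℝ => 1 + (2 * Real.pi * (ξ * τ)) ^ 2) Filter.atTop
      Filter.atTop := by
    refine Filter.tendsto_atTop_add_const_left _ _ ((Filter.tendsto_pow_atTop two_ne_zero).comp ?_)
    exact (Filter.tendsto_id.const_mul_atTop hξ).const_mul_atTop (by positivity)
  have h2 := ENNReal.tendsto_ofReal ((tendsto_rpow_neg_atTop hs).comp h1)
  rwa [ENNReal.ofReal_zero] at h2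

/-! ### From almost every time to every time, and the conclusion. -/

namespace IsSolution

variable {T : ℝ} {f : ℝ → ℝ → ℝ → ℝ} {E : ℝ → ℝ → ℝ}

/-- If the electric field vanishes for almost all times then it vanishes identically. -/
theorem field_eq_zero_of_ae (h : IsSolution T f E) (hT : 0 < T)
    (hE : ∀ᵐ t, fieldSup E t = 0) (t x : ℝ) : E t x = 0 := by
  have hEx : ∀ᵐ u, ∀ y, E u y = 0 := by
    filter_upwards [hE] with u hu y
    exact enorm_eq_zero.1 (le_antisymm ((h.enorm_field_le_fieldSup hT u y).trans hu.le) zero_le)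
  have hmode : ∀ n, chargeMode T f n t = 0 := by
    intro n
    set ξ := freq T n with hξ
    -- No continuity of `E` in time is assumed. As the force vanishes for almost all times,
    -- Duhamel's formula from a slightly earlier time identifies the mode with the free evolution
    -- `Φ`, which is continuous and zero almost everywhere after `t₀`.
    set t₀ := t - 1 with ht₀
    set Φ : ℝ → ℂ := fun τ => moment T ξ (fun p => f t₀ p.1 p.2) (char (ξ * (τ - t₀))) with hΦ
    have hΦc : Continuous Φ := by
      have hw : IntegrableOn (fun p : ℝ × ℝ => |f t₀ p.1 p.2|) (Ioc 0 T ×ˢ univ) :=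
        (h.integrable t₀).abs
      refine continuous_of_dominated (bound := fun p => |f t₀ p.1 p.2|)
        (fun τ => (integrable_moment (h.integrable t₀) (by fun_prop) (C := 1)
          fun v => (norm_char _ v).le).aestronglyMeasurable)
        (fun τ => Filter.Eventually.of_forall fun p => ?_) hw
        (Filter.Eventually.of_forall fun p => by fun_prop)
      rw [norm_mul, norm_mul, norm_char, norm_char, mul_one, mul_one, Complex.norm_real,
        Real.norm_eq_abs]
    have hmild : ∀ τ, t₀ ≤ τ → chargeMode T f n τ = Φ τ := by
      intro τ hτ
      have h1 := h.moment_duhamel hT (n + 1 : ℤ) hτ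
      have h2 : ∫ u in t₀..τ, 2 * Real.pi * Complex.I * (((n + 1 : ℤ) : ℝ) / T * (τ - u) : ℝ) *
          moment T (((n + 1 : ℤ) : ℝ) / T) (fun p => E u p.1 * f u p.1 p.2)
            (char (((n + 1 : ℤ) : ℝ) / T * (τ - u))) = 0 := by
        refine intervalIntegral.integral_zero_ae ?_
        filter_upwards [hEx] with u hu _
        simp [moment, hu]
      rw [h2, sub_eq_zero] at h1
      exact h1
    have hae : ∀ᵐ u, chargeMode T f n u = 0 := by
      filter_upwards [hEx] with u hu
      have h1 := h.fourier_poisson hT (n := (n + 1 : ℤ)) (by positivity) u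
      simp only [hu, Complex.ofReal_zero, zero_mul, integral_zero, mul_zero] at h1
      exact neg_eq_zero.1 h1.symm
    have heq : EqOn Φ (fun _ => 0) (Ioi t₀) := by
      refine Measure.eqOn_open_of_ae_eq (μ := volume) ?_ isOpen_Ioi hΦc.continuousOn
        continuousOn_const
      filter_upwards [ae_restrict_of_ae hae, ae_restrict_mem measurableSet_Ioi] with u hu hu'
      rw [← hmild u hu'.le, hu]
    have ht : t₀ < t := by rw [ht₀]; linarith
    rw [hmild t ht.le]
    exact heq ht
  have hsup := h.sq_fieldSup_le hT t
  simp only [hmode, enorm_zero, ne_eq, OfNat.ofNat_ne_zero, not_false_eq_true, zero_pow, tsum_zero,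
    mul_zero, nonpos_iff_eq_zero, pow_eq_zero_iff] at hsup
  exact enorm_eq_zero.1 (le_antisymm ((h.enorm_field_le_fieldSup hT t x).trans hsup.le) zero_le)

end IsSolution

theorem exists_pos_mul_sq_le_one {P : ℝ≥0∞} (hP : P ≠ ⊤) :
    ∃ ε : ℝ, 0 < ε ∧ P * ENNReal.ofReal ε ^ 2 ≤ 1 := by
  have hp : 0 ≤ P.toReal := ENNReal.toReal_nonneg
  have hε : 0 < (P.toReal + 1)⁻¹ := by positivity
  refine ⟨(P.toReal + 1)⁻¹, hε, ?_⟩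
  rw [← ENNReal.ofReal_toReal hP, ENNReal.toReal_ofReal hp, ← ENNReal.ofReal_pow hε.le,
    ← ENNReal.ofReal_mul hp, ENNReal.ofReal_le_one, inv_pow, ← div_eq_mul_inv,
    div_le_one (by positivity)]
  nlinarith

/-- Near a homogeneous equilibrium, below the critical period, no solution with a nontrivial
electric field stays close to the equilibrium for all times. -/
theorem exists_pos_forall_field_eq_zero {s : ℝ} (hs : 3 / 2 < s) {f₀ : ℝ → ℝ}
    (hcont : Continuous f₀) (hmass : ∫ v : ℝ, f₀ v = 1) (hH : MemH s f₀) {T : ℝ} (hT : 0 < T)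
    (hT₀ : ENNReal.ofReal T < criticalPeriod f₀) :
    ∃ ε₀ : ℝ, 0 < ε₀ ∧ ∀ (f : ℝ → ℝ → ℝ → ℝ) (E : ℝ → ℝ → ℝ), IsSolution T f E →
      (∀ t : ℝ, mixedENorm T s (fun x v => f t x v - f₀ v) < ENNReal.ofReal ε₀) →
      ∀ t x : ℝ, E t x = 0 := by
  have h₀ := IsProfile.of_memH hcont hmass hH
  obtain ⟨A, hA, R, hest⟩ := exists_mode_estimate h₀ hs hT hT₀
  have hsum : ∑' n, ENNReal.ofReal ((freq T n)⁻¹ ^ 2) ≠ ⊤ := by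
    rw [← ENNReal.ofReal_tsum_of_nonneg (fun n => by positivity) (summable_inv_freq_sq T)]
    exact ENNReal.ofReal_ne_top
  set B := ENNReal.ofReal (2 * T⁻¹) ^ 2 *
    (ENNReal.ofReal (2 * Real.pi)⁻¹ ^ 2 * ∑' n, ENNReal.ofReal ((freq T n)⁻¹ ^ 2)) with hB
  have hBt : B ≠ ⊤ := by finiteness
  -- This is the smallness `2 B A δ ≤ 1` of the bootstrap, with `δ = T ε²`.
  obtain ⟨ε, hε, hsmall⟩ := exists_pos_mul_sq_le_one (P := 2 * (B * A * ENNReal.ofReal T))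
    (by finiteness)
  refine ⟨ε, hε, fun f E h hclose => h.field_eq_zero_of_ae hT ?_⟩
  have hmz := h.measurable_fieldSup hT
  have hzero := lintegral_eq_zero_of_modes (x := fun n t => ‖chargeMode T f n t‖ₑ ^ 2)
    (q := fun n t => weightedNormSq s fun η => nonlinearMode T f₀ f E n η t)
    (γ := fun n t => weightedNormSq s (perturbationMode T f₀ f n t))
    (ω := fun n τ => ENNReal.ofReal (sobolevWeight (-s) (freq T n * τ)))
    (z := fun t => fieldSup E t ^ 2) (w := fun n => ENNReal.ofReal ((freq T n)⁻¹ ^ 2))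
    (A := A) (B := B) (δ := ENNReal.ofReal T * ENNReal.ofReal ε ^ 2)
    (L := ENNReal.ofReal T ^ 2) (N := ENNReal.ofReal (2 * T) ^ 2) (R := R)
    (fun n => (h.measurable_chargeMode n).enorm.pow_const 2)
    (fun n => measurable_weightedNormSq (h.measurable_nonlinearMode hT h₀ n))
    (hmz.pow_const 2) hA hBt (by finiteness) (by finiteness) (by finiteness) hsum
    (fun n t => by
      have := ENNReal.ofReal_le_ofReal (h.norm_chargeMode_le hT n t)
      rw [ofReal_norm] at this
      gcongr)
    (fun t => by
      have := h.fieldSup_le hT t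
      gcongr)
    (h.sq_fieldSup_le hT)
    (fun t => (h.tsum_nonlinearMode_le hT h₀ t).trans (by
      rw [mul_right_comm]
      gcongr
      exact (hclose t).le))
    (fun t => (h.tsum_perturbationMode_le hT h₀ t).trans (by
      gcongr
      exact (hclose t).le))
    (fun n => by simp [sobolevWeight])
    (fun n => tendsto_sobolevWeight_neg (by linarith) (freq_pos hT n))
    (le_trans (le_of_eq (by ring)) hsmall)
    (fun n t₀ a b hta _ => hest f E h n t₀ a b hta)
  rw [lintegral_eq_zero_iff (hmz.pow_const 2)] at hzero
  filter_upwards [hzero] with t ht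
  exact pow_eq_zero_iff two_ne_zero |>.1 ht

end VlasovPoisson

end

theorem theorem3 (s : ℝ) (hs : 3 / 2 < s) (f₀ : ℝ → ℝ) (hcont : Continuous f₀)
    (hnonneg : ∀ v, 0 ≤ f₀ v) (hmass : ∫ v : ℝ, f₀ v = 1) (hH : VlasovPoisson.MemH s f₀)
    (T : ℝ) (hT : 0 < T) (hT₀ : ENNReal.ofReal T < VlasovPoisson.criticalPeriod f₀) :
    ∃ ε₀ : ℝ, 0 < ε₀ ∧
      ∀ (f : ℝ → ℝ → ℝ → ℝ) (E : ℝ → ℝ → ℝ), VlasovPoisson.IsSolution T f E →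
        (∀ t : ℝ, VlasovPoisson.mixedENorm T s (fun x v => f t x v - f₀ v) < ENNReal.ofReal ε₀) →
        ∀ t x : ℝ, E t x = 0 := by
  exact VlasovPoisson.exists_pos_forall_field_eq_zero hs hcont hmass hH hT hT₀
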